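/- **Setting.** Let $n\ge 1$, $0=x_0<x_1<\dots<x_n=1$, $0=q_0<q_1<\dots<q_n=1$, and let $\varrho(x)=\sum_{k=1}^n q_k 1_{[x_k,x_{k+1})}(x)$ on $[0,1]$ (the last interval contains $1$). Let $h\ge 0$ and let $N$ run through a strictly increasing sequence of natural numbers such that $x_kN$ is an integer for all $k$. For $\sigma,\tau\in\Sigma_N=\{-1,1\}^N$ let $q_{\mathrm L}(\sigma,\tau)$ be $1/N$ times the length of the longest common initial segment of $\sigma$ and $\tau$. For each $N$ let $(\mathrm{GREM}_N(\sigma))_{\sigma\in\Sigma_N}$ be a centred Gaussian process with covariance $\varrho(q_{\mathrm L}(\sigma,\tau))$, all on one probability space (with any dependence between different $N$). Put $$X_N(h,\sigma)=\mathrm{GREM}_N(\sigma)+\frac{h}{\sqrt N}\sum_{i=1}^N\sigma_i,\qquad M_N(h)=N^{-1/2}\max_{\sigma\in\Sigma_N}X_N(h,\sigma).$$ **REM constants.** Let $I(t)=\frac12[(1-t)\log(1-t)+(1+t)\log(1+t)]$ and $\rho(t)=\sqrt{2(\log 2-I(t))}$ on $[-1,1]$. For $h\ge 0$ let $t_*(h)$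 be the unique maximiser of $t\mapsto\rho(t)+ht$ on $[-1,1]$, $M(h)=\rho(t_*(h))+h\,t_*(h)$, and, with $t_*=t_*(h)$, $$A_N(h)=\frac1{\rho(t_*)\sqrt N},\qquad B_N(h)=M(h)\sqrt N+\frac{A_N(h)}2\log\frac{A_N(h)^2}{2\pi(1-t_*^2)\,(I''(t_*)+h^2)}.$$ **Coarse graining.** For $1\le j\le k\le n$ let $\theta_{j,k}=\frac{q_k-q_{j-1}}{x_k-x_{j-1}}$ and $\widetilde\theta_{j,k}(h)=\theta_{j,k}\,\rho\bigl(t_*(\theta_{j,k}^{-1/2}h)\bigr)^{-2}$. Put $J_0=0$ and, as long as $J_{l-1}<n$, $$J_l=\min\bigl\{J\in\{J_{l-1}+1,\dots,n\}:\ \widetilde\theta_{J_{l-1}+1,J}(h)>\widetilde\theta_{J+1,k}(h)\ \text{ for all } J<k\le n\bigr\};$$ let $m=m(h)$ be the index with $J_m=n$. For $1\le l\le m$ put $\bar q_l=q_{J_l}-q_{J_{l-1}}$, $\bar x_l=x_{J_l}-x_{J_{l-1}}$, $\bar\theta_l=\theta_{J_{l-1}+1,J_l}=\bar q_l/\bar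 x_l$, $\bar\gamma_l=\widetilde\theta_{J_{l-1}+1,J_l}(h)^{1/2}$, and $$u_{N,\varrho,h}(x)=\sum_{l=1}^m\bar q_l^{1/2}B_{\bar x_lN}\bigl(\bar\theta_l^{-1/2}h\bigr)+N^{-1/2}x,\qquad \mathcal E_N(h)=\sum_{\sigma\in\Sigma_N}\delta_{u_{N,\varrho,h}^{-1}(X_N(h,\sigma))}.$$ **Cascade.** Let $\mathcal P_m=\sum_{\alpha\in\mathbb N^m}\delta_{(\mathcal P^{(1)}(\alpha_1),\,\mathcal P^{(2)}_{\alpha_1}(\alpha_2),\,\dots,\,\mathcal P^{(m)}_{\alpha_1,\dots,\alpha_{m-1}}(\alpha_m))}$, where the $\mathcal P^{(l)}_{\alpha_1,\dots,\alpha_{l-1}}$ are Poisson point processes on $\mathbb R$ with intensity $e^{-x}dx$, enumerated measurably by $\mathbb N$ and independent of each other together with their enumerations. Let $E(e_1,\dots,e_m)=\sum_{l=1}^m\bar\gamma_le_l$. **Theorem.** 1. The image $\int_{\mathbb R^m}\delta_{E(e)}\,\mathcal P_m(de)$ of $\mathcal P_m$ under $E$ is almost surely a locally finite measure on $\mathbb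 R$. Assume that there are no ties inside the blocks, that is, $\widetilde\theta_{j,J_l}(h)>\widetilde\theta_{J_{l-1}+1,J_l}(h)$ for all $1\le l\le m$ and $J_{l-1}+1<j\le J_l$. Then $$\mathcal E_N(h)\xrightarrow[N\to\infty]{}\int_{\mathbb R^m}\delta_{E(e)}\,\mathcal P_m(de)$$ weakly (in distribution), as random elements of the space of locally finite measures on $\mathbb R$ with the vague topology. 2. In all cases, with or without ties, $$M_N(h)\xrightarrow[N\to\infty]{}\sum_{l=1}^{m}(\bar q_l\bar x_l)^{1/2}\,M\bigl(\bar\theta_l^{-1/2}h\bigr)\qquad\text{almost surely and in }L^1.$$ -/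

import Mathlib

open MeasureTheory ProbabilityTheory Filter Topology Set
open scoped ENNReal NNReal CompactlySupported

noncomputable section

namespace GREM

/-! ### Cramér's entropy and the constants of the random energy model -/

/-- Cramér's entropy function `I`, considered on `[-1, 1]`. -/
def cramerI (t : ℝ) : ℝ :=
  (1 / 2) * ((1 - t) * Real.log (1 - t) + (1 + t) * Real.log (1 + t))

/-- `ρ(t) = √(2 (log 2 - I(t)))`. -/
def rho (t : ℝ) : ℝ := Real.sqrt (2 * (Real.log 2 - cramerI t))

lemma continuous_rho : Continuous rho := by
  have h1 : Continuous fun t : ℝ => (1 - t) * Real.log (1 - t) :=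
    Real.continuous_mul_log.comp (continuous_const.sub continuous_id)
  have h2 : Continuous fun t : ℝ => (1 + t) * Real.log (1 + t) :=
    Real.continuous_mul_log.comp (continuous_const.add continuous_id)
  unfold rho cramerI
  fun_prop

lemma exists_isMaxOn_rho (h : ℝ) :
    ∃ t ∈ Icc (-1 : ℝ) 1, IsMaxOn (fun s => rho s + h * s) (Icc (-1) 1) t :=
  isCompact_Icc.exists_isMaxOn ⟨0, by norm_num⟩
    (continuous_rho.add (continuous_const.mul continuous_id)).continuousOn

/-- The maximiser `t_*(h)` of `t ↦ ρ(t) + h t` over `[-1, 1]`. (It is unique, because this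
function is strictly concave on `[-1, 1]`.) -/
def tStar (h : ℝ) : ℝ := (exists_isMaxOn_rho h).choose

/-- `M(h) = max_{t ∈ [-1, 1]} (ρ(t) + h t)`. -/
def maxValue (h : ℝ) : ℝ := sSup ((fun t => rho t + h * t) '' Icc (-1) 1)

/-- The scale `A_N(h) = (ρ(t_*) √N)⁻¹`. -/
def scaleA (N h : ℝ) : ℝ := (rho (tStar h) * Real.sqrt N)⁻¹

/-- The centring
`B_N(h) = M(h) √N + (A_N(h) / 2) log (A_N(h)² / (2 π (1 - t_*²) (I''(t_*) + h²)))`. -/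
def centreB (N h : ℝ) : ℝ :=
  maxValue h * Real.sqrt N + scaleA N h / 2 *
    Real.log (scaleA N h ^ 2 /
      (2 * Real.pi * (1 - tStar h ^ 2) * (iteratedDeriv 2 cramerI (tStar h) + h ^ 2)))

/-! ### The model -/

/-- The discrete hypercube `{-1, 1}^N`. -/
abbrev Config (N : ℕ) : Type := Fin N → ℤˣ

/-- The lexicographic overlap: `1 / N` times the length of the longest common initial segment. -/
def lexOverlap {N : ℕ} (σ τ : Config N) : ℝ :=
  ((((Finset.range (N + 1)).filter fun k => ∀ i : Fin N, (i : ℕ) < k → σ i = τ i).sup id : ℕ) : ℝ)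
    / (N : ℝ)

/-- A discrete order parameter with `n` jumps: points `0 = x_0 < x_1 < ⋯ < x_n = 1` and values
`0 = q_0 < q_1 < ⋯ < q_n = 1`. Only the values of `x` and `q` at `0, …, n` are ever used. -/
structure OrderParameter (n : ℕ) where
  x : ℕ → ℝ
  q : ℕ → ℝ
  x_zero : x 0 = 0
  x_last : x n = 1
  x_lt : ∀ k < n, x k < x (k + 1)
  q_zero : q 0 = 0
  q_last : q n = 1
  q_lt : ∀ k < n, q k < q (k + 1)

/-- The energies with external field, for a realisation `g` of the GREM:
`X_N(h, σ) = g(σ) + (h / √N) ∑ i, σ_i`. -/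
def energy {N : ℕ} (h : ℝ) (g : Config N → ℝ) (σ : Config N) : ℝ :=
  g σ + h / Real.sqrt N * ∑ i, ((σ i : ℤ) : ℝ)

/-- The normalised ground state `M_N(h) = N^{-1/2} max_σ X_N(h, σ)`. -/
def groundState {N : ℕ} (h : ℝ) (g : Config N → ℝ) : ℝ :=
  (Real.sqrt N)⁻¹ *
    Finset.univ.sup' Finset.univ_nonempty (fun σ : Config N => energy h g σ)

namespace OrderParameter

variable {n : ℕ} (D : OrderParameter n)

/-- The step function `ϱ = ∑ k, q_k 1_{[x_k, x_{k+1})}` on `[0, 1]`; the last step contains `1`. -/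
def toFun (t : ℝ) : ℝ :=
  open Classical in
  ∑ k ∈ Finset.Icc 1 n, if D.x k ≤ t ∧ (k < n → t < D.x (k + 1)) then D.q k else 0

/-- `g` is a GREM on `{-1, 1}^N` with order parameter `ϱ`: a centred Gaussian process with
covariance `ϱ(q_L(σ, τ))`. -/
structure IsGREM (N : ℕ) {Ω : Type*} [MeasurableSpace Ω] (g : Config N → Ω → ℝ)
    (P : Measure Ω) : Prop where
  gaussian : IsGaussianProcess g P
  centred : ∀ σ, ∫ ω, g σ ω ∂P = 0
  covariance : ∀ σ τ, cov[g σ, g τ; P] = D.toFun (lexOverlap σ τ)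

/-! ### Coarse graining -/

/-- The slopes `θ_{j,k} = (q_k - q_{j-1}) / (x_k - x_{j-1})`, for `1 ≤ j ≤ k ≤ n`. -/
def slope (j k : ℕ) : ℝ := (D.q k - D.q (j - 1)) / (D.x k - D.x (j - 1))

/-- The modified slopes `θ_{j,k} ρ(t_*(θ_{j,k}^{-1/2} h))^{-2}`. -/
def modSlope (h : ℝ) (j k : ℕ) : ℝ :=
  D.slope j k / rho (tStar (h / Real.sqrt (D.slope j k))) ^ 2

/-- The coarse-graining indices: `J_0 = 0`, and `J_{l+1}` is the least `K ∈ {J_l + 1, …, n}` such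
that the modified slope of `J_l + 1, …, K` is larger than that of `K + 1, …, k` for every
`k ∈ {K + 1, …, n}`. -/
def J (h : ℝ) : ℕ → ℕ
  | 0 => 0
  | l + 1 => sInf {K : ℕ | J h l < K ∧ K ≤ n ∧
      ∀ k, K < k → k ≤ n → D.modSlope h (K + 1) k < D.modSlope h (J h l + 1) K}

/-- The number `m(h)` of coarse-grained blocks: the first `l` with `J_l = n`. -/
def m (h : ℝ) : ℕ := sInf {l : ℕ | D.J h l = n}

/-! The blocks are numbered `l = 0, …, m(h) - 1`; block `l` consists of the levels
`J_l + 1, …, J_{l+1}`. -/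

/-- The increment of `q` over block `l`. -/
def qBar (h : ℝ) (l : ℕ) : ℝ := D.q (D.J h (l + 1)) - D.q (D.J h l)

/-- The increment of `x` over block `l`. -/
def xBar (h : ℝ) (l : ℕ) : ℝ := D.x (D.J h (l + 1)) - D.x (D.J h l)

/-- The slope of block `l`. -/
def thetaBar (h : ℝ) (l : ℕ) : ℝ := D.slope (D.J h l + 1) (D.J h (l + 1))

/-- The square root of the modified slope of block `l`. -/
def gammaBar (h : ℝ) (l : ℕ) : ℝ := Real.sqrt (D.modSlope h (D.J h l + 1) (D.J h (l + 1)))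

/-- No ties inside a block: the modified slope of every proper final segment of a block is
strictly larger than the modified slope of the whole block. -/
def StrictBlocks (h : ℝ) : Prop :=
  ∀ l < D.m h, ∀ j, D.J h l + 1 < j → j ≤ D.J h (l + 1) →
    D.modSlope h (D.J h l + 1) (D.J h (l + 1)) < D.modSlope h j (D.J h (l + 1))

/-- The scaling function `u_{N,ϱ,h}`. -/
def scaling (h : ℝ) (N : ℕ) (y : ℝ) : ℝ :=
  ∑ l ∈ Finset.range (D.m h), Real.sqrt (D.qBar h l) *
      centreB (D.xBar h l * N) (h / Real.sqrt (D.thetaBar h l))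
    + (Real.sqrt N)⁻¹ * y

/-- The inverse `u_{N,ϱ,h}⁻¹` of the scaling function. -/
def scalingInv (h : ℝ) (N : ℕ) (y : ℝ) : ℝ :=
  Real.sqrt N * (y - ∑ l ∈ Finset.range (D.m h), Real.sqrt (D.qBar h l) *
      centreB (D.xBar h l * N) (h / Real.sqrt (D.thetaBar h l)))

lemma scaling_scalingInv (h : ℝ) {N : ℕ} (hN : 0 < N) (y : ℝ) :
    D.scaling h N (D.scalingInv h N y) = y ∧ D.scalingInv h N (D.scaling h N y) = y := by
  have : Real.sqrt N ≠ 0 := (Real.sqrt_pos.2 (by exact_mod_cast hN)).ne'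
  constructor <;> simp [scaling, scalingInv, this]

/-- The limit of the ground state. -/
def limitGroundState (h : ℝ) : ℝ :=
  ∑ l ∈ Finset.range (D.m h), Real.sqrt (D.qBar h l * D.xBar h l) *
    maxValue (h / Real.sqrt (D.thetaBar h l))

/-- The linear map `E(e_1, …, e_m) = γ̄_1 e_1 + ⋯ + γ̄_m e_m`. -/
def linearE (h : ℝ) (e : Fin (D.m h) → ℝ) : ℝ :=
  ∑ l : Fin (D.m h), D.gammaBar h l * e l

end OrderParameter

/-! ### Locally finite measures, vague topology and point processes -/

/-- Locally finite Borel measures on the real line. -/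
structure LocFinMeasure where
  toMeasure : Measure ℝ
  locFin : IsLocallyFiniteMeasure toMeasure

namespace LocFinMeasure

/-- The vague topology: the coarsest topology for which `μ ↦ ∫ φ dμ` is continuous for every
continuous `φ` with compact support. -/
instance : TopologicalSpace LocFinMeasure :=
  ⨅ φ : C_c(ℝ, ℝ), TopologicalSpace.induced (fun μ => ∫ x, φ x ∂μ.toMeasure) inferInstance

/-- The Borel σ-algebra of the vague topology. -/
instance : MeasurableSpace LocFinMeasure := borel LocFinMeasure

instance : BorelSpace LocFinMeasure := ⟨rfl⟩

open Classical in
/-- A measure as a locally finite measure (with value `0` if it is not locally finite). -/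
def ofMeasure (μ : Measure ℝ) : LocFinMeasure :=
  if hμ : IsLocallyFiniteMeasure μ then ⟨μ, hμ⟩ else ⟨0, inferInstance⟩

end LocFinMeasure

/-- The random measure `ξ` is a Poisson point process with intensity measure `Λ`. -/
structure IsPoissonProcess {Ω S : Type*} [MeasurableSpace Ω] [MeasurableSpace S]
    (ξ : Ω → Measure S) (Λ : Measure S) (P : Measure Ω) : Prop where
  measurable : Measurable ξ
  law : ∀ B : Set S, MeasurableSet B → Λ B ≠ ∞ →
    P.map (fun ω => ξ ω B) =
      (poissonMeasure (Λ B).toNNReal).map (fun k : ℕ => (k : ℝ≥0∞))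
  indep : ∀ (r : ℕ) (B : Fin r → Set S), (∀ i, MeasurableSet (B i)) →
    (∀ i j, i ≠ j → Disjoint (B i) (B j)) → iIndepFun (fun i ω => ξ ω (B i)) P

/-- The measure `e^{-x} dx` on the real line. -/
def expIntensity : Measure ℝ := volume.withDensity fun x => ENNReal.ofReal (Real.exp (-x))

/-- `p l β` enumerates the points of the process of level `l` attached to the multi-index
`β = (α_1, …, α_l)` (levels are numbered `0, …, m - 1`). All these processes are Poisson with
intensity `e^{-x} dx`, and they are independent, together with their enumerations. -/
structure IsCascadeFamily {m : ℕ} {Ω : Type*} [MeasurableSpace Ω]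
    (p : (l : Fin m) → (Fin (l : ℕ) → ℕ) → ℕ → Ω → ℝ) (P : Measure Ω) : Prop where
  measurable : ∀ l β j, Measurable (p l β j)
  poisson : ∀ l β, IsPoissonProcess
    (fun ω => Measure.sum fun j : ℕ => Measure.dirac (p l β j ω)) expIntensity P
  indep : iIndepFun
    (fun (i : (l : Fin m) × (Fin (l : ℕ) → ℕ)) (ω : Ω) (j : ℕ) => p i.1 i.2 j ω) P

/-- The cascade point process `P_m` on `ℝ^m`: a sum of Dirac masses over `α ∈ ℕ^m`, where the
coordinate `l` of the point with label `α` is the point number `α_l` of the process attached to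
`(α_0, …, α_{l-1})`. -/
def cascade {m : ℕ} {Ω : Type*} (p : (l : Fin m) → (Fin (l : ℕ) → ℕ) → ℕ → Ω → ℝ) (ω : Ω) :
    Measure (Fin m → ℝ) :=
  Measure.sum fun α : Fin m → ℕ =>
    Measure.dirac fun l : Fin m => p l (fun i => α (Fin.castLE l.isLt.le i)) (α l) ω

namespace OrderParameter

variable {n : ℕ} (D : OrderParameter n)

/-- The point process `∑ σ, δ_{u⁻¹(X_N(h, σ))}` of the rescaled energies. -/
def energyPoints (h : ℝ) {N : ℕ} (g : Config N → ℝ) : LocFinMeasure where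
  toMeasure := ∑ σ : Config N, Measure.dirac (D.scalingInv h N (energy h g σ))
  locFin := inferInstance

/-- The image of the cascade point process under the linear map `E`. -/
def limitPoints (h : ℝ) {Ω : Type*}
    (p : (l : Fin (D.m h)) → (Fin (l : ℕ) → ℕ) → ℕ → Ω → ℝ) (ω : Ω) : Measure ℝ :=
  (cascade p ω).map (D.linearE h)

end OrderParameter

end GREM

end

/-! Multiply all energies by √N. The GREM is then the sum of independent centred Gaussian variables
along the branches of the binary tree, so the expectation of ∏_σ ψ(√N X_N(σ)) is a deterministic
recursion over the levels, each level acting through `levelMap` (`integral_prod_eq_iter`). If ψ is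
the indicator of a half-line, this is the distribution function of the ground state; if ψ = e^{-φ},
it is the Laplace functional of the point process.

A block of slope θ is governed by the tilt λ with log(2 cosh λh) - λh tanh λh = λ²θ/2 (`tilt_spec`).
The modified slope is λ⁻², an increasing function of θ (`modSlope_lt_iff`), so the coarse graining
finds the vertices of the concave hull of the order parameter (`J_succ_spec`), and the tilts
strictly increase from block to block.

Ground state. The upper tail is a first-moment bound with the tilt of each block
(`one_sub_iter_below_le`). For the lower tail take a slightly smaller tilt: as the order parameter
lies below its hull, every initial segment of a block then has exponentially many paths near the
prescribed energies, and independence makes failure superexponentially unlikely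
(`iter_le_exp_neg_exp`). Ties do no harm here. Borel–Cantelli gives almost sure convergence, and a
uniform second-moment bound gives convergence in L¹.

Point process. In a block without ties the order parameter lies strictly below the chord, points
sharing part of their path become negligible, and the recursion is exp(-expected number of points)
up to vanishing errors (`iter_mem_Icc_exp`). The rescaled intensity has density e^{-x} times a
factor tending to 1 (`integral_intensity_eq`, `tendsto_densityCorr`). In the limit a block therefore
acts as R ↦ 1 - exp(-∫ R(y + γx) e^{-x} dx) (`tendsto_iter_block`); dominated convergence applies
because the next block has a larger tilt. The Laplace functional of the cascade obeys the same
recursion (`lintegral_nexp_cascade`, `one_sub_nexp_cascadeIter`), and its exponential bounds also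
give local finiteness. Convergence of Laplace functionals yields convergence in distribution because
the vague topology is induced by a map into a compact cube (`tendstoInDistribution_of_laplace`). -/

noncomputable section

namespace GREM

/-! ### The hierarchical Gaussian field on the binary tree -/

/-- The magnetisation `∑ i, σ_i`. -/
def spinSum {N : ℕ} (σ : Config N) : ℝ := ∑ i, ((σ i : ℤ) : ℝ)

@[simp] lemma spinSum_zero (σ : Config 0) : spinSum σ = 0 := by simp [spinSum]

lemma spinSum_cons {N : ℕ} (s : ℤˣ) (σ : Config N) :
    spinSum (Fin.cons s σ : Config (N + 1)) = ((s : ℤ) : ℝ) + spinSum σ := by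
  simp [spinSum, Fin.sum_univ_succ]

lemma sum_config_succ {M : Type*} [AddCommMonoid M] {N : ℕ} (f : Config (N + 1) → M) :
    ∑ σ, f σ = ∑ s : ℤˣ, ∑ τ : Config N, f (Fin.cons s τ) := by
  rw [← (Fin.consEquiv fun _ : Fin (N + 1) => ℤˣ).sum_comp, Fintype.sum_prod_type]
  rfl

lemma prod_config_succ {M : Type*} [CommMonoid M] {N : ℕ} (f : Config (N + 1) → M) :
    ∏ σ, f σ = ∏ s : ℤˣ, ∏ τ : Config N, f (Fin.cons s τ) := by
  rw [← (Fin.consEquiv fun _ : Fin (N + 1) => ℤˣ).prod_comp, Fintype.prod_prod_type]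
  rfl

/-- The law of the field on the leaves of the binary tree of depth `r` which is the sum of
independent centred Gaussian variables along the branches, the nodes at depth `i + 1` having
variance `v i`. -/
def treeLaw : (r : ℕ) → (ℕ → ℝ≥0) → Measure (Config r → ℝ)
  | 0, _ => Measure.dirac 0
  | r + 1, v => (Measure.pi fun _ : ℤˣ =>
      (gaussianReal 0 (v 0)).prod (treeLaw r fun i => v (i + 1))).map
        fun f σ => (f (σ 0)).1 + (f (σ 0)).2 (Fin.tail σ)

lemma measurable_branch (r : ℕ) : Measurable
    fun (f : ℤˣ → ℝ × (Config r → ℝ)) (σ : Config (r + 1)) =>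
      (f (σ 0)).1 + (f (σ 0)).2 (Fin.tail σ) := by
  fun_prop

instance (r : ℕ) (v : ℕ → ℝ≥0) : IsProbabilityMeasure (treeLaw r v) := by
  induction r generalizing v with
  | zero => unfold treeLaw; infer_instance
  | succ r ih =>
    have := ih fun i => v (i + 1)
    unfold treeLaw
    exact Measure.isProbabilityMeasure_map (measurable_branch r).aemeasurable

/-- The two subtrees below the root are independent, so the product over the leaves factors over the
first spin. The bound by 1 gives the integrability needed for Fubini. -/
lemma integral_treeLaw_succ {𝕜 : Type*} [RCLike 𝕜] {r : ℕ} (v : ℕ → ℝ≥0)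
    {φ : Config (r + 1) → ℝ → 𝕜} (hφ : ∀ σ, Measurable (φ σ)) (hb : ∀ σ x, ‖φ σ x‖ ≤ 1) :
    ∫ f, ∏ σ, φ σ (f σ) ∂treeLaw (r + 1) v =
      ∏ s : ℤˣ, ∫ a, ∫ f, ∏ τ : Config r, φ (Fin.cons s τ) (a + f τ)
        ∂treeLaw r (fun i => v (i + 1)) ∂gaussianReal 0 (v 0) := by
  have hmeas : Measurable fun f : Config (r + 1) → ℝ => ∏ σ, φ σ (f σ) :=
    Finset.measurable_prod _ fun σ _ => (hφ σ).comp (measurable_pi_apply σ)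
  have hmeas' (s : ℤˣ) : Measurable fun p : ℝ × (Config r → ℝ) =>
      ∏ τ : Config r, φ (Fin.cons s τ) (p.1 + p.2 τ) :=
    Finset.measurable_prod _ fun τ _ => (hφ _).comp (by fun_prop)
  rw [treeLaw, integral_map (measurable_branch r).aemeasurable hmeas.aestronglyMeasurable]
  simp_rw [prod_config_succ, Fin.cons_zero, Fin.tail_cons]
  rw [integral_fintype_prod_eq_prod (𝕜 := 𝕜)
    (f := fun s (p : ℝ × (Config r → ℝ)) => ∏ τ : Config r, φ (Fin.cons s τ) (p.1 + p.2 τ))]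
  refine Finset.prod_congr rfl fun s _ => ?_
  rw [integral_prod]
  refine Integrable.of_bound (hmeas' s).aestronglyMeasurable 1 (ae_of_all _ fun p => ?_)
  rw [norm_prod]
  exact Finset.prod_le_one (fun _ _ => norm_nonneg _) fun _ _ => hb _ _

/-- The covariance of the tree field. -/
def treeCov {r : ℕ} (v : ℕ → ℝ≥0) (σ τ : Config r) : ℝ :=
  ∑ i : Fin r, if ∀ j ≤ i, σ j = τ j then (v i : ℝ) else 0

lemma treeCov_cons {r : ℕ} (v : ℕ → ℝ≥0) (s t : ℤˣ) (σ τ : Config r) :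
    treeCov v (Fin.cons s σ : Config (r + 1)) (Fin.cons t τ) =
      if s = t then (v 0 : ℝ) + treeCov (fun i => v (i + 1)) σ τ else 0 := by
  unfold treeCov
  rw [Fin.sum_univ_succ]
  have h0 : (∀ j ≤ (0 : Fin (r + 1)), (Fin.cons s σ : Config (r + 1)) j =
      (Fin.cons t τ : Config (r + 1)) j) ↔ s = t := by
    simp
  have h1 (i : Fin r) : (∀ j ≤ i.succ, (Fin.cons s σ : Config (r + 1)) j =
      (Fin.cons t τ : Config (r + 1)) j) ↔ s = t ∧ ∀ j ≤ i, σ j = τ j := by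
    rw [Fin.forall_fin_succ]
    simp
  simp_rw [h0, h1]
  by_cases hst : s = t <;> simp [hst]

open Complex in
-- Induction on the depth: the variable of a first node is shared by all leaves below it, hence
-- contributes (∑ c)² times its variance, and the rest comes from the subtrees.
lemma integral_treeLaw_exp {r : ℕ} (v : ℕ → ℝ≥0) (c : Config r → ℝ) :
    ∫ f, ∏ σ, cexp (c σ * f σ * I) ∂treeLaw r v =
      cexp (-(((∑ σ, ∑ τ, c σ * c τ * treeCov v σ τ : ℝ) : ℂ)) / 2) := by
  induction r generalizing v with
  | zero => simp [treeLaw, treeCov]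
  | succ r ih =>
    have hb (σ : Config (r + 1)) (x : ℝ) : ‖cexp (c σ * x * I)‖ ≤ 1 := by
      rw [← ofReal_mul, norm_exp_ofReal_mul_I]
    rw [integral_treeLaw_succ (φ := fun σ x => cexp (c σ * x * I)) v (fun σ => by fun_prop) hb]
    have key (s : ℤˣ) : ∫ a, ∫ f, ∏ τ : Config r,
        cexp (c (Fin.cons s τ) * ((a + f τ : ℝ) : ℂ) * I) ∂treeLaw r (fun i => v (i + 1))
          ∂gaussianReal 0 (v 0) =
        cexp (-((((∑ τ, c (Fin.cons s τ)) ^ 2 * v 0 + ∑ σ, ∑ τ, c (Fin.cons s σ) *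
          c (Fin.cons s τ) * treeCov (fun i => v (i + 1)) σ τ : ℝ) : ℂ)) / 2) := by
      have h1 (a : ℝ) (f : Config r → ℝ) :
          ∏ τ : Config r, cexp (c (Fin.cons s τ) * ((a + f τ : ℝ) : ℂ) * I) =
          cexp ((∑ τ, c (Fin.cons s τ) : ℝ) * a * I) *
            ∏ τ : Config r, cexp (c (Fin.cons s τ) * f τ * I) := by
        rw [← exp_sum, ← exp_sum, ← exp_add]
        congr 1
        push_cast
        rw [Finset.sum_mul, Finset.sum_mul, ← Finset.sum_add_distrib]
        exact Finset.sum_congr rfl fun _ _ => by ring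
      simp_rw [h1, integral_const_mul, integral_mul_const]
      rw [ih, ← charFun_apply_real, charFun_gaussianReal, ← exp_add]
      congr 1
      push_cast
      ring
    simp_rw [key]
    rw [← exp_sum]
    congr 1
    rw [← Finset.sum_div, Finset.sum_neg_distrib, ← ofReal_sum]
    refine congrArg (fun x : ℝ => -(x : ℂ) / 2) ?_
    rw [sum_config_succ]
    refine Finset.sum_congr rfl fun s _ => ?_
    simp_rw [sum_config_succ (N := r), treeCov_cons]
    rw [sq, Finset.sum_mul_sum, Finset.sum_mul, ← Finset.sum_add_distrib]
    refine Finset.sum_congr rfl fun σ _ => ?_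
    -- Leaves with different first spins are uncorrelated.
    rw [Finset.sum_eq_single s (fun t _ ht => by simp [ht.symm])
      (fun hs => absurd (Finset.mem_univ s) hs), Finset.sum_mul,
      ← Finset.sum_add_distrib]
    exact Finset.sum_congr rfl fun τ _ => by simp; ring

/-- A centred Gaussian vector indexed by the leaves with the covariance of the tree field has the
law of the tree field. -/
lemma map_eq_treeLaw {r : ℕ} (v : ℕ → ℝ≥0) {Ω : Type*} [MeasurableSpace Ω] {P : Measure Ω}
    {g : Config r → Ω → ℝ} (hg : IsGaussianProcess g P) (h0 : ∀ σ, ∫ ω, g σ ω ∂P = 0)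
    (hc : ∀ σ τ, cov[g σ, g τ; P] = treeCov v σ τ) :
    P.map (fun ω σ => g σ ω) = treeLaw r v := by
  have := hg.isProbabilityMeasure
  have hgl : HasGaussianLaw (fun ω σ => g σ ω) P := by
    have h := (hg.hasGaussianLaw Finset.univ).map
      (ContinuousLinearMap.pi fun σ : Config r =>
        ContinuousLinearMap.proj (R := ℝ) (⟨σ, Finset.mem_univ σ⟩ : Finset.univ))
    exact h
  have hae := hgl.aemeasurable
  have : IsProbabilityMeasure (P.map fun ω σ => g σ ω) := Measure.isProbabilityMeasure_map hae
  have h2 (σ : Config r) : MemLp (g σ) 2 P := (hg.hasGaussianLaw_eval σ).memLp_two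
  refine Measure.ext_of_charFunDual (funext fun L => ?_)
  have hL (f : Config r → ℝ) : L f = ∑ σ, L (Pi.single σ 1) * f σ := by
    conv_lhs => rw [← Finset.univ_sum_single f]
    rw [map_sum]
    refine Finset.sum_congr rfl fun σ _ => ?_
    rw [show Pi.single σ (f σ) = f σ • (Pi.single σ (1 : ℝ) : Config r → ℝ) by
      ext τ; by_cases h : τ = σ <;> simp [h], map_smul, smul_eq_mul, mul_comm]
  have hR : charFunDual (treeLaw r v) L = Complex.exp (-(((∑ σ, ∑ τ, L (Pi.single σ 1) *
      L (Pi.single τ 1) * treeCov v σ τ : ℝ) : ℂ)) / 2) := by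
    rw [← integral_treeLaw_exp, charFunDual_apply]
    congr 1
    ext f
    rw [← Complex.exp_sum, hL, ← Finset.sum_mul]
    push_cast
    rfl
  rw [hR, hgl.charFunDual_map_eq]
  have hLc : (L ∘ fun ω σ => g σ ω) = ∑ σ, (fun ω => L (Pi.single σ 1) * g σ ω) := by
    ext ω
    simp only [Function.comp_apply, Finset.sum_apply]
    exact hL _
  have hmean : ∫ ω, (L ∘ fun ω σ => g σ ω) ω ∂P = 0 := by
    rw [hLc]
    simp only [Finset.sum_apply]
    rw [integral_finsetSum _ fun σ _ => ((h2 σ).integrable (by norm_num)).const_mul _]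
    simp [integral_const_mul, h0]
  have hvar : Var[L ∘ fun ω σ => g σ ω; P] =
      ∑ σ, ∑ τ, L (Pi.single σ 1) * L (Pi.single τ 1) * treeCov v σ τ := by
    rw [hLc, variance_sum fun σ => (h2 σ).const_mul _]
    refine Finset.sum_congr rfl fun σ _ => Finset.sum_congr rfl fun τ _ => ?_
    rw [covariance_const_mul_left, covariance_const_mul_right, hc]
    ring
  rw [hmean, hvar]
  congr 1
  push_cast
  ring

/-! ### Reduction to a deterministic recursion over the levels -/

/-- `E ∏_σ F(y + h S_σ + Y_σ)`, with independent centred Gaussian variables `Y_σ` of variance `v`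
attached to the configurations of `d` spins. -/
def levelMap (h : ℝ) (d : ℕ) (v : ℝ≥0) (F : ℝ → ℝ) (y : ℝ) : ℝ :=
  ∏ σ : Config d, ∫ w, F (y + h * spinSum σ + w) ∂gaussianReal 0 v

/-- The composition of the level maps of the levels `k, …, k + r - 1`. -/
def iter (h : ℝ) (d : ℕ → ℕ) (v : ℕ → ℝ≥0) : ℕ → ℕ → (ℝ → ℝ) → ℝ → ℝ
  | 0, _, ψ => ψ
  | r + 1, k, ψ => levelMap h (d k) (v k) (iter h d v r (k + 1) ψ)

lemma iter_add (h : ℝ) (d : ℕ → ℕ) (v : ℕ → ℝ≥0) (r s k : ℕ) (ψ : ℝ → ℝ) :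
    iter h d v (r + s) k ψ = iter h d v r k (iter h d v s (k + r) ψ) := by
  induction r generalizing k with
  | zero => simp [iter]
  | succ r ih => rw [show r + 1 + s = (r + s) + 1 by ring, iter, iter, ih, add_assoc, add_comm 1 r]

/-- `E ∏_σ ψ(y + h S_σ + f_σ)` for the tree field `f`. -/
def treeProd (h : ℝ) (r : ℕ) (v : ℕ → ℝ≥0) (ψ : ℝ → ℝ) (y : ℝ) : ℝ :=
  ∫ f, ∏ σ, ψ (y + h * spinSum σ + f σ) ∂treeLaw r v

lemma treeProd_zero (h : ℝ) (v : ℕ → ℝ≥0) (ψ : ℝ → ℝ) (y : ℝ) :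
    treeProd h 0 v ψ y = ψ y := by
  simp [treeProd, treeLaw]

lemma treeProd_succ (h : ℝ) (r : ℕ) (v : ℕ → ℝ≥0) {ψ : ℝ → ℝ} (hψ : Measurable ψ)
    (hb : ∀ x, |ψ x| ≤ 1) (y : ℝ) :
    treeProd h (r + 1) v ψ y =
      ∏ s : ℤˣ, ∫ a, treeProd h r (fun i => v (i + 1)) ψ (y + h * ((s : ℤ) : ℝ) + a)
        ∂gaussianReal 0 (v 0) := by
  rw [treeProd, integral_treeLaw_succ (φ := fun σ x => ψ (y + h * spinSum σ + x)) v
    (fun σ => by fun_prop) fun σ x => hb _]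
  refine Finset.prod_congr rfl fun s _ => integral_congr_ae (ae_of_all _ fun a => ?_)
  simp only [treeProd, spinSum_cons]
  congr 1
  ext f
  exact Finset.prod_congr rfl fun τ _ => by congr 1; ring

/-- All the variance of a level sits at its last node. The earlier nodes are degenerate, so their
spins only enter through the field, and the whole level becomes one Gaussian variable per
configuration. -/
lemma treeProd_add (h : ℝ) (d r : ℕ) (v : ℕ → ℝ≥0) (hv : ∀ i < d, v i = 0) {ψ : ℝ → ℝ}
    (hψ : Measurable ψ) (hb : ∀ x, |ψ x| ≤ 1) (y : ℝ) :
    treeProd h (r + (d + 1)) v ψ y =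
      levelMap h (d + 1) (v d) (treeProd h r (fun i => v (i + (d + 1))) ψ) y := by
  induction d generalizing v y with
  | zero =>
    rw [zero_add, treeProd_succ h r v hψ hb, levelMap, prod_config_succ]
    simp [spinSum_cons]
  | succ d ih =>
    rw [← add_assoc r, treeProd_succ h _ v hψ hb, levelMap, prod_config_succ]
    refine Finset.prod_congr rfl fun s _ => ?_
    rw [hv 0 (by omega), gaussianReal_zero_var, integral_dirac,
      ih (fun i => v (i + 1)) (fun i hi => hv _ (by omega)), levelMap]
    simp only [spinSum_cons]
    refine Finset.prod_congr rfl fun τ _ => ?_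
    congr 1
    ext w
    rw [show y + h * ((s : ℤ) : ℝ) + 0 + h * spinSum τ + w =
      y + h * (((s : ℤ) : ℝ) + spinSum τ) + w by ring]
    rfl

/-- The variance of the nodes at depth `i + 1`, when level `k` has `d k` spins and variance
`v k`. -/
def nodeVar (n : ℕ) (d : ℕ → ℕ) (v : ℕ → ℝ≥0) (i : ℕ) : ℝ≥0 :=
  ∑ k ∈ Finset.range n, if i + 1 = ∑ j ∈ Finset.range (k + 1), d j then v k else 0

lemma strictMono_sum_range {d : ℕ → ℕ} {n : ℕ} (hd : ∀ k < n, 0 < d k) {j k : ℕ} (hjk : j < k)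
    (hk : k ≤ n) : ∑ i ∈ Finset.range j, d i < ∑ i ∈ Finset.range k, d i := by
  induction k with
  | zero => omega
  | succ k ih =>
    rw [Finset.sum_range_succ]
    have := hd k (by omega)
    rcases (Nat.lt_succ_iff.1 hjk).lt_or_eq with h | h
    · have := ih h (by omega); omega
    · subst h; omega

/-- Levels are peeled off from the top. Since every level is nonempty, the level ends are distinct
depths, so `nodeVar` is `v k` at the end of level `k` and zero strictly inside it. -/
lemma treeProd_eq_iter (h : ℝ) (n : ℕ) (d : ℕ → ℕ) (v : ℕ → ℝ≥0) (hd : ∀ k < n, 0 < d k)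
    {ψ : ℝ → ℝ} (hψ : Measurable ψ) (hb : ∀ x, |ψ x| ≤ 1) (r k : ℕ) (hrk : k + r = n) :
    treeProd h (∑ j ∈ Finset.range r, d (k + j))
      (fun i => nodeVar n d v (i + ∑ j ∈ Finset.range k, d j)) ψ = iter h d v r k ψ := by
  induction r generalizing k with
  | zero => ext y; simp [iter, treeProd_zero]
  | succ r ih =>
    ext y
    obtain ⟨e, he⟩ : ∃ e, d k = e + 1 := ⟨d k - 1, by have := hd k (by omega); omega⟩
    have hsum : ∑ j ∈ Finset.range (k + 1), d j = e + 1 + ∑ j ∈ Finset.range k, d j := by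
      rw [Finset.sum_range_succ, he, add_comm]
    have hlast : nodeVar n d v (e + ∑ j ∈ Finset.range k, d j) = v k := by
      rw [nodeVar, Finset.sum_eq_single k]
      · rw [if_pos]; omega
      · intro j hj hjk
        rw [if_neg]
        intro h'
        rw [show e + ∑ j ∈ Finset.range k, d j + 1 = ∑ j ∈ Finset.range (k + 1), d j by omega] at h'
        rcases lt_or_gt_of_ne hjk with h1 | h1
        · exact (strictMono_sum_range hd (show j + 1 < k + 1 by omega) (by omega)).ne' h'
        · exact (strictMono_sum_range hd (show k + 1 < j + 1 by omega)
            (by have := Finset.mem_range.1 hj; omega)).ne h'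
      · intro hk; exact absurd (Finset.mem_range.2 (by omega)) hk
    have hzero : ∀ i < e, nodeVar n d v (i + ∑ j ∈ Finset.range k, d j) = 0 := by
      intro i hi
      refine Finset.sum_eq_zero fun j hj => if_neg fun h' => ?_
      have hj := Finset.mem_range.1 hj
      rcases lt_trichotomy (j + 1) (k + 1) with h1 | h1 | h1
      · have : ∑ i ∈ Finset.range (j + 1), d i ≤ ∑ j ∈ Finset.range k, d j :=
          Finset.sum_le_sum_of_subset (Finset.range_mono (by omega))
        omega
      · rw [h1] at h'; omega
      · have := strictMono_sum_range hd h1 (by omega)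
        omega
    have hr : ∑ j ∈ Finset.range (r + 1), d (k + j) =
        ∑ j ∈ Finset.range r, d (k + 1 + j) + (e + 1) := by
      rw [Finset.sum_range_succ', add_zero, he]
      congr 1
      exact Finset.sum_congr rfl fun j _ => by congr 1; ring
    rw [hr, treeProd_add h e _ _ hzero hψ hb, iter, ← ih (k + 1) (by omega), hlast, he]
    congr 2
    ext i
    rw [hsum, add_assoc]

/-- Here `o` is the length of the common initial segment: a level contributes exactly when it ends
inside this segment. -/
lemma treeCov_nodeVar {N n : ℕ} {d : ℕ → ℕ} (v : ℕ → ℝ≥0)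
    (hd : ∀ k < n, 0 < d k) (σ τ : Config N) {o : ℕ} (ho : o ≤ N)
    (hσ : ∀ i : Fin N, (∀ j ≤ i, σ j = τ j) ↔ (i : ℕ) < o) :
    treeCov (nodeVar n d v) σ τ =
      ∑ k ∈ Finset.range n, if ∑ j ∈ Finset.range (k + 1), d j ≤ o then (v k : ℝ) else 0 := by
  unfold treeCov
  simp_rw [hσ]
  rw [Fin.sum_univ_eq_sum_range (fun i => if i < o then (nodeVar n d v i : ℝ) else 0) N,
    ← Finset.sum_filter]
  have : (Finset.range N).filter (fun i => i < o) = Finset.range o := by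
    ext i; simp; omega
  rw [this]
  simp only [nodeVar, NNReal.coe_sum]
  rw [Finset.sum_comm]
  refine Finset.sum_congr rfl fun k hk => ?_
  have hpos : 0 < ∑ j ∈ Finset.range (k + 1), d j := by
    have := strictMono_sum_range hd (show 0 < k + 1 by omega)
      (by have := Finset.mem_range.1 hk; omega)
    simpa using this
  split_ifs with h
  · rw [Finset.sum_eq_single (∑ j ∈ Finset.range (k + 1), d j - 1)]
    · rw [if_pos (by omega)]
    · intro i _ hi; rw [if_neg (by omega)]; rfl
    · intro h'; simp at h'; omega
  · refine Finset.sum_eq_zero fun i hi => ?_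
    have := Finset.mem_range.1 hi
    rw [if_neg (by omega)]; rfl

lemma exists_overlap {N : ℕ} (σ τ : Config N) :
    ∃ o ≤ N, lexOverlap σ τ = (o : ℝ) / N ∧
      ∀ i : Fin N, (∀ j ≤ i, σ j = τ j) ↔ (i : ℕ) < o := by
  set s := (Finset.range (N + 1)).filter fun k => ∀ i : Fin N, (i : ℕ) < k → σ i = τ i with hs
  have hne : s.Nonempty := ⟨0, by simp [hs]⟩
  have hmem : s.sup id ∈ s := by
    obtain ⟨k, hk, he⟩ := Finset.exists_mem_eq_sup s hne id
    rw [he]; exact hk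
  rw [hs, Finset.mem_filter, Finset.mem_range, ← hs] at hmem
  refine ⟨s.sup id, by omega, rfl, fun i => ⟨fun h => ?_, fun h j hj => hmem.2 j ?_⟩⟩
  · have hi : (i : ℕ) + 1 ∈ s := by
      rw [hs, Finset.mem_filter, Finset.mem_range]
      exact ⟨by omega, fun j hj => h j (Fin.le_def.2 (by omega))⟩
    exact Finset.le_sup (f := id) hi
  · exact lt_of_le_of_lt (Fin.le_def.1 hj) h

/-! ### Identification of the GREM with a tree field -/

namespace OrderParameter

variable {n : ℕ} (D : OrderParameter n)

lemma x_strictMono {j k : ℕ} (hjk : j < k) (hk : k ≤ n) : D.x j < D.x k := by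
  induction k with
  | zero => omega
  | succ k ih =>
    rcases (Nat.lt_succ_iff.1 hjk).lt_or_eq with h | h
    · exact (ih h (by omega)).trans (D.x_lt k (by omega))
    · subst h; exact D.x_lt j (by omega)

lemma q_strictMono {j k : ℕ} (hjk : j < k) (hk : k ≤ n) : D.q j < D.q k := by
  induction k with
  | zero => omega
  | succ k ih =>
    rcases (Nat.lt_succ_iff.1 hjk).lt_or_eq with h | h
    · exact (ih h (by omega)).trans (D.q_lt k (by omega))
    · subst h; exact D.q_lt j (by omega)

/-- Summation by parts: the step function is the sum of its jumps, which are the variances of the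
levels. The boundary term vanishes because `q 0 = 0`. -/
lemma toFun_eq (t : ℝ) :
    D.toFun t = ∑ k ∈ Finset.range n, if D.x (k + 1) ≤ t then D.q (k + 1) - D.q k else 0 := by
  classical
  have h1 : D.toFun t = ∑ k ∈ Finset.range n,
      ((if D.x (k + 1) ≤ t then D.q (k + 1) else 0) -
        if k + 1 < n ∧ D.x (k + 1 + 1) ≤ t then D.q (k + 1) else 0) := by
    unfold toFun
    rw [show Finset.Icc 1 n = Finset.Ico 1 (n + 1) from rfl, Finset.sum_Ico_eq_sum_range]
    refine Finset.sum_congr (by simp) fun k hk => ?_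
    rw [add_comm 1 k]
    by_cases hk' : k + 1 < n
    · have := D.x_lt (k + 1) hk'
      by_cases h1 : D.x (k + 1 + 1) ≤ t
      · simp [hk', h1, h1.not_gt, (this.le.trans h1)]
      · simp [hk', h1, not_le.1 h1]
    · simp [hk']
  have h2 : ∑ k ∈ Finset.range n, (if k + 1 < n ∧ D.x (k + 1 + 1) ≤ t then D.q (k + 1) else 0) =
      ∑ k ∈ Finset.range n, if D.x (k + 1) ≤ t then D.q k else 0 := by
    obtain _ | n' := n
    · simp
    · rw [Finset.sum_range_succ, Finset.sum_range_succ' (fun k => if D.x (k + 1) ≤ t then _ else _)]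
      congr 1
      · exact Finset.sum_congr rfl fun k hk => by
          simp [Nat.succ_lt_succ_iff.2 (Finset.mem_range.1 hk)]
      · simp [D.q_zero]
  rw [h1, Finset.sum_sub_distrib, h2, ← Finset.sum_sub_distrib]
  exact Finset.sum_congr rfl fun k _ => by split_ifs <;> simp

/-- The number of spins of level `k`. -/
def levelSize (N k : ℕ) : ℕ := ⌊(D.x (k + 1) - D.x k) * N⌋₊

/-- The variance of level `k`, for energies multiplied by `√N`. -/
def levelVar (N k : ℕ) : ℝ≥0 := ((D.q (k + 1) - D.q k) * N).toNNReal

lemma coe_levelVar (N : ℕ) {k : ℕ} (hk : k < n) :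
    (D.levelVar N k : ℝ) = (D.q (k + 1) - D.q k) * N :=
  Real.coe_toNNReal _ (mul_nonneg (sub_nonneg.2 (D.q_lt k hk).le) (Nat.cast_nonneg _))

variable {D} in
lemma coe_levelSize {N : ℕ} (hdiv : ∀ k ≤ n, ∃ r : ℕ, D.x k * (N : ℝ) = r) {k : ℕ} (hk : k < n) :
    (D.levelSize N k : ℝ) = (D.x (k + 1) - D.x k) * N := by
  obtain ⟨a, ha⟩ := hdiv k hk.le
  obtain ⟨b, hb⟩ := hdiv (k + 1) hk
  have hab : a ≤ b := by
    have : (a : ℝ) ≤ b := by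
      rw [← ha, ← hb]
      exact mul_le_mul_of_nonneg_right (D.x_lt k hk).le (Nat.cast_nonneg _)
    exact_mod_cast this
  have : (D.x (k + 1) - D.x k) * N = ((b - a : ℕ) : ℝ) := by
    rw [Nat.cast_sub hab, ← ha, ← hb]; ring
  rw [levelSize, this, Nat.floor_natCast]

variable {D} in
lemma levelSize_pos {N : ℕ} (hN : 0 < N) (hdiv : ∀ k ≤ n, ∃ r : ℕ, D.x k * (N : ℝ) = r) {k : ℕ}
    (hk : k < n) : 0 < D.levelSize N k := by
  have h : (0 : ℝ) < D.levelSize N k := by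
    rw [coe_levelSize hdiv hk]
    exact mul_pos (sub_pos.2 (D.x_lt k hk)) (Nat.cast_pos.2 hN)
  exact_mod_cast h

variable {D} in
lemma sum_levelSize {N : ℕ} (hdiv : ∀ k ≤ n, ∃ r : ℕ, D.x k * (N : ℝ) = r) {k : ℕ} (hk : k ≤ n) :
    ((∑ j ∈ Finset.range k, D.levelSize N j : ℕ) : ℝ) = D.x k * N := by
  induction k with
  | zero => simp [D.x_zero]
  | succ k ih =>
    rw [Finset.sum_range_succ, Nat.cast_add, ih (by omega), coe_levelSize hdiv (by omega)]
    ring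

variable {D} in
/-- The expectation of a product over the configurations is computed by recursion over the
levels. -/
theorem integral_prod_eq_iter {N : ℕ} (hN : 0 < N)
    (hdiv : ∀ k ≤ n, ∃ r : ℕ, D.x k * (N : ℝ) = r) {Ω : Type*} [MeasurableSpace Ω]
    {P : Measure Ω} {g : Config N → Ω → ℝ} (hg : D.IsGREM N g P) (h : ℝ) {ψ : ℝ → ℝ}
    (hψ : Measurable ψ) (hb : ∀ x, |ψ x| ≤ 1) :
    ∫ ω, ∏ σ, ψ (Real.sqrt N * energy h (fun σ => g σ ω) σ) ∂P =
      iter h (D.levelSize N) (D.levelVar N) n 0 ψ 0 := by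
  have hd : ∀ k < n, 0 < D.levelSize N k := fun k hk => levelSize_pos hN hdiv hk
  have hN0 : (0 : ℝ) < N := Nat.cast_pos.2 hN
  have hs0 : Real.sqrt N ≠ 0 := (Real.sqrt_pos.2 hN0).ne'
  -- The factor √N makes the variance of level `k` proportional to `N` and turns the field term into
  -- h ∑ σ_i.
  have hlaw : P.map (fun ω σ => Real.sqrt N * g σ ω) =
      treeLaw N (nodeVar n (D.levelSize N) (D.levelVar N)) := by
    refine map_eq_treeLaw (g := fun σ ω => Real.sqrt N * g σ ω) _
      (hg.gaussian.smul fun _ => Real.sqrt N)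
      (fun σ => by rw [integral_const_mul, hg.centred, mul_zero]) fun σ τ => ?_
    obtain ⟨o, ho, hlex, hiff⟩ := exists_overlap σ τ
    rw [covariance_const_mul_left, covariance_const_mul_right, hg.covariance, hlex, D.toFun_eq,
      treeCov_nodeVar _ hd σ τ ho hiff, ← mul_assoc, Real.mul_self_sqrt hN0.le, Finset.mul_sum]
    refine Finset.sum_congr rfl fun k hk => ?_
    have hk := Finset.mem_range.1 hk
    have : D.x (k + 1) ≤ (o : ℝ) / N ↔ ∑ j ∈ Finset.range (k + 1), D.levelSize N j ≤ o := by
      rw [le_div_iff₀ hN0, ← sum_levelSize hdiv hk, Nat.cast_le]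
    rw [D.coe_levelVar N hk]
    simp only [this]
    split_ifs <;> ring
  have htot : ∑ j ∈ Finset.range n, D.levelSize N (0 + j) = N := by
    have := sum_levelSize hdiv le_rfl
    rw [D.x_last, one_mul] at this
    simpa using (by exact_mod_cast this : ∑ j ∈ Finset.range n, D.levelSize N j = N)
  have hiter := treeProd_eq_iter h n _ (D.levelVar N) hd hψ hb n 0 (by simp)
  rw [htot] at hiter
  simp only [Finset.range_zero, Finset.sum_empty, add_zero] at hiter
  rw [← hiter, treeProd, ← hlaw, integral_map]
  · refine integral_congr_ae (ae_of_all _ fun ω => Finset.prod_congr rfl fun σ _ => ?_)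
    simp only [energy, spinSum]
    congr 1
    rw [mul_add, ← mul_assoc, mul_div_cancel₀ _ hs0]
    ring
  · exact aemeasurable_pi_lambda _ fun σ => (hg.gaussian.aemeasurable σ).const_mul _
  · exact (Finset.measurable_prod _ fun σ _ => hψ.comp (by fun_prop)).aestronglyMeasurable

end OrderParameter

/-! ### Cramér's entropy and the tilting parameter -/

/-- The entropy `log (2 cosh x) - x tanh x` of a spin with mean `tanh x`. -/
def tiltEntropy (x : ℝ) : ℝ := Real.log (2 * Real.cosh x) - x * Real.tanh x

lemma one_add_tanh (x : ℝ) : 1 + Real.tanh x = Real.exp x / Real.cosh x := by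
  rw [Real.tanh_eq_sinh_div_cosh, ← Real.cosh_add_sinh]
  field_simp [(Real.cosh_pos x).ne']

lemma one_sub_tanh (x : ℝ) : 1 - Real.tanh x = Real.exp (-x) / Real.cosh x := by
  rw [← Real.cosh_neg x, ← one_add_tanh, Real.tanh_neg]; ring

lemma log_two_cosh (x : ℝ) :
    Real.log (2 * Real.cosh x) = Real.log 2 + Real.log (Real.cosh x) :=
  Real.log_mul two_ne_zero (Real.cosh_pos x).ne'

lemma cramerI_tanh (x : ℝ) : cramerI (Real.tanh x) = Real.log 2 - tiltEntropy x := by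
  have h1 : Real.log (1 + Real.tanh x) = x - Real.log (Real.cosh x) := by
    rw [one_add_tanh, Real.log_div (Real.exp_ne_zero _) (Real.cosh_pos x).ne', Real.log_exp]
  have h2 : Real.log (1 - Real.tanh x) = -x - Real.log (Real.cosh x) := by
    rw [one_sub_tanh, Real.log_div (Real.exp_ne_zero _) (Real.cosh_pos x).ne', Real.log_exp]
  rw [cramerI, tiltEntropy, h1, h2, log_two_cosh]
  ring

/-- The tangent inequality for y ↦ y log y at `a`. The endpoint y = 0 matters, since t = ±1 must be
covered later. -/
lemma mul_log_le {y a : ℝ} (hy : 0 ≤ y) (ha : 0 < a) :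
    y * Real.log a + (y - a) ≤ y * Real.log y := by
  rcases hy.eq_or_lt with rfl | hy
  · simp [ha.le]
  · have := Real.log_le_sub_one_of_pos (div_pos ha hy)
    rw [Real.log_div ha.ne' hy.ne'] at this
    have := mul_le_mul_of_nonneg_left this hy.le
    rw [mul_sub, mul_sub, mul_div_cancel₀ _ hy.ne'] at this
    linarith

/-- Young's inequality for the entropy. -/
lemma cramerI_ge (x : ℝ) {t : ℝ} (ht : t ∈ Icc (-1 : ℝ) 1) :
    t * x - Real.log (Real.cosh x) ≤ cramerI t := by
  have hc := Real.cosh_pos x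
  have h1 := mul_log_le (y := 1 + t) (by linarith [ht.1]) (div_pos (Real.exp_pos x) hc)
  have h2 := mul_log_le (y := 1 - t) (by linarith [ht.2]) (div_pos (Real.exp_pos (-x)) hc)
  rw [Real.log_div (Real.exp_ne_zero _) hc.ne', Real.log_exp, ← one_add_tanh] at h1
  rw [Real.log_div (Real.exp_ne_zero _) hc.ne', Real.log_exp, ← one_sub_tanh] at h2
  rw [cramerI]
  linarith

lemma half_sq_le_cramerI {t : ℝ} (ht : t ∈ Icc (-1 : ℝ) 1) : t ^ 2 / 2 ≤ cramerI t := by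
  have h1 := cramerI_ge t ht
  have h2 : Real.log (Real.cosh t) ≤ t ^ 2 / 2 := by
    rw [Real.log_le_iff_le_exp (Real.cosh_pos t)]
    exact Real.cosh_le_exp_half_sq t
  nlinarith

lemma abs_lt_log_two_cosh (x : ℝ) : |x| < Real.log (2 * Real.cosh x) := by
  rw [Real.lt_log_iff_exp_lt (by positivity), ← Real.cosh_abs, Real.cosh_eq]
  linarith [Real.exp_pos (-|x|)]

lemma abs_tanh_lt_one (x : ℝ) : |Real.tanh x| < 1 := by
  rw [abs_lt]
  have hc := Real.cosh_pos x
  constructor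
  · have := one_add_tanh x
    have : 0 < Real.exp x / Real.cosh x := by positivity
    linarith
  · have := one_sub_tanh x
    have : 0 < Real.exp (-x) / Real.cosh x := by positivity
    linarith

lemma tiltEntropy_pos (x : ℝ) : 0 < tiltEntropy x := by
  have h1 := abs_lt_log_two_cosh x
  have h2 : x * Real.tanh x ≤ |x| := by
    calc x * Real.tanh x ≤ |x * Real.tanh x| := le_abs_self _
      _ = |x| * |Real.tanh x| := abs_mul _ _
      _ ≤ |x| := mul_le_of_le_one_right (abs_nonneg _) (abs_tanh_lt_one x).le
  unfold tiltEntropy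
  linarith

lemma hasDerivAt_log_two_cosh (x : ℝ) :
    HasDerivAt (fun y => Real.log (2 * Real.cosh y)) (Real.tanh x) x := by
  have h := ((Real.hasDerivAt_cosh x).const_mul 2).log (by positivity)
  rw [Real.tanh_eq_sinh_div_cosh]
  convert h using 1
  field_simp

lemma tanh_mem (x : ℝ) : Real.tanh x ∈ Icc (-1 : ℝ) 1 :=
  ⟨(abs_lt.1 (abs_tanh_lt_one x)).1.le, (abs_lt.1 (abs_tanh_lt_one x)).2.le⟩

lemma tanh_sq_lt (x : ℝ) : Real.tanh x ^ 2 < 1 := (sq_lt_one_iff_abs_lt_one _).2 (abs_tanh_lt_one x)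

/-- The tangents of the convex function `log (2 cosh)`. -/
lemma log_two_cosh_ge (x y : ℝ) :
    Real.log (2 * Real.cosh x) + Real.tanh x * (y - x) ≤ Real.log (2 * Real.cosh y) := by
  have h := cramerI_ge y (tanh_mem x)
  rw [cramerI_tanh, tiltEntropy] at h
  rw [log_two_cosh y]
  linarith

lemma tanh_le_tanh {x y : ℝ} (hxy : x ≤ y) : Real.tanh x ≤ Real.tanh y := by
  rcases hxy.eq_or_lt with rfl | h
  · exact le_rfl
  have h1 := log_two_cosh_ge x y
  have h2 := log_two_cosh_ge y x
  by_contra! hlt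
  nlinarith

/-- The entropy is the intercept at 0 of the tangent to log(2 cosh); by convexity the intercept
decreases as the point of tangency moves right. -/
lemma tiltEntropy_antitone {x y : ℝ} (hx : 0 ≤ x) (hxy : x ≤ y) :
    tiltEntropy y ≤ tiltEntropy x := by
  have h1 := log_two_cosh_ge y x
  have h2 := tanh_le_tanh hxy
  unfold tiltEntropy
  nlinarith

lemma continuous_tanh : Continuous Real.tanh := by
  have : Real.tanh = fun x => Real.sinh x / Real.cosh x := by
    ext x; exact Real.tanh_eq_sinh_div_cosh x
  rw [this]
  exact Real.continuous_sinh.div Real.continuous_cosh fun x => (Real.cosh_pos x).ne'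

lemma rho_tanh (x : ℝ) : rho (Real.tanh x) = Real.sqrt (2 * tiltEntropy x) := by
  rw [rho, cramerI_tanh]; congr 1; ring

lemma rho_tanh_sq (x : ℝ) : rho (Real.tanh x) ^ 2 = 2 * tiltEntropy x := by
  rw [rho_tanh, Real.sq_sqrt (by linarith [tiltEntropy_pos x])]

lemma rho_tanh_pos (x : ℝ) : 0 < rho (Real.tanh x) := by
  rw [rho_tanh]; exact Real.sqrt_pos.2 (by linarith [tiltEntropy_pos x])

/-- With r = ρ(tanh x), Young's inequality gives ρ(t)² ≤ r² - 2x(t - tanh x). Inserting x = hr and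
completing the square bounds (ρ(t) - r)² by 2r times the deficit from the claimed maximum. So the
deficit is nonnegative, and equality forces ρ(t) = r. -/
lemma rho_le_of_eq {h x : ℝ} (hx : x = h * rho (Real.tanh x)) {t : ℝ} (ht : t ∈ Icc (-1 : ℝ) 1) :
    rho t + h * t ≤ rho (Real.tanh x) + h * Real.tanh x ∧
      (rho t + h * t = rho (Real.tanh x) + h * Real.tanh x → t = Real.tanh x) := by
  set r := rho (Real.tanh x) with hr
  have hrpos : 0 < r := rho_tanh_pos x
  have hrsq : r ^ 2 = 2 * tiltEntropy x := rho_tanh_sq x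
  have h0 : 0 ≤ rho t := Real.sqrt_nonneg _
  have h1 : rho t ^ 2 ≤ r ^ 2 - 2 * x * (t - Real.tanh x) := by
    have hy := cramerI_ge x ht
    rcases le_total 0 (2 * (Real.log 2 - cramerI t)) with h | h
    · rw [rho, Real.sq_sqrt h, hrsq, tiltEntropy, log_two_cosh]
      linarith
    -- Where the radicand is nonpositive, `rho t` is 0, and |x| < log(2 cosh x) suffices.
    · have : t * x ≤ |x| := by
        calc t * x ≤ |t * x| := le_abs_self _
          _ = |t| * |x| := abs_mul _ _
          _ ≤ |x| := mul_le_of_le_one_left (abs_nonneg _) (abs_le.2 ht)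
      have h2 := abs_lt_log_two_cosh x
      rw [rho, Real.sqrt_eq_zero_of_nonpos h, hrsq, tiltEntropy]
      nlinarith
  have h2 : (rho t - r) ^ 2 ≤ 2 * r * (r + h * Real.tanh x - (rho t + h * t)) := by
    have e : x * (t - Real.tanh x) = h * r * (t - Real.tanh x) :=
      congrArg (· * (t - Real.tanh x)) hx
    linarith
  refine ⟨?_, fun he => ?_⟩
  · by_contra! hlt
    nlinarith [sq_nonneg (rho t - r)]
  · rw [he, sub_self, mul_zero] at h2
    have h3 : rho t = r := by nlinarith [sq_nonneg (rho t - r)]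
    rw [h3] at he
    -- If h ≠ 0, the linear term recovers t from ρ(t) = r. If h = 0, it carries no information, and
    -- t = 0 follows from I(t) ≥ t²/2.
    by_cases hh : h = 0
    · subst hh
      rw [zero_mul] at hx
      have hx0 : Real.tanh x = 0 := by rw [hx]; simp
      rw [hx0] at hr ⊢
      have h4 := half_sq_le_cramerI ht
      have h5 : 2 * (Real.log 2 - cramerI t) = 2 * Real.log 2 := by
        have e1 : rho t ^ 2 = 2 * (Real.log 2 - cramerI t) := by
          rw [rho, Real.sq_sqrt]
          by_contra! hneg
          rw [rho, Real.sqrt_eq_zero_of_nonpos hneg.le] at h3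
          linarith
        rw [← e1, h3, hrsq, hx, tiltEntropy]
        simp
      nlinarith
    · exact mul_left_cancel₀ hh (by linarith)

/-- The critical equation of ρ(t) + ht in the coordinate t = tanh x. The intermediate value theorem
applies on [0, h √(2 log 2)] because 0 ≤ ρ ≤ √(2 log 2). -/
lemma exists_eq_mul_rho {h : ℝ} (hh : 0 ≤ h) : ∃ x, x = h * rho (Real.tanh x) := by
  set b := h * Real.sqrt (2 * Real.log 2) with hb
  have hb0 : 0 ≤ b := mul_nonneg hh (Real.sqrt_nonneg _)
  have hcont : ContinuousOn (fun x => h * rho (Real.tanh x) - x) (Icc 0 b) :=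
    ((continuous_const.mul (continuous_rho.comp continuous_tanh)).sub continuous_id).continuousOn
  have h1 : h * rho (Real.tanh b) - b ≤ 0 := by
    rw [hb, ← mul_sub]
    refine mul_nonpos_of_nonneg_of_nonpos hh (sub_nonpos.2 (Real.sqrt_le_sqrt ?_))
    have := half_sq_le_cramerI (tanh_mem b)
    rw [← hb]
    nlinarith [sq_nonneg (Real.tanh b)]
  have h2 : 0 ≤ h * rho (Real.tanh 0) - 0 := by
    rw [sub_zero]; exact mul_nonneg hh (Real.sqrt_nonneg _)
  obtain ⟨x, -, hx⟩ := intermediate_value_Icc' hb0 hcont ⟨h1, h2⟩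
  exact ⟨x, by dsimp only at hx; linarith⟩

lemma tStar_eq {h x : ℝ} (hx : x = h * rho (Real.tanh x)) : tStar h = Real.tanh x := by
  have hs := (exists_isMaxOn_rho h).choose_spec
  have h1 := hs.2 (tanh_mem x)
  have h2 := rho_le_of_eq hx hs.1
  exact h2.2 (le_antisymm h2.1 h1)

lemma maxValue_eq {h x : ℝ} (hx : x = h * rho (Real.tanh x)) :
    maxValue h = rho (Real.tanh x) + h * Real.tanh x := by
  refine IsGreatest.csSup_eq ⟨⟨_, tanh_mem x, rfl⟩, ?_⟩
  rintro _ ⟨t, ht, rfl⟩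
  exact (rho_le_of_eq hx ht).1

/-- The inverse `λ = ρ(t_*(θ^{-1/2} h)) θ^{-1/2}` of the square root of the modified slope. -/
def tilt (h θ : ℝ) : ℝ := rho (tStar (h / Real.sqrt θ)) / Real.sqrt θ

section

variable {h θ : ℝ}

/-- The critical point for the field h/√θ is x = λh. In terms of λ the constants of the REM become
explicit; the fourth identity, entropy = λ²θ/2, is the one on which all later cancellations rest. -/
lemma tilt_spec (hh : 0 ≤ h) (hθ : 0 < θ) :
    0 < tilt h θ ∧ tStar (h / Real.sqrt θ) = Real.tanh (tilt h θ * h) ∧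
      rho (tStar (h / Real.sqrt θ)) = tilt h θ * Real.sqrt θ ∧
      2 * tiltEntropy (tilt h θ * h) = tilt h θ ^ 2 * θ ∧
      Real.sqrt θ * maxValue (h / Real.sqrt θ) = tilt h θ * θ + h * Real.tanh (tilt h θ * h) := by
  have hs := Real.sqrt_pos.2 hθ
  obtain ⟨x, hx⟩ := exists_eq_mul_rho (div_nonneg hh hs.le)
  have ht := tStar_eq hx
  have hm := maxValue_eq hx
  have hxl : tilt h θ * h = x := by rw [tilt, ht]; conv_rhs => rw [hx]
                                    ring
  have hrho : rho (tStar (h / Real.sqrt θ)) = tilt h θ * Real.sqrt θ := by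
    rw [tilt, div_mul_cancel₀ _ hs.ne']
  refine ⟨?_, by rw [hxl, ht], hrho, ?_, ?_⟩
  · rw [tilt, ht]; exact div_pos (rho_tanh_pos x) hs
  · rw [hxl, ← rho_tanh_sq, ← ht, hrho, mul_pow, Real.sq_sqrt hθ.le]
  · rw [hm, hxl, ← ht, hrho, mul_add, mul_left_comm, Real.mul_self_sqrt hθ.le, ← mul_assoc,
      mul_div_cancel₀ _ hs.ne']

lemma tilt_pos (hh : 0 ≤ h) (hθ : 0 < θ) : 0 < tilt h θ := (tilt_spec hh hθ).1

/-- If λ ≤ λ', the decreasing entropy gives λ'²θ' ≤ λ²θ ≤ λ'²θ, contradicting θ < θ'. -/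
lemma tilt_lt_tilt (hh : 0 ≤ h) {θ' : ℝ} (hθ : 0 < θ) (hlt : θ < θ') : tilt h θ' < tilt h θ := by
  obtain ⟨h1, -, -, h2, -⟩ := tilt_spec hh hθ
  obtain ⟨h1', -, -, h2', -⟩ := tilt_spec hh (hθ.trans hlt)
  by_contra! hle
  have h3 := tiltEntropy_antitone (mul_nonneg h1.le hh) (mul_le_mul_of_nonneg_right hle hh)
  have h4 : tilt h θ ^ 2 ≤ tilt h θ' ^ 2 := pow_le_pow_left₀ h1.le hle 2
  have h5 := pow_pos h1 2
  nlinarith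

end

/-! ### Derivatives of the entropy -/

lemma hasDerivAt_cramerI {t : ℝ} (ht : |t| < 1) :
    HasDerivAt cramerI ((1 / 2) * (Real.log (1 + t) - Real.log (1 - t))) t := by
  obtain ⟨h1, h2⟩ := abs_lt.1 ht
  have ha : HasDerivAt (fun x : ℝ => 1 - x) (-1) t := by
    simpa using (hasDerivAt_id t).const_sub 1
  have hb : HasDerivAt (fun x : ℝ => 1 + x) 1 t := by
    simpa using (hasDerivAt_id t).const_add 1
  have h1' : (1 : ℝ) - t ≠ 0 := by linarith
  have h2' : (1 : ℝ) + t ≠ 0 := by linarith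
  have h := (((ha.mul (ha.log h1')).add (hb.mul (hb.log h2'))).const_mul (1 / 2))
  refine h.congr_deriv ?_
  field_simp
  ring

lemma iteratedDeriv_two_cramerI {t : ℝ} (ht : |t| < 1) :
    iteratedDeriv 2 cramerI t = (1 - t ^ 2)⁻¹ := by
  rw [show (2 : ℕ) = 1 + 1 from rfl, iteratedDeriv_succ, iteratedDeriv_one]
  have hev : deriv cramerI =ᶠ[𝓝 t]
      fun t => (1 / 2) * (Real.log (1 + t) - Real.log (1 - t)) := by
    filter_upwards [(isOpen_lt continuous_abs continuous_const).mem_nhds ht] with s hs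
    exact (hasDerivAt_cramerI hs).deriv
  rw [hev.deriv_eq]
  obtain ⟨h1, h2⟩ := abs_lt.1 ht
  have ha : HasDerivAt (fun x : ℝ => 1 - x) (-1) t := by
    simpa using (hasDerivAt_id t).const_sub 1
  have hb : HasDerivAt (fun x : ℝ => 1 + x) 1 t := by
    simpa using (hasDerivAt_id t).const_add 1
  have h1' : (1 : ℝ) - t ≠ 0 := by linarith
  have h2' : (1 : ℝ) + t ≠ 0 := by linarith
  have h3 : (1 : ℝ) - t ^ 2 ≠ 0 := by
    rw [show 1 - t ^ 2 = (1 - t) * (1 + t) by ring]; exact mul_ne_zero h1' h2'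
  have hd : HasDerivAt (fun t => 1 / 2 * (Real.log (1 + t) - Real.log (1 - t))) _ t :=
    ((hb.log h2').sub (ha.log h1')).const_mul (1 / 2)
  rw [hd.deriv]
  field_simp
  ring

namespace OrderParameter

variable {n : ℕ} (D : OrderParameter n) {h : ℝ}

lemma slope_pos {j k : ℕ} (hj : j - 1 < k) (hk : k ≤ n) : 0 < D.slope j k :=
  div_pos (sub_pos.2 (D.q_strictMono hj hk)) (sub_pos.2 (D.x_strictMono hj hk))

lemma modSlope_eq (hh : 0 ≤ h) {j k : ℕ} (hj : j - 1 < k) (hk : k ≤ n) :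
    D.modSlope h j k = (tilt h (D.slope j k) ^ 2)⁻¹ := by
  have hs := D.slope_pos hj hk
  obtain ⟨h1, -, h3, -⟩ := tilt_spec hh hs
  rw [modSlope, h3, mul_pow, Real.sq_sqrt hs.le]
  field_simp

/-- The modified slope λ⁻² is strictly increasing in the slope. So the field does not affect the
comparisons, and the coarse graining can be studied with ordinary slopes. -/
lemma modSlope_lt_iff (hh : 0 ≤ h) {j k j' k' : ℕ} (hj : j - 1 < k) (hk : k ≤ n)
    (hj' : j' - 1 < k') (hk' : k' ≤ n) :
    D.modSlope h j k < D.modSlope h j' k' ↔ D.slope j k < D.slope j' k' := by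
  have hs := D.slope_pos hj hk
  have hs' := D.slope_pos hj' hk'
  rw [D.modSlope_eq hh hj hk, D.modSlope_eq hh hj' hk']
  have key {a b : ℝ} (ha : 0 < a) (hab : a < b) :
      (tilt h a ^ 2)⁻¹ < (tilt h b ^ 2)⁻¹ :=
    (inv_lt_inv₀ (pow_pos (tilt_pos hh ha) 2) (pow_pos (tilt_pos hh (ha.trans hab)) 2)).2
      (pow_lt_pow_left₀ (tilt_lt_tilt hh ha hab) (tilt_pos hh (ha.trans hab)).le two_ne_zero)
  constructor
  · intro hlt
    by_contra! hle
    rcases hle.eq_or_lt with he | he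
    · rw [he] at hlt; exact lt_irrefl _ hlt
    · exact lt_asymm hlt (key hs' he)
  · exact key hs

end OrderParameter

/-! ### Coarse graining -/

namespace OrderParameter

variable {n : ℕ} (D : OrderParameter n) {h : ℝ}

lemma slope_succ (j k : ℕ) : D.slope (j + 1) k = (D.q k - D.q j) / (D.x k - D.x j) := by
  simp [slope]

/-- The slope over `a, c` is a weighted mean of the slopes over `a, b` and `b, c`. -/
lemma slope_succ_lt_iff {a b c : ℕ} (hab : a < b) (hbc : b < c) (hc : c ≤ n) :
    (D.slope (b + 1) c < D.slope (a + 1) b ↔ D.slope (a + 1) c < D.slope (a + 1) b) ∧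
      (D.slope (a + 1) c < D.slope (b + 1) c ↔ D.slope (a + 1) b < D.slope (a + 1) c) := by
  have h1 := D.x_strictMono hab (hbc.le.trans hc)
  have h2 := D.x_strictMono hbc hc
  simp only [slope_succ]
  rw [div_lt_div_iff₀ (by linarith) (by linarith), div_lt_div_iff₀ (by linarith) (by linarith),
    div_lt_div_iff₀ (by linarith) (by linarith), div_lt_div_iff₀ (by linarith) (by linarith)]
  constructor <;> constructor <;> intro <;> nlinarith

/-- The next index is the last point `K` at which the slope seen from `J h l` is maximal, that is,
the next vertex of the concave hull. `K` satisfies the defining condition; if a smaller index did,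
its condition at `K` would contradict maximality. -/
lemma J_succ_spec (hh : 0 ≤ h) {l : ℕ} (hl : D.J h l < n) :
    D.J h l < D.J h (l + 1) ∧ D.J h (l + 1) ≤ n ∧
      (∀ k, D.J h (l + 1) < k → k ≤ n →
        D.modSlope h (D.J h (l + 1) + 1) k < D.modSlope h (D.J h l + 1) (D.J h (l + 1))) ∧
      ∀ j, D.J h l < j → j ≤ n →
        D.slope (D.J h l + 1) j ≤ D.slope (D.J h l + 1) (D.J h (l + 1)) := by
  set S := {K : ℕ | D.J h l < K ∧ K ≤ n ∧
    ∀ k, K < k → k ≤ n → D.modSlope h (K + 1) k < D.modSlope h (D.J h l + 1) K} with hS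
  have hJ : D.J h (l + 1) = sInf S := by rw [J]
  -- The index `n` satisfies the condition vacuously, so the infimum is attained and is not the
  -- default value 0 of the empty set.
  have hmem : sInf S ∈ S := Nat.sInf_mem ⟨n, hl, le_rfl, fun k h1 h2 => by omega⟩
  rw [← hJ] at hmem
  obtain ⟨h1, h2, h3⟩ := hmem
  refine ⟨h1, h2, h3, ?_⟩
  set f := fun j => D.slope (D.J h l + 1) j with hf
  obtain ⟨j₀, hj₀, hmax⟩ := (Finset.Ioc (D.J h l) n).exists_max_image f ⟨n, by simp [hl]⟩
  set T := (Finset.Ioc (D.J h l) n).filter fun j => f j = f j₀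
  have hT : T.Nonempty := ⟨j₀, by simp only [T, Finset.mem_filter]; exact ⟨hj₀, trivial⟩⟩
  have hKT := T.max'_mem hT
  set K := T.max' hT with hK
  simp only [T, Finset.mem_filter, Finset.mem_Ioc] at hKT
  have hlt : ∀ k, K < k → k ≤ n → f k < f K := by
    intro k hk hkn
    have hk' : k ∈ Finset.Ioc (D.J h l) n := by simp; omega
    rw [hKT.2]
    refine lt_of_le_of_ne (hmax k hk') fun he => ?_
    have := T.le_max' k (by simp only [T, Finset.mem_filter]; exact ⟨hk', he⟩)
    omega
  have hKS : K ∈ S := by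
    refine ⟨hKT.1.1, hKT.1.2, fun k hk hkn => ?_⟩
    rw [D.modSlope_lt_iff hh (by omega) hkn (by omega) hKT.1.2]
    exact (D.slope_succ_lt_iff hKT.1.1 hk hkn).1.2 (hlt k hk hkn)
  have hle : D.J h (l + 1) ≤ K := by rw [hJ]; exact Nat.sInf_le hKS
  have heq : D.J h (l + 1) = K := by
    refine le_antisymm hle (not_lt.1 fun hlt' => ?_)
    have h4 := h3 K hlt' hKT.1.2
    rw [D.modSlope_lt_iff hh (by omega) hKT.1.2 (by omega) h2,
      (D.slope_succ_lt_iff h1 hlt' hKT.1.2).1] at h4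
    have h5 := hmax (D.J h (l + 1)) (by simp; omega)
    rw [← hKT.2] at h5
    exact absurd h4 (not_lt.2 h5)
  intro j hj hjn
  rw [heq]
  have := hmax j (by simp; omega)
  rwa [← hKT.2] at this

lemma exists_J_eq (hh : 0 ≤ h) : ∃ l, D.J h l = n := by
  by_contra! hne
  have hle : ∀ l, D.J h l < n ∧ l ≤ D.J h l := by
    intro l
    induction l with
    | zero => exact ⟨lt_of_le_of_ne (by simp [J]) (hne 0), Nat.zero_le _⟩
    | succ l ih =>
      obtain ⟨h1, h2, -⟩ := D.J_succ_spec hh ih.1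
      exact ⟨lt_of_le_of_ne h2 (hne _), by omega⟩
  have := hle n
  omega

lemma J_m (hh : 0 ≤ h) : D.J h (D.m h) = n := Nat.sInf_mem (D.exists_J_eq hh)

lemma J_lt_of_lt (hh : 0 ≤ h) {l : ℕ} (hl : l < D.m h) : D.J h l < n := by
  induction l with
  | zero =>
    exact lt_of_le_of_ne (by simp [J]) fun he => Nat.notMem_of_lt_sInf hl he
  | succ l ih =>
    exact lt_of_le_of_ne (D.J_succ_spec hh (ih (by omega))).2.1
      fun he => Nat.notMem_of_lt_sInf hl he

lemma J_lt_J_succ (hh : 0 ≤ h) {l : ℕ} (hl : l < D.m h) : D.J h l < D.J h (l + 1) :=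
  (D.J_succ_spec hh (D.J_lt_of_lt hh hl)).1

lemma J_succ_le (hh : 0 ≤ h) {l : ℕ} (hl : l < D.m h) : D.J h (l + 1) ≤ n :=
  (D.J_succ_spec hh (D.J_lt_of_lt hh hl)).2.1

lemma qBar_pos (hh : 0 ≤ h) {l : ℕ} (hl : l < D.m h) : 0 < D.qBar h l :=
  sub_pos.2 (D.q_strictMono (D.J_lt_J_succ hh hl) (D.J_succ_le hh hl))

lemma xBar_pos (hh : 0 ≤ h) {l : ℕ} (hl : l < D.m h) : 0 < D.xBar h l :=
  sub_pos.2 (D.x_strictMono (D.J_lt_J_succ hh hl) (D.J_succ_le hh hl))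

lemma thetaBar_eq (l : ℕ) : D.thetaBar h l = D.qBar h l / D.xBar h l := by
  simp [thetaBar, slope, qBar, xBar]

lemma thetaBar_pos (hh : 0 ≤ h) {l : ℕ} (hl : l < D.m h) : 0 < D.thetaBar h l := by
  rw [thetaBar_eq]; exact div_pos (D.qBar_pos hh hl) (D.xBar_pos hh hl)

lemma gammaBar_eq (hh : 0 ≤ h) {l : ℕ} (hl : l < D.m h) :
    D.gammaBar h l = (tilt h (D.thetaBar h l))⁻¹ := by
  rw [gammaBar, D.modSlope_eq hh (by simpa using D.J_lt_J_succ hh hl) (D.J_succ_le hh hl),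
    ← inv_pow]
  exact Real.sqrt_sq (inv_nonneg.2 (tilt_pos hh (D.thetaBar_pos hh hl)).le)

/-- The slopes of the hull decrease, so the tilts increase. This gap makes the integrals ∫ min(1, C
e^{κx}) e^{-x/λ…}-type, after scaling, converge when blocks are composed: the exponent of the next
block exceeds that of the current one. -/
lemma tilt_thetaBar_lt (hh : 0 ≤ h) {l : ℕ} (hl : l + 1 < D.m h) :
    tilt h (D.thetaBar h l) < tilt h (D.thetaBar h (l + 1)) := by
  have hl' : l < D.m h := by omega
  have h1 := (D.J_succ_spec hh (D.J_lt_of_lt hh hl')).2.2.1 _ (D.J_lt_J_succ hh hl)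
    (D.J_succ_le hh hl)
  rw [D.modSlope_lt_iff hh (by simpa using D.J_lt_J_succ hh hl) (D.J_succ_le hh hl)
    (by simpa using D.J_lt_J_succ hh hl') (D.J_succ_le hh hl')] at h1
  exact tilt_lt_tilt hh (D.thetaBar_pos hh hl) h1

lemma q_sub_le_thetaBar_mul (hh : 0 ≤ h) {l : ℕ} (hl : l < D.m h) {j : ℕ} (hj : D.J h l < j)
    (hjn : j ≤ n) : D.q j - D.q (D.J h l) ≤ D.thetaBar h l * (D.x j - D.x (D.J h l)) := by
  have h1 := (D.J_succ_spec hh (D.J_lt_of_lt hh hl)).2.2.2 j hj hjn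
  rwa [slope_succ, div_le_iff₀ (sub_pos.2 (D.x_strictMono hj hjn))] at h1

/-- Without ties every final segment is steeper than the block, hence every initial segment is
flatter: the order parameter stays strictly below the chord. -/
lemma q_sub_lt_thetaBar_mul (hh : 0 ≤ h) (hs : D.StrictBlocks h) {l : ℕ} (hl : l < D.m h) {j : ℕ}
    (hj : D.J h l < j) (hj' : j < D.J h (l + 1)) :
    D.q j - D.q (D.J h l) < D.thetaBar h l * (D.x j - D.x (D.J h l)) := by
  have hn := D.J_succ_le hh hl
  have h1 := hs l hl (j + 1) (by omega) (by omega)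
  rw [D.modSlope_lt_iff hh (by simpa using hj.trans hj') hn (by simpa using hj') hn,
    (D.slope_succ_lt_iff hj hj' hn).2, slope_succ,
    div_lt_iff₀ (sub_pos.2 (D.x_strictMono hj (hj'.le.trans hn)))] at h1
  exact h1

end OrderParameter

/-! ### Intensity measures of the levels -/

/-- The intensity measure of the energies of `d` spins with variance `v`. -/
def intensity (h : ℝ) (d : ℕ) (v : ℝ≥0) : Measure ℝ :=
  ∑ σ : Config d, gaussianReal (h * spinSum σ) v

instance (h : ℝ) (d : ℕ) (v : ℝ≥0) : IsFiniteMeasure (intensity h d v) := by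
  unfold intensity; infer_instance

lemma integrable_intensity {h : ℝ} {d : ℕ} {v : ℝ≥0} {f : ℝ → ℝ}
    (hf : ∀ m, Integrable f (gaussianReal m v)) : Integrable f (intensity h d v) := by
  unfold intensity
  exact integrable_finsetSum_measure.2 fun σ _ => hf _

lemma integral_intensity {h : ℝ} {d : ℕ} {v : ℝ≥0} {f : ℝ → ℝ}
    (hf : ∀ m, Integrable f (gaussianReal m v)) :
    ∫ w, f w ∂intensity h d v = ∑ σ : Config d, ∫ w, f w ∂gaussianReal (h * spinSum σ) v := by
  unfold intensity
  exact integral_finsetSum_measure fun σ _ => hf _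

lemma integral_gaussianReal_eq_shift {f : ℝ → ℝ} (hf : Measurable f) (m : ℝ) (v : ℝ≥0) :
    ∫ w, f w ∂gaussianReal m v = ∫ w, f (m + w) ∂gaussianReal 0 v := by
  rw [← integral_map (φ := fun w => m + w) (by fun_prop) hf.aestronglyMeasurable,
    gaussianReal_map_const_add, zero_add]

lemma integrable_of_mem_Icc {μ : Measure ℝ} [IsFiniteMeasure μ] {f : ℝ → ℝ} (hf : Measurable f)
    (hb : ∀ x, f x ∈ Icc (0 : ℝ) 1) : Integrable f μ :=
  Integrable.of_bound hf.aestronglyMeasurable 1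
    (ae_of_all _ fun x => by rw [Real.norm_of_nonneg (hb x).1]; exact (hb x).2)

lemma integral_intensity_shift {h : ℝ} {d : ℕ} {v : ℝ≥0} {f : ℝ → ℝ} (hf : Measurable f)
    (hb : ∀ x, f x ∈ Icc (0 : ℝ) 1) (y : ℝ) :
    ∫ w, f (y + w) ∂intensity h d v =
      ∑ σ : Config d, ∫ w, f (y + h * spinSum σ + w) ∂gaussianReal 0 v := by
  rw [integral_intensity fun m => integrable_of_mem_Icc (by fun_prop) fun x => hb _]
  refine Finset.sum_congr rfl fun σ _ => ?_
  rw [integral_gaussianReal_eq_shift (f := fun w => f (y + w)) (by fun_prop)]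
  simp_rw [add_assoc]

lemma spinSum_append {d d' : ℕ} (σ : Config d) (τ : Config d') :
    spinSum (Fin.append σ τ : Config (d + d')) = spinSum σ + spinSum τ := by
  simp [spinSum, Fin.sum_univ_add]

/-- Configurations concatenate and Gaussian laws convolve, so in first-moment computations a whole
block acts like a single level. -/
lemma integral_intensity_add {h : ℝ} {d d' : ℕ} {v v' : ℝ≥0} {f : ℝ → ℝ} (hf : Measurable f)
    (hb : ∀ x, f x ∈ Icc (0 : ℝ) 1) :
    ∫ x, ∫ y, f (x + y) ∂intensity h d' v' ∂intensity h d v =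
      ∫ x, f x ∂intensity h (d + d') (v + v') := by
  have hint (μ : Measure ℝ) [IsFiniteMeasure μ] : Integrable f μ := integrable_of_mem_Icc hf hb
  have hm (m : ℝ) : StronglyMeasurable fun x => ∫ y, f (x + y) ∂gaussianReal m v' :=
    StronglyMeasurable.integral_prod_right (f := fun x y => f (x + y))
      (by fun_prop : Measurable (Function.uncurry fun x y => f (x + y))).stronglyMeasurable
  have hint' (m m' : ℝ) : Integrable (fun x => ∫ y, f (x + y) ∂gaussianReal m v')
      (gaussianReal m' v) := by
    refine Integrable.of_bound (hm m).aestronglyMeasurable 1 (ae_of_all _ fun x => ?_)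
    refine (norm_integral_le_of_norm_le_const (C := 1) (ae_of_all _ fun y => ?_)).trans (by simp)
    rw [Real.norm_of_nonneg (hb _).1]; exact (hb _).2
  have h1 (x : ℝ) : ∫ y, f (x + y) ∂intensity h d' v' =
      ∑ τ : Config d', ∫ y, f (x + y) ∂gaussianReal (h * spinSum τ) v' :=
    integral_intensity fun m => integrable_of_mem_Icc (by fun_prop) fun _ => hb _
  simp_rw [h1]
  rw [integral_intensity fun m => integrable_finsetSum _ fun τ _ => hint' _ _,
    integral_intensity fun m => hint _, ← (Fin.appendEquiv d d').sum_comp,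
    Fintype.sum_prod_type]
  refine Finset.sum_congr rfl fun σ _ => ?_
  rw [integral_finsetSum _ fun τ _ => hint' _ _]
  refine Finset.sum_congr rfl fun τ _ => ?_
  rw [← integral_conv (hint _), gaussianReal_conv_gaussianReal]
  simp only [Fin.appendEquiv, Equiv.coe_fn_mk, spinSum_append, mul_add]

lemma sum_exp_mul_spinSum (x : ℝ) (d : ℕ) :
    ∑ σ : Config d, Real.exp (x * spinSum σ) = (2 * Real.cosh x) ^ d := by
  induction d with
  | zero => simp
  | succ d ih =>
    rw [sum_config_succ]
    simp_rw [spinSum_cons, mul_add, Real.exp_add, ← Finset.mul_sum, ih, ← Finset.sum_mul]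
    rw [pow_succ, mul_comm]
    congr 1
    rw [show (Finset.univ : Finset ℤˣ) = {1, -1} from rfl, Finset.sum_pair (by decide)]
    simp [Real.cosh_eq]
    ring

/-- The logarithm of the exponential moment of the intensity of `D` spins with variance `V`. -/
def logMoment (h l D V : ℝ) : ℝ := D * Real.log (2 * Real.cosh (l * h)) + l ^ 2 * V / 2

lemma logMoment_add (h l D V D' V' : ℝ) :
    logMoment h l (D + D') (V + V') = logMoment h l D V + logMoment h l D' V' := by
  unfold logMoment; ring

lemma integral_exp_gaussianReal (l m : ℝ) (v : ℝ≥0) :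
    ∫ w, Real.exp (l * w) ∂gaussianReal m v = Real.exp (l * m + l ^ 2 * v / 2) := by
  have := mgf_gaussianReal (p := gaussianReal m v) (X := id) Measure.map_id l
  simp only [mgf, id] at this
  rw [this]; congr 1; ring

lemma two_cosh_pow (x : ℝ) (d : ℕ) :
    (2 * Real.cosh x) ^ d = Real.exp (d * Real.log (2 * Real.cosh x)) := by
  rw [Real.exp_nat_mul, Real.exp_log (by positivity)]

lemma integral_exp_intensity (h l : ℝ) (d : ℕ) (v : ℝ≥0) :
    ∫ w, Real.exp (l * w) ∂intensity h d v = Real.exp (logMoment h l d v) := by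
  rw [integral_intensity fun m => integrable_exp_mul_gaussianReal l]
  simp_rw [integral_exp_gaussianReal, Real.exp_add, ← Finset.sum_mul, ← mul_assoc,
    sum_exp_mul_spinSum, logMoment, Real.exp_add, two_cosh_pow]

lemma integrable_exp_intensity (h l : ℝ) (d : ℕ) (v : ℝ≥0) :
    Integrable (fun w => Real.exp (l * w)) (intensity h d v) :=
  integrable_intensity fun _ => integrable_exp_mul_gaussianReal l

/-! ### Bounds for the level maps -/

lemma one_sub_prod_le_sum {ι : Type*} (s : Finset ι) {r : ι → ℝ} (hr : ∀ i ∈ s, r i ∈ Icc (0 : ℝ) 1) :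
    1 - ∏ i ∈ s, (1 - r i) ≤ ∑ i ∈ s, r i := by
  classical
  induction s using Finset.induction_on with
  | empty => simp
  | insert a s ha ih =>
    rw [Finset.prod_insert ha, Finset.sum_insert ha]
    have h1 := ih fun i hi => hr i (Finset.mem_insert_of_mem hi)
    have h2 := hr a (Finset.mem_insert_self _ _)
    have h3 : ∏ i ∈ s, (1 - r i) ≤ 1 := Finset.prod_le_one
      (fun i hi => by have := hr i (Finset.mem_insert_of_mem hi); linarith [this.2])
      fun i hi => by have := hr i (Finset.mem_insert_of_mem hi); linarith [this.1]
    nlinarith [h2.1, h2.2]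

lemma prod_one_sub_le_exp {ι : Type*} (s : Finset ι) {r : ι → ℝ} (hr : ∀ i ∈ s, r i ≤ 1) :
    ∏ i ∈ s, (1 - r i) ≤ Real.exp (-∑ i ∈ s, r i) := by
  rw [← Finset.sum_neg_distrib, Real.exp_sum]
  exact Finset.prod_le_prod (fun i hi => by linarith [hr i hi])
    fun i _ => by linarith [Real.add_one_le_exp (-r i)]

/-- For a sum a ≤ 1 the usual error a² is at most a^p; for a ≥ 1 the left side is nonpositive. An
exponent p close to 1 is allowed because the squares can be too large to integrate against the
intensities. -/
lemma sum_sub_rpow_le_one_sub_prod {ι : Type*} (s : Finset ι) {r : ι → ℝ}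
    (hr : ∀ i ∈ s, r i ∈ Icc (0 : ℝ) 1) {p : ℝ} (hp1 : 1 ≤ p) (hp2 : p ≤ 2) :
    ∑ i ∈ s, r i - (∑ i ∈ s, r i) ^ p ≤ 1 - ∏ i ∈ s, (1 - r i) := by
  set a := ∑ i ∈ s, r i with ha
  have ha0 : 0 ≤ a := Finset.sum_nonneg fun i hi => (hr i hi).1
  rcases le_total a 1 with h | h
  · have h1 := prod_one_sub_le_exp s fun i hi => (hr i hi).2
    have h2 := Real.abs_exp_sub_one_sub_id_le (x := -a) (by rw [abs_neg, abs_of_nonneg ha0]; exact h)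
    have h3 : a ^ (2 : ℕ) ≤ a ^ p := by
      rcases ha0.eq_or_lt with h0 | h0
      · rw [← h0]; simp [Real.zero_rpow (by linarith : p ≠ 0)]
      · rw [← Real.rpow_natCast]
        exact Real.rpow_le_rpow_of_exponent_ge h0 h (by exact_mod_cast hp2)
    have h4 := (abs_le.1 h2).2
    rw [← ha] at h1
    nlinarith
  · have h1 : a ≤ a ^ p := by
      simpa using Real.rpow_le_rpow_of_exponent_le h hp1
    have h2 : ∏ i ∈ s, (1 - r i) ≤ 1 := Finset.prod_le_one
      (fun i hi => by linarith [(hr i hi).2]) fun i hi => by linarith [(hr i hi).1]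
    linarith

section

variable {h : ℝ} {F : ℝ → ℝ}

lemma integral_mem_Icc {μ : Measure ℝ} [IsProbabilityMeasure μ] {f : ℝ → ℝ}
    (hb : ∀ x, f x ∈ Icc (0 : ℝ) 1) : ∫ w, f w ∂μ ∈ Icc (0 : ℝ) 1 := by
  refine ⟨integral_nonneg fun x => (hb x).1, ?_⟩
  have := norm_integral_le_of_norm_le_const (μ := μ) (f := f) (C := 1)
    (ae_of_all _ fun x => by rw [Real.norm_of_nonneg (hb x).1]; exact (hb x).2)
  simpa using (le_abs_self _).trans this

lemma measurable_integral_shift (hF : Measurable F) (μ : Measure ℝ) [SFinite μ] :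
    Measurable fun y => ∫ w, F (y + w) ∂μ :=
  (StronglyMeasurable.integral_prod_right (f := fun x y => F (x + y))
      (by fun_prop : Measurable (Function.uncurry fun x y => F (x + y))).stronglyMeasurable).measurable

lemma measurable_levelMap (hF : Measurable F) (d : ℕ) (v : ℝ≥0) :
    Measurable (levelMap h d v F) :=
  Finset.measurable_prod _ fun σ _ =>
    (measurable_integral_shift hF _).comp (measurable_id.add_const (h * spinSum σ))

lemma levelMap_mem (hb : ∀ x, F x ∈ Icc (0 : ℝ) 1) (d : ℕ) (v : ℝ≥0) (y : ℝ) :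
    levelMap h d v F y ∈ Icc (0 : ℝ) 1 :=
  ⟨Finset.prod_nonneg fun _ _ => (integral_mem_Icc fun _ => hb _).1,
    Finset.prod_le_one (fun _ _ => (integral_mem_Icc fun _ => hb _).1)
      fun _ _ => (integral_mem_Icc fun _ => hb _).2⟩

lemma one_sub_mem {x : ℝ} (hx : x ∈ Icc (0 : ℝ) 1) : 1 - x ∈ Icc (0 : ℝ) 1 :=
  ⟨by linarith [hx.2], by linarith [hx.1]⟩

lemma levelMap_eq (hF : Measurable F) (hb : ∀ x, F x ∈ Icc (0 : ℝ) 1) (d : ℕ) (v : ℝ≥0) (y : ℝ) :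
    levelMap h d v F y =
      ∏ σ : Config d, (1 - ∫ w, (1 - F (y + h * spinSum σ + w)) ∂gaussianReal 0 v) := by
  refine Finset.prod_congr rfl fun σ _ => ?_
  rw [integral_sub (integrable_const _) (integrable_of_mem_Icc (by fun_prop) fun _ => hb _)]
  simp

/-- The union bound over the configurations of one level. -/
lemma one_sub_levelMap_le (hF : Measurable F) (hb : ∀ x, F x ∈ Icc (0 : ℝ) 1) (d : ℕ) (v : ℝ≥0)
    (y : ℝ) : 1 - levelMap h d v F y ≤ ∫ w, (1 - F (y + w)) ∂intensity h d v := by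
  rw [levelMap_eq hF hb, integral_intensity_shift (f := fun x => 1 - F x) (by fun_prop)
    fun x => one_sub_mem (hb x)]
  exact one_sub_prod_le_sum _ fun σ _ => integral_mem_Icc fun x => one_sub_mem (hb _)

lemma levelMap_le_exp (hF : Measurable F) (hb : ∀ x, F x ∈ Icc (0 : ℝ) 1) (d : ℕ) (v : ℝ≥0)
    (y : ℝ) : levelMap h d v F y ≤ Real.exp (-∫ w, (1 - F (y + w)) ∂intensity h d v) := by
  rw [levelMap_eq hF hb, integral_intensity_shift (f := fun x => 1 - F x) (by fun_prop)
    fun x => one_sub_mem (hb x)]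
  exact prod_one_sub_le_exp _ fun σ _ => (integral_mem_Icc fun x => one_sub_mem (hb _)).2

lemma sub_rpow_le_one_sub_levelMap (hF : Measurable F) (hb : ∀ x, F x ∈ Icc (0 : ℝ) 1) (d : ℕ)
    (v : ℝ≥0) (y : ℝ) {p : ℝ} (hp1 : 1 ≤ p) (hp2 : p ≤ 2) :
    ∫ w, (1 - F (y + w)) ∂intensity h d v - (∫ w, (1 - F (y + w)) ∂intensity h d v) ^ p ≤
      1 - levelMap h d v F y := by
  rw [levelMap_eq hF hb, integral_intensity_shift (f := fun x => 1 - F x) (by fun_prop)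
    fun x => one_sub_mem (hb x)]
  exact sum_sub_rpow_le_one_sub_prod _
    (fun σ _ => integral_mem_Icc fun x => one_sub_mem (hb _)) hp1 hp2

lemma levelMap_antitone (hF : Measurable F) (hb : ∀ x, F x ∈ Icc (0 : ℝ) 1) (ha : Antitone F)
    (d : ℕ) (v : ℝ≥0) : Antitone (levelMap h d v F) := by
  intro x y hxy
  refine Finset.prod_le_prod (fun _ _ => (integral_mem_Icc fun _ => hb _).1) fun σ _ => ?_
  refine integral_mono (integrable_of_mem_Icc (by fun_prop) fun _ => hb _)
    (integrable_of_mem_Icc (by fun_prop) fun _ => hb _) fun w => ha (by linarith)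

variable {d : ℕ → ℕ} {v : ℕ → ℝ≥0} {ψ : ℝ → ℝ}

lemma measurable_iter (hψ : Measurable ψ) (r k : ℕ) : Measurable (iter h d v r k ψ) := by
  induction r generalizing k with
  | zero => exact hψ
  | succ r ih => exact measurable_levelMap (ih _) _ _

lemma iter_mem (hb : ∀ x, ψ x ∈ Icc (0 : ℝ) 1) (r k : ℕ) (y : ℝ) :
    iter h d v r k ψ y ∈ Icc (0 : ℝ) 1 := by
  induction r generalizing k y with
  | zero => exact hb y
  | succ r ih => exact levelMap_mem (fun x => ih _ _) _ _ _

lemma iter_antitone (hψ : Measurable ψ) (hb : ∀ x, ψ x ∈ Icc (0 : ℝ) 1) (ha : Antitone ψ)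
    (r k : ℕ) : Antitone (iter h d v r k ψ) := by
  induction r generalizing k with
  | zero => exact ha
  | succ r ih =>
    exact levelMap_antitone (measurable_iter hψ _ _) (iter_mem hb _ _) (ih _) _ _

lemma iter_shift (r k : ℕ) : iter h d v r k ψ =
    iter h (fun i => d (k + i)) (fun i => v (k + i)) r 0 ψ := by
  have : ∀ j, iter h d v r (k + j) ψ =
      iter h (fun i => d (k + i)) (fun i => v (k + i)) r j ψ := by
    induction r with
    | zero => intro j; rfl
    | succ r ih => intro j; rw [iter, iter, add_assoc, ih]
  exact this 0

lemma iter_comp_add (hψ : ℝ → ℝ) (c : ℝ) (r k : ℕ) (y : ℝ) :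
    iter h d v r k (fun x => hψ (x + c)) y = iter h d v r k hψ (y + c) := by
  induction r generalizing k y with
  | zero => rfl
  | succ r ih =>
    simp only [iter, levelMap]
    refine Finset.prod_congr rfl fun σ _ => ?_
    congr 1
    ext w
    rw [ih]
    congr 1
    ring

lemma integral_one_sub_le_exp (hF : Measurable F) (hb : ∀ x, F x ∈ Icc (0 : ℝ) 1) {C l : ℝ}
    (hC : ∀ x, 1 - F x ≤ C * Real.exp (l * x)) (d : ℕ) (v : ℝ≥0) (y : ℝ) :
    ∫ w, (1 - F (y + w)) ∂intensity h d v ≤ C * Real.exp (l * y + logMoment h l d v) := by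
  rw [Real.exp_add, ← integral_exp_intensity, ← mul_assoc, ← integral_const_mul]
  refine integral_mono (integrable_of_mem_Icc (by fun_prop) fun x => one_sub_mem (hb _))
    ((integrable_exp_intensity _ _ _ _).const_mul _) fun w => ?_
  refine (hC _).trans_eq ?_
  rw [mul_add, Real.exp_add]; ring

/-- Exponentials are eigenfunctions of integration against the shifted intensity, with eigenvalue
exp of `logMoment`. An exponential bound therefore passes through all levels with its exponent
unchanged. -/
lemma one_sub_iter_le_exp (hψ : Measurable ψ) (hb : ∀ x, ψ x ∈ Icc (0 : ℝ) 1) {C l : ℝ}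
    (hC : ∀ x, 1 - ψ x ≤ C * Real.exp (l * x)) (r k : ℕ) (y : ℝ) :
    1 - iter h d v r k ψ y ≤ C * Real.exp (l * y + logMoment h l
      (∑ i ∈ Finset.range r, (d (k + i) : ℝ)) (∑ i ∈ Finset.range r, (v (k + i) : ℝ))) := by
  induction r generalizing k y with
  | zero => simpa [logMoment, iter] using hC y
  | succ r ih =>
    rw [Finset.sum_range_succ', Finset.sum_range_succ', logMoment_add]
    set A := logMoment h l (∑ i ∈ Finset.range r, (d (k + (i + 1)) : ℝ))
      (∑ i ∈ Finset.range r, (v (k + (i + 1)) : ℝ)) with hA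
    have h1 : ∀ x, 1 - iter h d v r (k + 1) ψ x ≤ (C * Real.exp A) * Real.exp (l * x) := by
      intro x
      refine (ih (k + 1) x).trans_eq ?_
      rw [Real.exp_add, hA]
      simp only [add_assoc, add_comm 1]
      ring
    refine (one_sub_levelMap_le (measurable_iter hψ _ _) (iter_mem hb _ _) _ _ _).trans ?_
    refine (integral_one_sub_le_exp (measurable_iter hψ _ _) (iter_mem hb _ _) h1 _ _ _).trans_eq ?_
    rw [mul_assoc, ← Real.exp_add]
    congr 2
    simp only [add_zero]
    ring

end

/-! ### Lower bounds for the intensity of large energies -/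

lemma hasDerivAt_tanh (x : ℝ) : HasDerivAt Real.tanh (1 - Real.tanh x ^ 2) x := by
  have he : Real.tanh = fun x => Real.sinh x / Real.cosh x := by
    ext x; exact Real.tanh_eq_sinh_div_cosh x
  have hc := (Real.cosh_pos x).ne'
  have h := (Real.hasDerivAt_sinh x).div (Real.hasDerivAt_cosh x) hc
  rw [he]
  refine h.congr_deriv ?_
  field_simp

section

variable (h : ℝ) (d : ℕ) (v : ℝ≥0)

lemma cgf_intensity : cgf id (intensity h d v) = fun l => logMoment h l d v := by
  ext l
  simp only [cgf, mgf, id, integral_exp_intensity, Real.log_exp]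

lemma hasDerivAt_logMoment (l D V : ℝ) :
    HasDerivAt (fun l => logMoment h l D V) (h * Real.tanh (l * h) * D + l * V) l := by
  have h1 := (hasDerivAt_log_two_cosh (l * h)).comp l ((hasDerivAt_id l).mul_const h)
  have h2 := ((hasDerivAt_pow 2 l).mul_const V).div_const 2
  refine ((h1.const_mul D).add h2).congr_deriv ?_
  simp
  ring

lemma iteratedDeriv_two_logMoment (l D V : ℝ) :
    iteratedDeriv 2 (fun l => logMoment h l D V) l =
      h ^ 2 * (1 - Real.tanh (l * h) ^ 2) * D + V := by
  rw [show (2 : ℕ) = 1 + 1 from rfl, iteratedDeriv_succ, iteratedDeriv_one,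
    funext fun l => (hasDerivAt_logMoment h l D V).deriv]
  have h1 := (hasDerivAt_tanh (l * h)).comp l ((hasDerivAt_id l).mul_const h)
  have h2 : HasDerivAt (fun l => h * Real.tanh (l * h) * D + l * V)
      (h * ((1 - Real.tanh (l * h) ^ 2) * (1 * h)) * D + 1 * V) l :=
    ((h1.const_mul h).mul_const D).add ((hasDerivAt_id l).mul_const V)
  rw [h2.deriv]
  ring

/-- Cramér's change of measure. Tilted by `l`, the normalised intensity has mean `m` and variance at
most η²/2, so Chebyshev leaves mass at least 1/2 within η of `m`. Undoing the tilt there costs at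
most the density bound at m + η. -/
lemma intensity_real_ge {l η : ℝ} (hl : 0 ≤ l) (hη : 0 < η) (hvar : h ^ 2 * d + v ≤ η ^ 2 / 2) :
    Real.exp (d * tiltEntropy (l * h) - l ^ 2 * v / 2 - l * η) / 2 ≤
      (intensity h d v).real (Ici (h * Real.tanh (l * h) * d + l * v - η)) := by
  set μ := intensity h d v with hμ
  set m := h * Real.tanh (l * h) * d + l * v with hm
  have hint : l ∈ interior (integrableExpSet id μ) := by
    have : integrableExpSet id μ = univ := by
      ext t; simpa [integrableExpSet] using integrable_exp_intensity h t d v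
    rw [this, interior_univ]; trivial
  have hZ : ∫ w, Real.exp (l * id w) ∂μ = Real.exp (logMoment h l d v) :=
    integral_exp_intensity h l d v
  have hZpos := Real.exp_pos (logMoment h l d v)
  have : NeZero μ := ⟨fun h0 => by
    rw [h0, integral_zero_measure] at hZ; exact hZpos.ne hZ⟩
  set ν := μ.tilted fun w => l * id w with hν
  have : IsProbabilityMeasure ν :=
    isProbabilityMeasure_tilted (integrable_exp_intensity h l d v)
  have hmean : ∫ w, id w ∂ν = m := by
    rw [hν, integral_tilted_mul_self hint, cgf_intensity, (hasDerivAt_logMoment h l d v).deriv]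
  have hvar' : Var[id; ν] ≤ η ^ 2 / 2 := by
    rw [hν, variance_tilted_mul hint, cgf_intensity, iteratedDeriv_two_logMoment]
    refine le_trans ?_ hvar
    have : h ^ 2 * (1 - Real.tanh (l * h) ^ 2) * d ≤ h ^ 2 * 1 * d := by
      gcongr
      linarith [sq_nonneg (Real.tanh (l * h))]
    linarith
  have hcheb : ν.real {w | η ≤ |id w - m|} ≤ 1 / 2 := by
    have h1 := meas_ge_le_variance_div_sq (memLp_tilted_mul hint 2) hη
    rw [← hν, hmean] at h1
    rw [Measure.real]
    refine ENNReal.toReal_le_of_le_ofReal (by norm_num) (h1.trans (ENNReal.ofReal_le_ofReal ?_))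
    rw [div_le_iff₀ (by positivity)]
    linarith
  set A := Ioo (m - η) (m + η) with hA
  have hAν : 1 / 2 ≤ ν.real A := by
    have h1 : {w : ℝ | η ≤ |id w - m|} = Aᶜ := by
      ext w
      simp only [mem_ofPred_eq, id, hA, mem_compl_iff, mem_Ioo, not_and_or, not_lt,
        le_abs]
      constructor
      · rintro (h | h)
        · right; linarith
        · left; linarith
      · rintro (h | h)
        · right; linarith
        · left; linarith
    rw [h1, probReal_compl_eq_one_sub measurableSet_Ioo] at hcheb
    linarith
  have hAμ : ν.real A ≤ Real.exp (l * (m + η) - logMoment h l d v) * μ.real A := by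
    rw [← setIntegral_one_eq_measureReal (μ := ν), hν, setIntegral_tilted, hZ,
      ← setIntegral_one_eq_measureReal (μ := μ), ← integral_const_mul]
    refine setIntegral_mono_on ?_ (integrable_const _).integrableOn measurableSet_Ioo
      fun w hw => ?_
    · simp only [smul_eq_mul, mul_one]
      exact ((integrable_exp_intensity h l d v).div_const _).integrableOn
    · rw [smul_eq_mul, mul_one, mul_one, ← Real.exp_sub]
      exact Real.exp_le_exp.2 (sub_le_sub_right (mul_le_mul_of_nonneg_left hw.2.le hl) _)
  have hfin : μ.real A ≤ μ.real (Ici (m - η)) :=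
    measureReal_mono fun w hw => hw.1.le
  have hexp : Real.exp (d * tiltEntropy (l * h) - l ^ 2 * v / 2 - l * η) *
      Real.exp (l * (m + η) - logMoment h l d v) = 1 := by
    rw [← Real.exp_add, Real.exp_eq_one_iff, logMoment, tiltEntropy, hm]
    ring
  have hE := Real.exp_pos (d * tiltEntropy (l * h) - l ^ 2 * v / 2 - l * η)
  have h3 := mul_le_mul_of_nonneg_left (hAν.trans hAμ) hE.le
  rw [← mul_assoc, hexp, one_mul] at h3
  linarith

variable {h}

lemma levelMap_le_exp_measure {F : ℝ → ℝ} (hF : Measurable F) (hb : ∀ x, F x ∈ Icc (0 : ℝ) 1)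
    (ha : Antitone F) (y e : ℝ) :
    levelMap h d v F (y - e) ≤ Real.exp (-((intensity h d v).real (Ici e) * (1 - F y))) := by
  refine (levelMap_le_exp hF hb d v _).trans (Real.exp_le_exp.2 (neg_le_neg ?_))
  rw [← smul_eq_mul, ← setIntegral_const]
  have hi : Integrable (fun w => 1 - F (y - e + w)) (intensity h d v) :=
    integrable_of_mem_Icc (by fun_prop) fun x => one_sub_mem (hb _)
  refine (setIntegral_mono_on (integrable_const _).integrableOn hi.integrableOn measurableSet_Ici
    fun w hw => ?_).trans (setIntegral_le_integral hi (ae_of_all _ fun w => (one_sub_mem (hb _)).1))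
  have := ha (show y ≤ y - e + w by linarith [mem_Ici.1 hw])
  linarith

end

lemma half_min_le_one_sub_exp_neg {x : ℝ} (hx : 0 ≤ x) : min 1 x / 2 ≤ 1 - Real.exp (-x) := by
  have h0 : 0 ≤ min 1 x := le_min zero_le_one hx
  have h1 : Real.exp (-x) ≤ Real.exp (-min 1 x) := Real.exp_le_exp.2 (neg_le_neg (min_le_right _ _))
  have h2 : Real.exp (-min 1 x) ≤ (1 + min 1 x)⁻¹ := by
    rw [Real.exp_neg]
    exact inv_anti₀ (by linarith) (by linarith [Real.add_one_le_exp (min 1 x)])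
  have h3 : (1 + min 1 x)⁻¹ ≤ 1 - min 1 x / 2 := by
    rw [inv_le_iff_one_le_mul₀ (by linarith)]
    nlinarith [min_le_left 1 x]
  linarith

/-- Lower bound for the largest energy in a group of levels: if all initial segments have
exponentially many paths following the given energy profile, the probability that the profile is
not exceeded decays superexponentially. -/
lemma iter_le_exp_neg_exp {h l κ c₀ T : ℝ} {r : ℕ} (hl : 0 ≤ l) (hκ : 0 < κ)
    {d : ℕ → ℕ} {v : ℕ → ℝ≥0} {ξ η : ℕ → ℝ} (hT : 0 < T) (hr : 0 < r)
    (hd : ∀ k < r, (d k : ℝ) = ξ k * T) (hv : ∀ k < r, (v k : ℝ) = η k * T)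
    (hlarge : ∀ k < r, h ^ 2 * ξ k + η k ≤ κ ^ 2 * T / 2)
    (hS : ∀ j, 0 < j → j ≤ r → c₀ ≤ ∑ k ∈ Finset.range j,
      (ξ k * tiltEntropy (l * h) - l ^ 2 * η k / 2 - l * κ))
    {F : ℝ → ℝ} (hF : Measurable F) (hb : ∀ x, F x ∈ Icc (0 : ℝ) 1) (ha : Antitone F) {y : ℝ}
    (hy : F y ≤ 1 / 2) :
    iter h d v r 0 F (y - ∑ k ∈ Finset.range r,
      (h * Real.tanh (l * h) * ξ k + l * η k - κ) * T) ≤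
        Real.exp (-((4 : ℝ)⁻¹ ^ (r + 1) * Real.exp (c₀ * T))) := by
  -- `s k` is the exponential growth rate of the number of points of level `k` above the energy `e
  -- k`; the slack κ pays for Chebyshev.
  set s : ℕ → ℝ := fun k => ξ k * tiltEntropy (l * h) - l ^ 2 * η k / 2 - l * κ with hs
  set e : ℕ → ℝ := fun k => (h * Real.tanh (l * h) * ξ k + l * η k - κ) * T with he
  have htail : ∀ k < r, Real.exp (s k * T) / 2 ≤ (intensity h (d k) (v k)).real (Ici (e k)) := by
    intro k hk
    have := intensity_real_ge h (d k) (v k) (l := l) (η := κ * T) hl (by positivity) (by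
      rw [hd k hk, hv k hk]; nlinarith [hlarge k hk])
    rw [hd k hk, hv k hk] at this
    convert this using 4 <;> simp only [hs, he] <;> ring
  have hstep : ∀ t k, k + (t + 1) = r → ∀ z,
      iter h d v (t + 1) k F (z - e k) ≤ Real.exp (-(Real.exp (s k * T) / 2 *
        (1 - iter h d v t (k + 1) F z))) := by
    intro t k hk z
    refine (levelMap_le_exp_measure (d k) (v k) (measurable_iter hF _ _) (iter_mem hb _ _)
      (iter_antitone hF hb ha _ _) z (e k)).trans (Real.exp_le_exp.2 (neg_le_neg ?_))
    exact mul_le_mul_of_nonneg_right (htail k (by omega)) (one_sub_mem (iter_mem hb _ _ _)).1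
  -- Induction from the last level upwards. The success probability of a subtree may be
  -- exponentially small, but not smaller than the number of paths above it allows; the surplus rate
  -- c₀ is kept in reserve, and each level costs a factor 4.
  have hind : ∀ t k, k + t = r → 0 < k →
      2⁻¹ * (4 : ℝ)⁻¹ ^ t * Real.exp (-((∑ i ∈ Finset.range k, s i) - c₀) * T) ≤
        1 - iter h d v t k F (y - ∑ i ∈ Finset.range t, e (k + i)) := by
    intro t
    induction t with
    | zero =>
      intro k hk hk0
      have h1 : Real.exp (-((∑ i ∈ Finset.range k, s i) - c₀) * T) ≤ 1 := by
        rw [Real.exp_le_one_iff]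
        have := hS k hk0 (by omega)
        nlinarith
      simp only [iter, Finset.range_zero, Finset.sum_empty, sub_zero, pow_zero]
      linarith
    | succ t ih =>
      intro k hk hk0
      have h1 := ih (k + 1) (by omega) (by omega)
      have h2 := hstep t k (by omega) (y - ∑ i ∈ Finset.range t, e (k + 1 + i))
      have h3 : y - ∑ i ∈ Finset.range t, e (k + 1 + i) - e k =
          y - ∑ i ∈ Finset.range (t + 1), e (k + i) := by
        rw [Finset.sum_range_succ', sub_sub]
        simp only [add_assoc, add_comm 1, add_zero]
      rw [h3] at h2
      set p := 1 - iter h d v t (k + 1) F (y - ∑ i ∈ Finset.range t, e (k + 1 + i)) with hp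
      have hp0 : 0 ≤ p := (one_sub_mem (iter_mem hb _ _ _)).1
      have h4 := half_min_le_one_sub_exp_neg
        (mul_nonneg (half_pos (Real.exp_pos (s k * T))).le hp0)
      refine le_trans ?_ (h4.trans (by linarith))
      set q := Real.exp (-((∑ i ∈ Finset.range k, s i) - c₀) * T) with hq
      have hq1 : q ≤ 1 := by
        rw [hq, Real.exp_le_one_iff]
        have := hS k hk0 (by omega)
        nlinarith
      have h5 : 4⁻¹ ^ (t + 1) * q ≤ Real.exp (s k * T) / 2 * p := by
        have h6 := mul_le_mul_of_nonneg_left h1 (half_pos (Real.exp_pos (s k * T))).le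
        refine le_trans (le_of_eq ?_) h6
        have h7 : q = Real.exp (s k * T) *
            Real.exp (-((∑ i ∈ Finset.range (k + 1), s i) - c₀) * T) := by
          rw [hq, ← Real.exp_add, Finset.sum_range_succ]; congr 1; ring
        rw [h7, pow_succ]; ring
      have h8 : (4 : ℝ)⁻¹ ^ (t + 1) * q ≤ 1 :=
        mul_le_one₀ (pow_le_one₀ (by norm_num) (by norm_num)) (Real.exp_pos _).le hq1
      have := le_min h8 h5
      linarith
  -- At the first level the subtrees are independent trials; their number times their success
  -- probability is of order exp(c₀T), which makes the failure probability doubly exponentially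
  -- small.
  obtain ⟨t, rfl⟩ : ∃ t, r = t + 1 := ⟨r - 1, by omega⟩
  have h1 := hind t 1 (by omega) one_pos
  have h2 := hstep t 0 (by omega) (y - ∑ i ∈ Finset.range t, e (1 + i))
  have h3 : y - ∑ i ∈ Finset.range t, e (1 + i) - e 0 =
      y - ∑ i ∈ Finset.range (t + 1), e i := by
    rw [Finset.sum_range_succ', sub_sub]
    simp only [add_comm 1]
  rw [h3] at h2
  refine h2.trans (Real.exp_le_exp.2 (neg_le_neg ?_))
  have h4 := mul_le_mul_of_nonneg_left h1 (half_pos (Real.exp_pos (s 0 * T))).le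
  refine le_trans (le_of_lt ?_) h4
  have h5 : Real.exp (s 0 * T) / 2 * (2⁻¹ * (4 : ℝ)⁻¹ ^ t *
      Real.exp (-((∑ i ∈ Finset.range 1, s i) - c₀) * T)) =
      4 * ((4 : ℝ)⁻¹ ^ (t + 1 + 1) * Real.exp (c₀ * T)) := by
    have : Real.exp (c₀ * T) = Real.exp (s 0 * T) *
        Real.exp (-((∑ i ∈ Finset.range 1, s i) - c₀) * T) := by
      rw [← Real.exp_add, Finset.sum_range_one]; congr 1; ring
    rw [this, pow_succ, pow_succ]; ring
  rw [h5]
  have : 0 < (4 : ℝ)⁻¹ ^ (t + 1 + 1) * Real.exp (c₀ * T) := by positivity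
  linarith

/-! ### Tails of the ground state -/

namespace OrderParameter

variable {n : ℕ} (D : OrderParameter n) {h : ℝ}

/-- The contribution of block `l` to the limit of the ground state. -/
def blockMax (h : ℝ) (l : ℕ) : ℝ :=
  Real.sqrt (D.qBar h l * D.xBar h l) * maxValue (h / Real.sqrt (D.thetaBar h l))

/-- The tilting parameter of block `l`. -/
def blockTilt (h : ℝ) (l : ℕ) : ℝ := tilt h (D.thetaBar h l)

lemma blockTilt_pos (hh : 0 ≤ h) {l : ℕ} (hl : l < D.m h) : 0 < D.blockTilt h l :=
  tilt_pos hh (D.thetaBar_pos hh hl)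

lemma qBar_eq (hh : 0 ≤ h) {l : ℕ} (hl : l < D.m h) :
    D.qBar h l = D.thetaBar h l * D.xBar h l := by
  rw [thetaBar_eq, div_mul_cancel₀ _ (D.xBar_pos hh hl).ne']

lemma blockMax_eq (hh : 0 ≤ h) {l : ℕ} (hl : l < D.m h) :
    D.blockMax h l = D.blockTilt h l * D.qBar h l +
      h * Real.tanh (D.blockTilt h l * h) * D.xBar h l := by
  have hx := D.xBar_pos hh hl
  have h1 := (tilt_spec hh (D.thetaBar_pos hh hl)).2.2.2.2
  rw [blockMax, D.qBar_eq hh hl, mul_assoc, Real.sqrt_mul (D.thetaBar_pos hh hl).le,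
    Real.sqrt_mul_self hx.le, mul_right_comm, h1, blockTilt]
  ring

lemma two_mul_tiltEntropy_blockTilt (hh : 0 ≤ h) {l : ℕ} (hl : l < D.m h) :
    2 * tiltEntropy (D.blockTilt h l * h) = D.blockTilt h l ^ 2 * D.thetaBar h l :=
  (tilt_spec hh (D.thetaBar_pos hh hl)).2.2.2.1

/-- At the tilt of the block the first-moment bound is balanced exactly at the speed `blockMax`;
this is the critical equation of `tilt_spec`. -/
lemma logMoment_block (hh : 0 ≤ h) {l : ℕ} (hl : l < D.m h) (N : ℝ) :
    logMoment h (D.blockTilt h l) (D.xBar h l * N) (D.qBar h l * N) =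
      D.blockTilt h l * (D.blockMax h l * N) := by
  have h1 := D.two_mul_tiltEntropy_blockTilt hh hl
  rw [D.blockMax_eq hh hl, logMoment, D.qBar_eq hh hl]
  rw [tiltEntropy] at h1
  linear_combination (D.xBar h l * N / 2) * h1

variable {D} in
lemma sum_levelSize_block {N : ℕ} (hdiv : ∀ k ≤ n, ∃ r : ℕ, D.x k * (N : ℝ) = r) {k r : ℕ}
    (hkr : k + r ≤ n) :
    ∑ i ∈ Finset.range r, (D.levelSize N (k + i) : ℝ) = (D.x (k + r) - D.x k) * N := by
  rw [Finset.sum_congr rfl fun i hi => coe_levelSize hdiv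
    (show k + i < n by have := Finset.mem_range.1 hi; omega), ← Finset.sum_mul]
  exact congrArg (· * (N : ℝ)) (Finset.sum_range_sub (fun i => D.x (k + i)) r)

lemma sum_levelVar_block (N : ℕ) {k r : ℕ} (hkr : k + r ≤ n) :
    ∑ i ∈ Finset.range r, (D.levelVar N (k + i) : ℝ) = (D.q (k + r) - D.q k) * N := by
  rw [Finset.sum_congr rfl fun i hi => D.coe_levelVar N
    (show k + i < n by have := Finset.mem_range.1 hi; omega), ← Finset.sum_mul]
  exact congrArg (· * (N : ℝ)) (Finset.sum_range_sub (fun i => D.q (k + i)) r)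

lemma iter_block_split (hh : 0 ≤ h) {l : ℕ} (hl : l < D.m h) (d : ℕ → ℕ) (v : ℕ → ℝ≥0)
    (ψ : ℝ → ℝ) : iter h d v (n - D.J h l) (D.J h l) ψ =
      iter h d v (D.J h (l + 1) - D.J h l) (D.J h l)
        (iter h d v (n - D.J h (l + 1)) (D.J h (l + 1)) ψ) := by
  have h1 := D.J_lt_J_succ hh hl
  have h2 := D.J_succ_le hh hl
  conv_lhs => rw [show n - D.J h l = (D.J h (l + 1) - D.J h l) + (n - D.J h (l + 1)) by omega]
  rw [iter_add, show D.J h l + (D.J h (l + 1) - D.J h l) = D.J h (l + 1) by omega]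

variable {D} in
lemma one_sub_iter_block_le (hh : 0 ≤ h) {l : ℕ} (hl : l < D.m h) {N : ℕ}
    (hdiv : ∀ k ≤ n, ∃ r : ℕ, D.x k * (N : ℝ) = r) {F : ℝ → ℝ} (hF : Measurable F)
    (hb : ∀ x, F x ∈ Icc (0 : ℝ) 1) {C : ℝ}
    (hC : ∀ x, 1 - F x ≤ C * Real.exp (D.blockTilt h l * x)) (y : ℝ) :
    1 - iter h (D.levelSize N) (D.levelVar N) (D.J h (l + 1) - D.J h l) (D.J h l) F y ≤
      C * Real.exp (D.blockTilt h l * (y + D.blockMax h l * N)) := by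
  have h1 := D.J_lt_J_succ hh hl
  have h2 := D.J_succ_le hh hl
  refine (one_sub_iter_le_exp hF hb hC _ _ y).trans_eq ?_
  rw [sum_levelSize_block hdiv (by omega), D.sum_levelVar_block N (by omega),
    show D.J h l + (D.J h (l + 1) - D.J h l) = D.J h (l + 1) by omega, mul_add,
    ← D.logMoment_block hh hl]
  rfl

/-- The indicator function of `(-∞, c)`. -/
def below (c : ℝ) : ℝ → ℝ := (Iio c).indicator 1

lemma measurable_below (c : ℝ) : Measurable (below c) :=
  measurable_one.indicator measurableSet_Iio

lemma below_mem (c x : ℝ) : below c x ∈ Icc (0 : ℝ) 1 := by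
  unfold below indicator; split_ifs <;> simp

lemma below_antitone (c : ℝ) : Antitone (below c) := by
  intro x y hxy
  unfold below indicator
  split_ifs with h1 h2
  · exact le_rfl
  · exact absurd (lt_of_le_of_lt hxy h1) h2
  · simp
  · exact le_rfl

variable {D} in
-- Each block, from the last to the first, is estimated with its own tilt. The bound left by the
-- later blocks has a larger exponent, which can be lowered to the tilt of the present block; `lam`
-- carries this freedom through the induction.
lemma one_sub_iter_below_le (hh : 0 ≤ h) {N : ℕ}
    (hdiv : ∀ k ≤ n, ∃ r : ℕ, D.x k * (N : ℝ) = r) (c : ℝ) (s l : ℕ) (hsl : l + s = D.m h)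
    {lam : ℝ} (hlam : 0 < lam) (hle : l < D.m h → lam ≤ D.blockTilt h l) (y : ℝ) :
    1 - iter h (D.levelSize N) (D.levelVar N) (n - D.J h l) (D.J h l) (below c) y ≤
      Real.exp (lam * (y - c + (∑ i ∈ Finset.Ico l (D.m h), D.blockMax h i) * N)) := by
  induction s generalizing l lam y with
  | zero =>
    obtain rfl : l = D.m h := by omega
    rw [D.J_m hh, Nat.sub_self, iter, Finset.Ico_self, Finset.sum_empty, zero_mul, add_zero]
    unfold below indicator
    split_ifs with hy
    · simpa using (Real.exp_pos _).le
    · have : 0 ≤ lam * (y - c) := mul_nonneg hlam.le (sub_nonneg.2 (not_lt.1 hy))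
      simpa using this
  | succ s ih =>
    have hl : l < D.m h := by omega
    set z := y - c + (∑ i ∈ Finset.Ico l (D.m h), D.blockMax h i) * N with hz
    have hpos := D.blockTilt_pos hh hl
    have key : 1 - iter h (D.levelSize N) (D.levelVar N) (n - D.J h l) (D.J h l) (below c) y ≤
        Real.exp (D.blockTilt h l * z) := by
      rw [D.iter_block_split hh hl]
      have hC (x : ℝ) : 1 - iter h (D.levelSize N) (D.levelVar N) (n - D.J h (l + 1))
          (D.J h (l + 1)) (below c) x ≤ Real.exp (D.blockTilt h l *
            (-c + (∑ i ∈ Finset.Ico (l + 1) (D.m h), D.blockMax h i) * N)) *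
            Real.exp (D.blockTilt h l * x) := by
        refine (ih (l + 1) (by omega) hpos (fun h' => (D.tilt_thetaBar_lt hh h').le) x).trans_eq ?_
        rw [← Real.exp_add]; congr 1; ring
      refine (one_sub_iter_block_le hh hl hdiv (measurable_iter (measurable_below c) _ _)
        (iter_mem (below_mem c) _ _) hC y).trans_eq ?_
      rw [← Real.exp_add, hz, Finset.sum_eq_sum_Ico_succ_bot hl]
      congr 1; ring
    -- For z ≥ 0 the asserted bound is at least 1; for z ≤ 0 a smaller exponent only weakens it.
    rcases le_total 0 z with h0 | h0
    · have h1 : 1 ≤ Real.exp (lam * z) := by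
        rw [← Real.exp_zero]; exact Real.exp_le_exp.2 (mul_nonneg hlam.le h0)
      linarith [(iter_mem (h := h) (d := D.levelSize N) (v := D.levelVar N) (below_mem c)
        (n - D.J h l) (D.J h l) y).1]
    · exact key.trans (Real.exp_le_exp.2 (mul_le_mul_of_nonpos_right (hle hl) h0))

/-- With tilt aλ, a < 1, the prescribed energies still add up to nearly `blockMax`, while every
initial segment has positive entropy because its variance is at most θ times its length. Only the
weak inequality is used, so ties are allowed. -/
lemma exists_iter_block_le (hh : 0 ≤ h) {l : ℕ} (hl : l < D.m h) {ε : ℝ} (hε : 0 < ε) :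
    ∃ c > 0, ∀ᶠ N : ℕ in atTop, (∀ k ≤ n, ∃ r : ℕ, D.x k * (N : ℝ) = r) →
      ∀ F : ℝ → ℝ, Measurable F → (∀ x, F x ∈ Icc (0 : ℝ) 1) → Antitone F → ∀ y, F y ≤ 1 / 2 →
        iter h (D.levelSize N) (D.levelVar N) (D.J h (l + 1) - D.J h l) (D.J h l) F
          (y - (D.blockMax h l - ε) * N) ≤ Real.exp (-(c * N)) := by
  have h1 := D.J_lt_J_succ hh hl
  have h2 := D.J_succ_le hh hl
  set r := D.J h (l + 1) - D.J h l with hr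
  have hr0 : 0 < r := by omega
  set lam := D.blockTilt h l with hlam
  have hlam0 : 0 < lam := D.blockTilt_pos hh hl
  set ξ : ℕ → ℝ := fun k => D.x (D.J h l + k + 1) - D.x (D.J h l + k) with hξ
  set η : ℕ → ℝ := fun k => D.q (D.J h l + k + 1) - D.q (D.J h l + k) with hη
  have hξsum (j : ℕ) : ∑ k ∈ Finset.range j, ξ k = D.x (D.J h l + j) - D.x (D.J h l) :=
    Finset.sum_range_sub (fun i => D.x (D.J h l + i)) j
  have hηsum (j : ℕ) : ∑ k ∈ Finset.range j, η k = D.q (D.J h l + j) - D.q (D.J h l) :=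
    Finset.sum_range_sub (fun i => D.q (D.J h l + i)) j
  have hJr : D.J h l + r = D.J h (l + 1) := by omega
  obtain ⟨a, ha0, ha1, ha⟩ : ∃ a, 0 < a ∧ a < 1 ∧ D.blockMax h l - ε / 2 <
      a * lam * D.qBar h l + h * Real.tanh (a * lam * h) * D.xBar h l := by
    have hcont : Continuous fun a : ℝ =>
        a * lam * D.qBar h l + h * Real.tanh (a * lam * h) * D.xBar h l := by
      have := continuous_tanh
      fun_prop
    have hev := (hcont.tendsto 1).eventually_const_lt (u := D.blockMax h l - ε / 2)
      (by rw [D.blockMax_eq hh hl, one_mul, ← hlam]; linarith)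
    obtain ⟨a, ha, ha'⟩ := ((hev.filter_mono (nhdsWithin_le_nhds (s := Iio 1))).and
      (Ioo_mem_nhdsLT (show (0 : ℝ) < 1 by norm_num))).exists
    exact ⟨a, ha'.1, ha'.2, ha⟩
  set θ := D.thetaBar h l with hθ
  have hθ0 : 0 < θ := D.thetaBar_pos hh hl
  have hξ0 : 0 < ξ 0 := sub_pos.2 (D.x_lt _ (by omega))
  -- Half of a lower bound for the surplus entropy (1 - a²)λ²θX/2 with X ≥ ξ 0; the other half
  -- absorbs the slacks κ.
  set c₀ := (1 - a ^ 2) * lam ^ 2 * θ * ξ 0 / 4 with hc₀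
  have ha2 : 0 < 1 - a ^ 2 := by nlinarith
  have hc₀pos : 0 < c₀ := by positivity
  obtain ⟨κ, hκ0, hκ1, hκ2⟩ : ∃ κ > 0, r * (a * lam * κ) ≤ c₀ ∧ r * κ ≤ ε / 2 := by
    have hr0' : (0 : ℝ) < r := Nat.cast_pos.2 hr0
    refine ⟨min (c₀ / (r * (a * lam))) (ε / 2 / r), by positivity, ?_, ?_⟩
    · calc r * (a * lam * min (c₀ / (r * (a * lam))) (ε / 2 / r))
          ≤ r * (a * lam * (c₀ / (r * (a * lam)))) := by gcongr; exact min_le_left _ _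
        _ = c₀ := by field_simp
    · calc r * min (c₀ / (r * (a * lam))) (ε / 2 / r) ≤ r * (ε / 2 / r) := by
            gcongr; exact min_le_right _ _
        _ = ε / 2 := by field_simp
  have hlarge : ∀ᶠ N : ℕ in atTop, ∀ k ∈ Finset.range r,
      h ^ 2 * ξ k + η k ≤ κ ^ 2 * (N : ℝ) / 2 := by
    refine (Filter.eventually_all_finset _).2 fun k _ => ?_
    have : Tendsto (fun N : ℕ => κ ^ 2 * (N : ℝ) / 2) atTop atTop :=
      (tendsto_natCast_atTop_atTop.const_mul_atTop (by positivity)).atTop_div_const (by norm_num)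
    exact this.eventually_ge_atTop _
  refine ⟨(4 : ℝ)⁻¹ ^ (r + 1) * c₀, by positivity, ?_⟩
  filter_upwards [hlarge, eventually_gt_atTop 0] with N hN hN0 hdiv F hF hb hanti y hy
  have hN0' : (0 : ℝ) < N := Nat.cast_pos.2 hN0
  have main := iter_le_exp_neg_exp (h := h) (l := a * lam) (κ := κ) (c₀ := c₀) (T := N) (r := r)
    (by positivity) hκ0 (d := fun k => D.levelSize N (D.J h l + k))
    (v := fun k => D.levelVar N (D.J h l + k)) (ξ := ξ) (η := η) hN0' hr0
    (fun k hk => coe_levelSize hdiv (by omega)) (fun k hk => D.coe_levelVar N (by omega))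
    (fun k hk => hN k (Finset.mem_range.2 hk)) ?_ hF hb hanti hy
  · rw [← iter_shift] at main
    refine (iter_antitone hF hb hanti _ _ ?_).trans (main.trans (Real.exp_le_exp.2 (neg_le_neg ?_)))
    · refine sub_le_sub_left ?_ y
      rw [← Finset.sum_mul]
      refine mul_le_mul_of_nonneg_right ?_ hN0'.le
      rw [Finset.sum_sub_distrib, Finset.sum_add_distrib, ← Finset.mul_sum, ← Finset.mul_sum,
        hξsum, hηsum, hJr, Finset.sum_const, Finset.card_range, nsmul_eq_mul]
      change _ ≤ h * Real.tanh (a * lam * h) * D.xBar h l + a * lam * D.qBar h l - r * κ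
      linarith
    · rw [mul_assoc]
      gcongr
      linarith [Real.add_one_le_exp (c₀ * N)]
  · intro j hj0 hjr
    have hX : ξ 0 ≤ ∑ k ∈ Finset.range j, ξ k :=
      Finset.single_le_sum (f := ξ) (fun k hk => (sub_pos.2 (D.x_lt _
        (by have := Finset.mem_range.1 hk; omega))).le) (Finset.mem_range.2 hj0)
    have hH : ∑ k ∈ Finset.range j, η k ≤ θ * ∑ k ∈ Finset.range j, ξ k := by
      rw [hξsum, hηsum]
      exact D.q_sub_le_thetaBar_mul hh hl (by omega) (by omega)
    have hE : lam ^ 2 * θ / 2 ≤ tiltEntropy (a * lam * h) := by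
      have e1 := D.two_mul_tiltEntropy_blockTilt hh hl
      have e2 : tiltEntropy (lam * h) ≤ tiltEntropy (a * lam * h) :=
        tiltEntropy_antitone (by positivity)
          (mul_le_mul_of_nonneg_right (by nlinarith) hh)
      linarith
    rw [Finset.sum_sub_distrib, Finset.sum_sub_distrib, ← Finset.sum_mul, ← Finset.sum_div,
      ← Finset.mul_sum, Finset.sum_const, Finset.card_range, nsmul_eq_mul]
    set X := ∑ k ∈ Finset.range j, ξ k
    set H := ∑ k ∈ Finset.range j, η k
    have hX0 : 0 < X := hξ0.trans_le hX
    have e3 : X * (lam ^ 2 * θ / 2) ≤ X * tiltEntropy (a * lam * h) :=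
      mul_le_mul_of_nonneg_left hE hX0.le
    have e4 : (a * lam) ^ 2 * H ≤ (a * lam) ^ 2 * (θ * X) :=
      mul_le_mul_of_nonneg_left hH (sq_nonneg _)
    have e5 : (1 - a ^ 2) * lam ^ 2 * θ * ξ 0 ≤ (1 - a ^ 2) * lam ^ 2 * θ * X :=
      mul_le_mul_of_nonneg_left hX (by positivity)
    have e6 : (j : ℝ) * (a * lam * κ) ≤ r * (a * lam * κ) :=
      mul_le_mul_of_nonneg_right (Nat.cast_le.2 hjr) (by positivity)
    nlinarith

/-- Backwards over the blocks, halving ε each time. A block only needs the later ones to succeed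
with probability at least 1/2, so this weaker conclusion is carried along; it also holds at l = m,
where there is no block to give an exponential rate. -/
lemma exists_iter_below_le (hh : 0 ≤ h) (s l : ℕ) (hsl : l + s = D.m h) {ε : ℝ} (hε : 0 < ε) :
    (l < D.m h → ∃ c > 0, ∀ᶠ N : ℕ in atTop, (∀ k ≤ n, ∃ r : ℕ, D.x k * (N : ℝ) = r) →
      ∀ C, iter h (D.levelSize N) (D.levelVar N) (n - D.J h l) (D.J h l) (below C)
        (C - (∑ i ∈ Finset.Ico l (D.m h), D.blockMax h i - ε) * N) ≤ Real.exp (-(c * N))) ∧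
    ∀ᶠ N : ℕ in atTop, (∀ k ≤ n, ∃ r : ℕ, D.x k * (N : ℝ) = r) →
      ∀ C, iter h (D.levelSize N) (D.levelVar N) (n - D.J h l) (D.J h l) (below C)
        (C - (∑ i ∈ Finset.Ico l (D.m h), D.blockMax h i - ε) * N) ≤ 1 / 2 := by
  induction s generalizing l ε with
  | zero =>
    obtain rfl : l = D.m h := by omega
    refine ⟨fun hlt => absurd hlt (lt_irrefl _), Eventually.of_forall fun N _ C => ?_⟩
    rw [D.J_m hh, Nat.sub_self, iter, Finset.Ico_self, Finset.sum_empty, below,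
      indicator_of_notMem]
    · norm_num
    · have : 0 ≤ ε * N := by positivity
      rw [mem_Iio, not_lt]; linarith
  | succ s ih =>
    have hl : l < D.m h := by omega
    have h1 := (ih (l + 1) (by omega) (half_pos hε)).2
    obtain ⟨c, hc, h2⟩ := D.exists_iter_block_le hh hl (half_pos hε)
    have main : ∀ᶠ N : ℕ in atTop, (∀ k ≤ n, ∃ r : ℕ, D.x k * (N : ℝ) = r) →
      ∀ C, iter h (D.levelSize N) (D.levelVar N) (n - D.J h l) (D.J h l) (below C)
        (C - (∑ i ∈ Finset.Ico l (D.m h), D.blockMax h i - ε) * N) ≤ Real.exp (-(c * N)) := by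
      filter_upwards [h1, h2] with N hN1 hN2 hdiv C
      rw [D.iter_block_split hh hl]
      refine le_trans (le_of_eq ?_) (hN2 hdiv _ (measurable_iter (measurable_below C) _ _)
        (iter_mem (below_mem C) _ _) (iter_antitone (measurable_below C) (below_mem C)
          (below_antitone C) _ _) _ (hN1 hdiv C))
      rw [Finset.sum_eq_sum_Ico_succ_bot hl]
      congr 1
      ring
    refine ⟨fun _ => ⟨c, hc, main⟩, ?_⟩
    have hlim : Tendsto (fun N : ℕ => Real.exp (-(c * N))) atTop (𝓝 0) :=
      Real.tendsto_exp_neg_atTop_nhds_zero.comp (tendsto_natCast_atTop_atTop.const_mul_atTop hc)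
    filter_upwards [main, hlim.eventually_le_const (show (0 : ℝ) < 1 / 2 by norm_num)]
      with N hN1 hN2 hdiv C
    exact (hN1 hdiv C).trans hN2

lemma n_pos (D : OrderParameter n) : 0 < n := by
  rcases Nat.eq_zero_or_pos n with rfl | hn
  · have h1 := D.x_last; rw [D.x_zero] at h1; norm_num at h1
  · exact hn

lemma m_pos (hh : 0 ≤ h) : 0 < D.m h := by
  rcases Nat.eq_zero_or_pos (D.m h) with h0 | h0
  · have h1 := D.J_m hh
    rw [h0, J] at h1
    exact absurd h1 D.n_pos.ne
  · exact h0

lemma limitGroundState_eq (h : ℝ) :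
    D.limitGroundState h = ∑ i ∈ Finset.Ico 0 (D.m h), D.blockMax h i := by
  rw [Nat.Ico_zero_eq_range]; rfl

lemma groundState_lt_iff {N : ℕ} (hN : 0 < N) (g : Config N → ℝ) (a : ℝ) :
    groundState h g < a ↔ ∀ σ, Real.sqrt N * energy h g σ < a * N := by
  have hs : 0 < Real.sqrt N := Real.sqrt_pos.2 (Nat.cast_pos.2 hN)
  have hsq : Real.sqrt N * Real.sqrt N = N := Real.mul_self_sqrt (Nat.cast_nonneg _)
  rw [groundState, ← div_eq_inv_mul, div_lt_iff₀ hs, Finset.sup'_lt_iff]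
  simp only [Finset.mem_univ, true_imp_iff]
  refine forall_congr' fun σ => ?_
  have e : a * N = Real.sqrt N * (a * Real.sqrt N) := by linear_combination (-a) * hsq
  rw [e, mul_lt_mul_iff_of_pos_left hs]

lemma measurable_energy {N : ℕ} (σ : Config N) : Measurable fun g : Config N → ℝ => energy h g σ := by
  unfold energy; fun_prop

lemma measurable_groundState {N : ℕ} : Measurable (groundState (N := N) h) := by
  unfold groundState
  refine Measurable.const_mul ?_ _
  have := Finset.measurable_sup' (f := fun σ (g : Config N → ℝ) => energy h g σ)
    Finset.univ_nonempty fun σ _ => measurable_energy σ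
  convert this using 1
  ext g
  rw [Finset.sup'_apply]

variable {D} in
lemma measureReal_groundState_lt {N : ℕ} (hN : 0 < N)
    (hdiv : ∀ k ≤ n, ∃ r : ℕ, D.x k * (N : ℝ) = r) {Ω : Type*} [MeasurableSpace Ω]
    {P : Measure Ω} [IsProbabilityMeasure P] {g : Config N → Ω → ℝ} (hg : D.IsGREM N g P) (a : ℝ) :
    P.real {ω | groundState h (fun σ => g σ ω) < a} =
      iter h (D.levelSize N) (D.levelVar N) n 0 (below (a * N)) 0 := by
  rw [← integral_prod_eq_iter hN hdiv hg h (measurable_below _) fun x => by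
    rw [abs_of_nonneg (below_mem _ _).1]; exact (below_mem _ _).2]
  have hae : AEMeasurable (fun ω σ => g σ ω) P :=
    aemeasurable_pi_lambda _ fun σ => hg.gaussian.aemeasurable σ
  have hnull : NullMeasurableSet {ω | groundState h (fun σ => g σ ω) < a} P :=
    nullMeasurableSet_lt (measurable_groundState.comp_aemeasurable hae) aemeasurable_const
  rw [← setIntegral_one_eq_measureReal, ← integral_indicator₀ hnull]
  congr 1
  ext ω
  by_cases hω : groundState h (fun σ => g σ ω) < a
  · rw [indicator_of_mem (by exact hω)]
    rw [groundState_lt_iff hN] at hω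
    exact (Finset.prod_eq_one fun σ _ => indicator_of_mem (mem_Iio.2 (hω σ)) _).symm
  · rw [indicator_of_notMem (by exact hω)]
    rw [groundState_lt_iff hN] at hω
    push Not at hω
    obtain ⟨σ, hσ⟩ := hω
    refine (Finset.prod_eq_zero (Finset.mem_univ σ) ?_).symm
    exact indicator_of_notMem (by simpa using hσ) _

end OrderParameter

/-! ### Convergence of the ground state -/

namespace OrderParameter

variable {n : ℕ} (D : OrderParameter n) {h : ℝ}

/-- Combines the two tails. The bound depends only on the law for one `N`, so arbitrary dependence
between different `N` is harmless. -/
lemma exists_tail_le (hh : 0 ≤ h) {ε : ℝ} (hε : 0 < ε) :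
    ∃ c > 0, ∀ᶠ N : ℕ in atTop, (∀ k ≤ n, ∃ r : ℕ, D.x k * (N : ℝ) = r) →
      ∀ {Ω : Type*} [MeasurableSpace Ω] (P : Measure Ω) [IsProbabilityMeasure P]
        (g : Config N → Ω → ℝ), D.IsGREM N g P →
        P {ω | ε < |groundState h (fun σ => g σ ω) - D.limitGroundState h|} ≤
          ENNReal.ofReal (2 * Real.exp (-(c * N))) := by
  have hm := D.m_pos hh
  obtain ⟨c, hc, hev⟩ := (D.exists_iter_below_le hh (D.m h) 0 (by omega) hε).1 hm
  have hlam := D.blockTilt_pos hh hm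
  set L := D.limitGroundState h with hL
  refine ⟨min c (D.blockTilt h 0 * ε), lt_min hc (by positivity), ?_⟩
  filter_upwards [hev, eventually_gt_atTop 0] with N hN hN0 hdiv Ω _ P _ g hg
  have hN0' : (0 : ℝ) < N := Nat.cast_pos.2 hN0
  have hae : AEMeasurable (fun ω => groundState h fun σ => g σ ω) P :=
    measurable_groundState.comp_aemeasurable
      (aemeasurable_pi_lambda _ fun σ => hg.gaussian.aemeasurable σ)
  have h1 : P.real {ω | groundState h (fun σ => g σ ω) < L - ε} ≤
      Real.exp (-(min c (D.blockTilt h 0 * ε) * N)) := by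
    rw [measureReal_groundState_lt hN0 hdiv hg]
    have := hN hdiv ((L - ε) * N)
    rw [← limitGroundState_eq, ← hL, sub_self, J, Nat.sub_zero] at this
    refine this.trans (Real.exp_le_exp.2 (neg_le_neg ?_))
    gcongr
    exact min_le_left _ _
  have h2 : P.real {ω | groundState h (fun σ => g σ ω) < L + ε}ᶜ ≤
      Real.exp (-(min c (D.blockTilt h 0 * ε) * N)) := by
    have hnull : NullMeasurableSet {ω | groundState h (fun σ => g σ ω) < L + ε} P :=
      nullMeasurableSet_lt hae aemeasurable_const
    rw [probReal_compl_eq_one_sub₀ hnull, measureReal_groundState_lt hN0 hdiv hg]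
    have := one_sub_iter_below_le hh hdiv ((L + ε) * N) (D.m h) 0 (by omega) hlam
      (fun _ => le_rfl) 0
    rw [← limitGroundState_eq, ← hL, J, Nat.sub_zero] at this
    refine this.trans (Real.exp_le_exp.2 ?_)
    have h3 : min c (D.blockTilt h 0 * ε) * N ≤ D.blockTilt h 0 * ε * N := by
      gcongr
      exact min_le_right _ _
    linarith
  have hsub : {ω | ε < |groundState h (fun σ => g σ ω) - L|} ⊆
      {ω | groundState h (fun σ => g σ ω) < L - ε} ∪
        {ω | groundState h (fun σ => g σ ω) < L + ε}ᶜ := by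
    intro ω hω
    rw [mem_ofPred_eq] at hω
    rcases lt_abs.1 hω with h3 | h3
    · right
      rw [mem_compl_iff, mem_ofPred_eq]
      linarith
    · left
      rw [mem_ofPred_eq]
      linarith
  refine (measure_mono hsub).trans ((measure_union_le _ _).trans ?_)
  rw [← ofReal_measureReal, ← ofReal_measureReal, ← ENNReal.ofReal_add measureReal_nonneg
    measureReal_nonneg]
  exact ENNReal.ofReal_le_ofReal (by linarith)

theorem ae_tendsto_groundState (hh : 0 ≤ h) {N : ℕ → ℕ} (hN : StrictMono N)
    (hdiv : ∀ α, ∀ k ≤ n, ∃ r : ℕ, D.x k * (N α : ℝ) = r)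
    {Ω : Type*} [MeasurableSpace Ω] (P : Measure Ω) [IsProbabilityMeasure P]
    (g : (α : ℕ) → Config (N α) → Ω → ℝ) (hg : ∀ α, D.IsGREM (N α) (g α) P) :
    ∀ᵐ ω ∂P, Tendsto (fun α => groundState h fun σ => g α σ ω) atTop
      (𝓝 (D.limitGroundState h)) := by
  have key (j : ℕ) : ∀ᵐ ω ∂P, ∀ᶠ α in atTop,
      |groundState h (fun σ => g α σ ω) - D.limitGroundState h| ≤ 1 / ((j : ℝ) + 1) := by
    obtain ⟨c, hc, hev⟩ := D.exists_tail_le hh (show (0 : ℝ) < 1 / ((j : ℝ) + 1) by positivity)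
    obtain ⟨i₀, hi₀⟩ := eventually_atTop.1 (hN.tendsto_atTop.eventually hev)
    -- Past `i₀` the tail bound always holds, and strict monotonicity gives `i ≤ N (i + i₀)`, hence
    -- a geometric majorant for Borel–Cantelli.
    have hsum : ∑' i, P {ω | 1 / ((j : ℝ) + 1) <
        |groundState h (fun σ => g (i + i₀) σ ω) - D.limitGroundState h|} ≠ ∞ := by
      refine ne_top_of_le_ne_top ?_ (ENNReal.tsum_le_tsum (g := fun i : ℕ =>
        ENNReal.ofReal (2 * Real.exp (i * (-c)))) fun i => ?_)
      · refine Summable.tsum_ofReal_ne_top ?_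
        exact (Real.summable_exp_nat_mul_iff.2 (by linarith)).mul_left 2
      · refine (hi₀ (i + i₀) (by omega) (hdiv _) P _ (hg _)).trans (ENNReal.ofReal_le_ofReal ?_)
        have h1 : i ≤ N (i + i₀) := le_trans (by omega) (hN.le_apply (x := i + i₀))
        have h2 : (i : ℝ) ≤ N (i + i₀) := Nat.cast_le.2 h1
        have h3 : c * i ≤ c * N (i + i₀) := mul_le_mul_of_nonneg_left h2 hc.le
        have := Real.exp_le_exp.2 (show -(c * N (i + i₀)) ≤ i * (-c) by linarith)
        linarith
    filter_upwards [ae_eventually_notMem hsum] with ω hω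
    obtain ⟨i₁, hi₁⟩ := eventually_atTop.1 hω
    refine eventually_atTop.2 ⟨i₁ + i₀, fun α hα => ?_⟩
    obtain ⟨i, rfl⟩ : ∃ i, α = i + i₀ := ⟨α - i₀, by omega⟩
    exact not_lt.1 (hi₁ i (by omega))
  filter_upwards [ae_all_iff.2 key] with ω hω
  rw [Metric.tendsto_atTop']
  intro ε hε
  obtain ⟨j, hj⟩ := exists_nat_one_div_lt hε
  obtain ⟨i, hi⟩ := eventually_atTop.1 (hω j)
  exact ⟨i, fun α hα => by rw [Real.dist_eq]; exact (hi α hα.le).trans_lt hj⟩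

/-! ### Uniform second moments and convergence in mean -/

lemma toFun_mem (t : ℝ) : D.toFun t ∈ Icc (0 : ℝ) 1 := by
  rw [toFun_eq]
  have hq (k) (hk : k ∈ Finset.range n) : 0 ≤ D.q (k + 1) - D.q k :=
    sub_nonneg.2 (D.q_lt k (Finset.mem_range.1 hk)).le
  constructor
  · exact Finset.sum_nonneg fun k hk => by split_ifs; exacts [hq k hk, le_rfl]
  · have : ∑ k ∈ Finset.range n, (D.q (k + 1) - D.q k) = 1 := by
      rw [Finset.sum_range_sub, D.q_zero, D.q_last, sub_zero]
    rw [← this]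
    exact Finset.sum_le_sum fun k hk => by split_ifs; exacts [le_rfl, hq k hk]

/-- A negative ground state is controlled by the all-plus configuration `1`, whose field term is
nonnegative. A positive one exceeds `K` by an amount controlled by exp(N(M - K)), which is at most
the exponential sum over all configurations. -/
lemma sq_groundState_le (hh : 0 ≤ h) {N : ℕ} (hN : 0 < N) (g : Config N → ℝ) (K L : ℝ) :
    (groundState h g - L) ^ 2 ≤ 2 * L ^ 2 + 4 * K ^ 2 + 2 * g 1 ^ 2 +
      ∑ σ, 8 * Real.exp (Real.sqrt N * g σ + (h * spinSum σ - N * K)) := by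
  have hN1 : (1 : ℝ) ≤ N := by exact_mod_cast hN
  have hs : 0 < Real.sqrt N := Real.sqrt_pos.2 (by linarith)
  have hs1 : 1 ≤ Real.sqrt N := Real.one_le_sqrt.2 hN1
  have hsq : Real.sqrt N * Real.sqrt N = N := Real.mul_self_sqrt (Nat.cast_nonneg _)
  set M := groundState h g with hM
  have hE (σ : Config N) : 0 ≤ 8 * Real.exp (Real.sqrt N * g σ + (h * spinSum σ - N * K)) := by
    positivity
  have hsum := Finset.sum_nonneg fun σ (_ : σ ∈ Finset.univ) => hE σ
  have hML : (M - L) ^ 2 ≤ 2 * M ^ 2 + 2 * L ^ 2 := by nlinarith [sq_nonneg (M + L)]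
  rcases le_total M 0 with h0 | h0
  · have h1 : g 1 / Real.sqrt N ≤ M := by
      have h2 := Finset.le_sup' (fun σ : Config N => energy h g σ) (Finset.mem_univ 1)
      have h3 : g 1 ≤ energy h g 1 := by
        have : (0 : ℝ) ≤ h / Real.sqrt N * ∑ i : Fin N, (((1 : Config N) i : ℤ) : ℝ) := by
          simp; positivity
        rw [energy]; linarith
      rw [hM, groundState, div_eq_inv_mul]
      exact mul_le_mul_of_nonneg_left (h3.trans h2) (inv_nonneg.2 hs.le)
    have h4 : g 1 ≤ M * Real.sqrt N := by rwa [div_le_iff₀ hs] at h1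
    have h5 : M * Real.sqrt N ≤ M := by nlinarith
    have h6 : M ^ 2 ≤ g 1 ^ 2 := by nlinarith
    nlinarith [sq_nonneg K, sq_nonneg (g 1)]
  · obtain ⟨σ, -, hσ⟩ := Finset.exists_mem_eq_sup' (Finset.univ_nonempty)
      (fun σ : Config N => energy h g σ)
    have h1 : N * M = Real.sqrt N * g σ + h * spinSum σ := by
      rw [hM, groundState, hσ, ← mul_assoc]
      have : (N : ℝ) * (Real.sqrt N)⁻¹ = Real.sqrt N := by
        rw [← div_eq_mul_inv, div_eq_iff hs.ne', hsq]
      rw [this, energy, mul_add, ← mul_assoc, mul_div_cancel₀ _ hs.ne']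
      rfl
    have h2 : 8 * Real.exp (N * (M - K)) ≤
        ∑ σ, 8 * Real.exp (Real.sqrt N * g σ + (h * spinSum σ - N * K)) := by
      refine le_trans (le_of_eq ?_) (Finset.single_le_sum (fun σ _ => hE σ) (Finset.mem_univ σ))
      rw [mul_sub, h1]; congr 2; ring
    have h3 : M ^ 2 ≤ 2 * K ^ 2 + 4 * Real.exp (N * (M - K)) := by
      rcases le_total M K with h4 | h4
      · nlinarith [Real.exp_pos (N * (M - K))]
      · have h5 : M - K ≤ N * (M - K) := by nlinarith
        have h6 := Real.quadratic_le_exp_of_nonneg (sub_nonneg.2 h4)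
        have h7 := Real.exp_le_exp.2 h5
        nlinarith [sq_nonneg (M - 2 * K)]
    nlinarith [sq_nonneg (g 1)]

lemma exists_lintegral_sq_le (hh : 0 ≤ h) : ∃ B > 0, ∀ N : ℕ, 0 < N →
    ∀ {Ω : Type*} [MeasurableSpace Ω] (P : Measure Ω) [IsProbabilityMeasure P]
      (g : Config N → Ω → ℝ), D.IsGREM N g P →
      ∫⁻ ω, ENNReal.ofReal ((groundState h (fun σ => g σ ω) - D.limitGroundState h) ^ 2) ∂P ≤
        ENNReal.ofReal B := by
  -- With this `K` the factor e^{-NK} cancels the bound e^{N/2} (2 cosh h)^N for the expected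
  -- exponential sum.
  set K := Real.log (2 * Real.cosh h) + 1 / 2 with hK
  set L := D.limitGroundState h
  refine ⟨2 * L ^ 2 + 4 * K ^ 2 + 2 * 1 + 8, by positivity, fun N hN Ω _ P _ g hg => ?_⟩
  have hN0 : (0 : ℝ) ≤ N := Nat.cast_nonneg _
  have hvar (σ : Config N) : Var[g σ; P] ∈ Icc (0 : ℝ) 1 := by
    rw [← covariance_self (hg.gaussian.aemeasurable σ), hg.covariance]
    exact D.toFun_mem _
  have hmap (σ : Config N) : P.map (g σ) = gaussianReal 0 Var[g σ; P].toNNReal := by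
    rw [(hg.gaussian.hasGaussianLaw_eval σ).map_eq_gaussianReal, hg.centred]
  have hint (σ : Config N) : Integrable (fun ω => Real.exp (Real.sqrt N * g σ ω)) P := by
    have h1 := integrable_exp_mul_gaussianReal (μ := 0) (v := Var[g σ; P].toNNReal) (Real.sqrt N)
    rw [← hmap σ] at h1
    exact h1.comp_aemeasurable (hg.gaussian.aemeasurable σ)
  have hexp (σ : Config N) : ∫ ω, Real.exp (Real.sqrt N * g σ ω) ∂P ≤ Real.exp (N / 2) := by
    have h1 := mgf_gaussianReal (hmap σ) (Real.sqrt N)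
    rw [mgf] at h1
    rw [h1, Real.exp_le_exp, Real.sq_sqrt hN0, Real.coe_toNNReal _ (hvar σ).1]
    nlinarith [(hvar σ).2]
  have hint2 : Integrable (fun ω => 2 * L ^ 2 + 4 * K ^ 2 + 2 * g 1 ω ^ 2) P :=
    (integrable_const _).add
      (((hg.gaussian.hasGaussianLaw_eval 1).memLp_two.integrable_sq).const_mul 2)
  have hint3 (σ : Config N) : Integrable (fun ω =>
      8 * Real.exp (Real.sqrt N * g σ ω + (h * spinSum σ - N * K))) P := by
    simp_rw [Real.exp_add]
    exact ((hint σ).mul_const _).const_mul 8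
  have hint4 : Integrable (fun ω => 2 * L ^ 2 + 4 * K ^ 2 + 2 * g 1 ω ^ 2 +
      ∑ σ, 8 * Real.exp (Real.sqrt N * g σ ω + (h * spinSum σ - N * K))) P :=
    hint2.add (integrable_finsetSum _ fun σ _ => hint3 σ)
  refine (lintegral_mono fun ω => ENNReal.ofReal_le_ofReal
    (sq_groundState_le hh hN (fun σ => g σ ω) K L)).trans ?_
  rw [← ofReal_integral_eq_lintegral_ofReal hint4 (ae_of_all _ fun ω => by positivity)]
  refine ENNReal.ofReal_le_ofReal ?_
  rw [integral_add hint2 (integrable_finsetSum _ fun σ _ => hint3 σ),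
    integral_finsetSum _ fun σ _ => hint3 σ, integral_add (integrable_const _)
      (((hg.gaussian.hasGaussianLaw_eval 1).memLp_two.integrable_sq).const_mul 2),
    integral_const_mul]
  have h1 : ∫ ω, g 1 ω ^ 2 ∂P ≤ 1 := by
    rw [← variance_of_integral_eq_zero (hg.gaussian.aemeasurable 1) (hg.centred 1)]
    exact (hvar 1).2
  have h2 : ∑ σ, ∫ ω, 8 * Real.exp (Real.sqrt N * g σ ω + (h * spinSum σ - N * K)) ∂P ≤ 8 := by
    calc ∑ σ, ∫ ω, 8 * Real.exp (Real.sqrt N * g σ ω + (h * spinSum σ - N * K)) ∂P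
        ≤ ∑ σ : Config N, 8 * (Real.exp (N / 2) * Real.exp (h * spinSum σ - N * K)) := by
          refine Finset.sum_le_sum fun σ _ => ?_
          simp_rw [Real.exp_add, integral_const_mul, integral_mul_const]
          have := hexp σ
          gcongr
      _ = 8 * (Real.exp (N / 2) * Real.exp (-(N * K)) * (2 * Real.cosh h) ^ N) := by
          rw [← sum_exp_mul_spinSum, Finset.mul_sum, Finset.mul_sum]
          refine Finset.sum_congr rfl fun σ _ => ?_
          rw [sub_eq_add_neg, Real.exp_add]; ring
      _ = 8 := by
          rw [two_cosh_pow, ← Real.exp_add, ← Real.exp_add, hK]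
          rw [show (N : ℝ) / 2 + -(N * (Real.log (2 * Real.cosh h) + 1 / 2)) +
            N * Real.log (2 * Real.cosh h) = 0 by ring, Real.exp_zero, mul_one]
  simp only [integral_const, probReal_univ, smul_eq_mul, one_mul]
  linarith

theorem tendsto_eLpNorm_groundState (hh : 0 ≤ h) {N : ℕ → ℕ} (hN : StrictMono N)
    (hdiv : ∀ α, ∀ k ≤ n, ∃ r : ℕ, D.x k * (N α : ℝ) = r)
    {Ω : Type*} [MeasurableSpace Ω] (P : Measure Ω) [IsProbabilityMeasure P]
    (g : (α : ℕ) → Config (N α) → Ω → ℝ) (hg : ∀ α, D.IsGREM (N α) (g α) P) :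
    Tendsto (fun α => eLpNorm (fun ω => groundState h (fun σ => g α σ ω) -
      D.limitGroundState h) 1 P) atTop (𝓝 0) := by
  obtain ⟨B, hB, hBle⟩ := D.exists_lintegral_sq_le hh
  rw [ENNReal.tendsto_nhds_zero]
  intro e he
  obtain ⟨ε, hε0, hε⟩ : ∃ ε : ℝ, 0 < ε ∧ ENNReal.ofReal ε ≤ e := by
    rcases eq_or_ne e ∞ with rfl | hne
    · exact ⟨1, one_pos, le_top⟩
    · exact ⟨e.toReal, ENNReal.toReal_pos he.ne' hne, ENNReal.ofReal_toReal_le⟩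
  -- On |X| > ε/3 use |X| ≤ δX² + 1/(4δ). The three resulting contributions are at most ε/3 each:
  -- the small values, the second moment, and the exponentially small tail.
  set δ := ε / (3 * B) with hδ
  have hδ0 : 0 < δ := by positivity
  obtain ⟨c, hc, hev⟩ := D.exists_tail_le hh (show 0 < ε / 3 by positivity)
  have hlim : Tendsto (fun N : ℕ => (4 * δ)⁻¹ * (2 * Real.exp (-(c * N)))) atTop (𝓝 0) := by
    have := ((Real.tendsto_exp_neg_atTop_nhds_zero.comp
      (tendsto_natCast_atTop_atTop.const_mul_atTop hc)).const_mul 2).const_mul (4 * δ)⁻¹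
    simpa using this
  filter_upwards [hN.tendsto_atTop.eventually hev, hN.tendsto_atTop.eventually
    (hlim.eventually_le_const (show 0 < ε / 3 by positivity)),
    hN.tendsto_atTop.eventually (eventually_gt_atTop 0)] with α h1 h2 h3
  have h4 := h1 (hdiv α) P (g α) (hg α)
  have h5 := hBle (N α) h3 P (g α) (hg α)
  set X : Ω → ℝ := fun ω => groundState h (fun σ => g α σ ω) - D.limitGroundState h with hX
  have hae : AEMeasurable X P :=
    (measurable_groundState.comp_aemeasurable
      (aemeasurable_pi_lambda _ fun σ => (hg α).gaussian.aemeasurable σ)).sub_const _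
  have hnull : NullMeasurableSet {ω | ε / 3 < |X ω|} P :=
    nullMeasurableSet_lt aemeasurable_const hae.abs
  rw [eLpNorm_one_eq_lintegral_enorm]
  refine le_trans ?_ hε
  calc ∫⁻ ω, ‖X ω‖ₑ ∂P
      ≤ ∫⁻ ω, (ENNReal.ofReal (ε / 3) + ENNReal.ofReal δ * ENNReal.ofReal (X ω ^ 2) +
          {ω | ε / 3 < |X ω|}.indicator (fun _ => ENNReal.ofReal (4 * δ)⁻¹) ω) ∂P := by
        refine lintegral_mono fun ω => ?_
        rw [Real.enorm_eq_ofReal_abs, ← ENNReal.ofReal_mul hδ0.le]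
        by_cases hω : ε / 3 < |X ω|
        · rw [indicator_of_mem (by exact hω), ← ENNReal.ofReal_add (by positivity) (by positivity),
            ← ENNReal.ofReal_add (by positivity) (by positivity)]
          refine ENNReal.ofReal_le_ofReal ?_
          have h6 : |X ω| ≤ δ * X ω ^ 2 + (4 * δ)⁻¹ := by
            rw [← sq_abs (X ω)]
            have h7 : δ * |X ω| ^ 2 + (4 * δ)⁻¹ - |X ω| = (2 * δ * |X ω| - 1) ^ 2 * (4 * δ)⁻¹ := by
              field_simp; ring
            have h8 : 0 ≤ (2 * δ * |X ω| - 1) ^ 2 * (4 * δ)⁻¹ := by positivity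
            linarith
          linarith
        · rw [indicator_of_notMem (by exact hω), add_zero]
          exact (ENNReal.ofReal_le_ofReal (not_lt.1 hω)).trans le_self_add
    _ = ENNReal.ofReal (ε / 3) + ENNReal.ofReal δ * ∫⁻ ω, ENNReal.ofReal (X ω ^ 2) ∂P +
          ENNReal.ofReal (4 * δ)⁻¹ * P {ω | ε / 3 < |X ω|} := by
        rw [lintegral_add_left' (by fun_prop), lintegral_add_left' (by fun_prop),
          lintegral_const_mul'' _ (by fun_prop), lintegral_indicator₀ hnull]
        simp
    _ ≤ ENNReal.ofReal (ε / 3) + ENNReal.ofReal δ * ENNReal.ofReal B +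
          ENNReal.ofReal (4 * δ)⁻¹ * ENNReal.ofReal (2 * Real.exp (-(c * N α))) := by
        gcongr
    _ ≤ ENNReal.ofReal ε := by
        rw [← ENNReal.ofReal_mul hδ0.le, ← ENNReal.ofReal_mul (by positivity),
          ← ENNReal.ofReal_add (by positivity) (by positivity),
          ← ENNReal.ofReal_add (by positivity) (by positivity)]
        refine ENNReal.ofReal_le_ofReal ?_
        have : δ * B = ε / 3 := by rw [hδ]; field_simp
        linarith

end OrderParameter

/-! ### The central limit theorem for tilted spins -/

instance : MeasurableSingletonClass ℤˣ :=
  ⟨fun s => ⟨{(s : ℤ)}, measurableSet_singleton _, by ext; simp [Units.ext_iff]⟩⟩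

/-- The law of a spin under the tilt `x`. -/
def spinLaw (x : ℝ) : Measure ℤˣ :=
  ∑ s : ℤˣ, ENNReal.ofReal (Real.exp (x * ((s : ℤ) : ℝ)) / (2 * Real.cosh x)) • Measure.dirac s

lemma univ_units_int : (Finset.univ : Finset ℤˣ) = {1, -1} := rfl

lemma sum_units {M : Type*} [AddCommMonoid M] (f : ℤˣ → M) : ∑ s, f s = f 1 + f (-1) := by
  rw [univ_units_int, Finset.sum_pair (by decide)]

lemma integral_spinLaw {E : Type*} [NormedAddCommGroup E] [NormedSpace ℝ E] [CompleteSpace E]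
    (x : ℝ) (f : ℤˣ → E) : ∫ s, f s ∂spinLaw x =
      ∑ s : ℤˣ, (Real.exp (x * ((s : ℤ) : ℝ)) / (2 * Real.cosh x)) • f s := by
  unfold spinLaw
  have hpos (s : ℤˣ) : 0 ≤ Real.exp (x * ((s : ℤ) : ℝ)) / (2 * Real.cosh x) := by positivity
  rw [integral_finsetSum_measure fun s _ => (integrable_dirac (by simp)).smul_measure
    ENNReal.ofReal_ne_top]
  refine Finset.sum_congr rfl fun s _ => ?_
  rw [integral_smul_measure, integral_dirac, ENNReal.toReal_ofReal (hpos s)]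

instance (x : ℝ) : IsProbabilityMeasure (spinLaw x) := by
  constructor
  have hpos (s : ℤˣ) : 0 ≤ Real.exp (x * ((s : ℤ) : ℝ)) / (2 * Real.cosh x) := by positivity
  simp only [spinLaw, Measure.finsetSum_apply, Measure.smul_apply, Measure.dirac_apply_of_mem
    (mem_univ _), smul_eq_mul, mul_one]
  rw [← ENNReal.ofReal_sum_of_nonneg fun s _ => hpos s, sum_units, ← add_div, Real.cosh_eq]
  simp only [Units.val_one, Int.cast_one, mul_one, Units.val_neg, Int.cast_neg, mul_neg]
  rw [mul_div_cancel₀ _ (two_ne_zero), div_self (by positivity), ENNReal.ofReal_one]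

/-- The expectation of `exp (-(a - s (S - d tanh x) / √d)² / 2)` for `d` independent spins with
tilt `x` and sum `S`. -/
def tiltMean (x s a : ℝ) (d : ℕ) : ℝ :=
  ((2 * Real.cosh x) ^ d)⁻¹ * ∑ σ : Config d, Real.exp (x * spinSum σ) *
    Real.exp (-(a - s * ((spinSum σ - d * Real.tanh x) / Real.sqrt d)) ^ 2 / 2)

lemma tiltMean_nonneg (x s a : ℝ) (d : ℕ) : 0 ≤ tiltMean x s a d := by
  unfold tiltMean; positivity

lemma tiltMean_le_one (x s a : ℝ) (d : ℕ) : tiltMean x s a d ≤ 1 := by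
  have hc : 0 < (2 * Real.cosh x) ^ d := by positivity
  rw [tiltMean, inv_mul_le_iff₀ hc, mul_one, ← sum_exp_mul_spinSum]
  refine Finset.sum_le_sum fun σ _ => mul_le_of_le_one_right (Real.exp_pos _).le ?_
  rw [Real.exp_le_one_iff]
  have := sq_nonneg (a - s * ((spinSum σ - d * Real.tanh x) / Real.sqrt d))
  linarith

open Complex in
lemma exp_neg_sq_eq_integral (u : ℝ) :
    ((Real.exp (-u ^ 2 / 2) : ℝ) : ℂ) = ∫ z, cexp (u * z * I) ∂gaussianReal 0 1 := by
  rw [← charFun_apply_real, charFun_gaussianReal]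
  push_cast
  congr 1
  ring

open Complex in
-- Writing the Gaussian function as a Fourier integral makes the mean factor over the spins, leaving
-- a power of one characteristic function.
lemma tiltMean_eq_integral (x s a : ℝ) (d : ℕ) :
    ((tiltMean x s a d : ℝ) : ℂ) = ∫ z, cexp (a * z * I) *
      (∑ e : ℤˣ, ((Real.exp (x * ((e : ℤ) : ℝ)) / (2 * Real.cosh x) : ℝ) : ℂ) *
        cexp ((-(s * z) / Real.sqrt d * (((e : ℤ) : ℝ) - Real.tanh x) : ℝ) * I)) ^ d
      ∂gaussianReal 0 1 := by
  have h1 (z : ℝ) : cexp (a * z * I) *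
      (∑ e : ℤˣ, ((Real.exp (x * ((e : ℤ) : ℝ)) / (2 * Real.cosh x) : ℝ) : ℂ) *
        cexp ((-(s * z) / Real.sqrt d * (((e : ℤ) : ℝ) - Real.tanh x) : ℝ) * I)) ^ d =
      ∑ σ : Config d, ((((2 * Real.cosh x) ^ d)⁻¹ * Real.exp (x * spinSum σ) : ℝ) : ℂ) *
        cexp (((a - s * ((spinSum σ - d * Real.tanh x) / Real.sqrt d) : ℝ) : ℂ) * z * I) := by
    rw [Fintype.sum_pow, Finset.mul_sum]
    refine Finset.sum_congr rfl fun σ _ => ?_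
    rw [Finset.prod_mul_distrib, ← Complex.exp_sum, ← ofReal_prod, Finset.prod_div_distrib,
      ← Real.exp_sum, Finset.prod_const, Finset.card_univ, Fintype.card_fin, ← Finset.mul_sum,
      mul_left_comm, ← Complex.exp_add, ← Finset.sum_mul, ← ofReal_sum, ← Finset.mul_sum,
      Finset.sum_sub_distrib, Finset.sum_const, Finset.card_univ, Fintype.card_fin, nsmul_eq_mul,
      div_eq_inv_mul]
    congr 2
    change _ + ((-(s * z) / Real.sqrt d * (spinSum σ - d * Real.tanh x) : ℝ) : ℂ) * I = _
    push_cast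
    ring
  simp_rw [h1]
  have hint (σ : Config d) : Integrable (fun z : ℝ =>
      ((((2 * Real.cosh x) ^ d)⁻¹ * Real.exp (x * spinSum σ) : ℝ) : ℂ) *
        cexp (((a - s * ((spinSum σ - d * Real.tanh x) / Real.sqrt d) : ℝ) : ℂ) * z * I))
      (gaussianReal 0 1) := by
    refine Integrable.const_mul (Integrable.of_bound (by fun_prop) 1 (ae_of_all _ fun z => ?_)) _
    rw [← ofReal_mul, norm_exp_ofReal_mul_I]
  rw [integral_finsetSum _ fun σ _ => hint σ, tiltMean, Finset.mul_sum, ofReal_sum]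
  refine Finset.sum_congr rfl fun σ _ => ?_
  rw [integral_const_mul, ← exp_neg_sq_eq_integral, ← ofReal_mul]
  congr 1
  ring

lemma integral_exp_neg_mul_sq_gaussianReal {b : ℝ} (hb : 0 ≤ b) :
    ∫ z, Real.exp (-(b * z ^ 2) / 2) ∂gaussianReal 0 1 = (Real.sqrt (1 + b))⁻¹ := by
  rw [integral_gaussianReal_eq_integral_smul one_ne_zero]
  have h1 (z : ℝ) : gaussianPDFReal 0 1 z • Real.exp (-(b * z ^ 2) / 2) =
      (Real.sqrt (2 * Real.pi))⁻¹ * Real.exp (-((1 + b) / 2) * z ^ 2) := by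
    rw [gaussianPDFReal, smul_eq_mul, mul_assoc, ← Real.exp_add]
    simp only [NNReal.coe_one, mul_one, sub_zero]
    congr 2
    ring
  simp_rw [h1]
  rw [integral_const_mul, integral_gaussian, ← Real.sqrt_inv, ← Real.sqrt_mul (by positivity),
    ← Real.sqrt_inv]
  congr 1
  have := Real.pi_pos
  field_simp

open Complex in
/-- The central limit theorem for tilted spins, integrated against a Gaussian function. -/
lemma tendsto_tiltMean (x s : ℝ) {a : ℕ → ℝ} (ha : Tendsto a atTop (𝓝 0)) :
    Tendsto (fun d => tiltMean x s (a d) d) atTop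
      (𝓝 (Real.sqrt (1 + s ^ 2 * (1 - Real.tanh x ^ 2)))⁻¹) := by
  set t := Real.tanh x with ht
  have hσ2 : 0 < 1 - t ^ 2 := by linarith [tanh_sq_lt x]
  set r := Real.sqrt (1 - t ^ 2) with hr
  have hr0 : 0 < r := Real.sqrt_pos.2 hσ2
  have hrsq : r ^ 2 = 1 - t ^ 2 := Real.sq_sqrt hσ2.le
  have hc := Real.cosh_pos x
  set Y : ℤˣ → ℝ := fun e => (((e : ℤ) : ℝ) - t) / r with hY
  have hp : Real.exp x / (2 * Real.cosh x) = (1 + t) / 2 := by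
    rw [ht, one_add_tanh]; field_simp
  have hm : Real.exp (-x) / (2 * Real.cosh x) = (1 - t) / 2 := by
    rw [ht, one_sub_tanh]; field_simp
  have h0 : ∫ e, Y e ∂spinLaw x = 0 := by
    rw [integral_spinLaw, sum_units]
    simp only [Units.val_one, Int.cast_one, mul_one, Units.val_neg, Int.cast_neg, mul_neg, hY,
      smul_eq_mul, hp, hm]
    ring
  have h1 : ∫ e, (Y ^ 2) e ∂spinLaw x = 1 := by
    rw [integral_spinLaw, sum_units]
    simp only [Units.val_one, Int.cast_one, mul_one, Units.val_neg, Int.cast_neg, mul_neg, hY,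
      smul_eq_mul, hp, hm, Pi.pow_apply, div_pow, hrsq]
    field_simp
    ring
  have hlim (z : ℝ) : Tendsto (fun d : ℕ => (∑ e : ℤˣ,
      ((Real.exp (x * ((e : ℤ) : ℝ)) / (2 * Real.cosh x) : ℝ) : ℂ) *
        cexp ((-(s * z) / Real.sqrt d * (((e : ℤ) : ℝ) - t) : ℝ) * I)) ^ d) atTop
      (𝓝 (cexp (-((s ^ 2 * (1 - t ^ 2) * z ^ 2 : ℝ) : ℂ) / 2))) := by
    -- `Y` is the standardised spin; its standard deviation `r` is moved into the argument -(rsz).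
    have h2 := tendsto_charFun_inv_sqrt_mul_pow (P := spinLaw x) (X := Y)
      (measurable_of_countable Y).aemeasurable h0 h1 (-(r * s * z))
    have e1 : cexp (-(((-(r * s * z) : ℝ)) : ℂ) ^ 2 / 2) =
        cexp (-((s ^ 2 * (1 - t ^ 2) * z ^ 2 : ℝ) : ℂ) / 2) := by
      rw [← hrsq]; push_cast; congr 1; ring
    rw [e1] at h2
    refine h2.congr fun d => ?_
    congr 1
    rw [charFun_apply_real, integral_map (measurable_of_countable Y).aemeasurable
      (by fun_prop), integral_spinLaw]
    refine Finset.sum_congr rfl fun e _ => ?_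
    rw [real_smul, ← ofReal_mul]
    congr 3
    rw [hY]
    field_simp
  have hmain : Tendsto (fun d => ((tiltMean x s (a d) d : ℝ) : ℂ)) atTop
      (𝓝 (∫ z, cexp (-((s ^ 2 * (1 - t ^ 2) * z ^ 2 : ℝ) : ℂ) / 2) ∂gaussianReal 0 1)) := by
    simp_rw [tiltMean_eq_integral]
    refine tendsto_integral_of_dominated_convergence (fun _ => 1) (fun d => ?_)
      (integrable_const _) (fun d => ae_of_all _ fun z => ?_) (ae_of_all _ fun z => ?_)
    · refine Measurable.aestronglyMeasurable ?_
      refine Measurable.mul (by fun_prop) (Measurable.pow_const ?_ _)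
      exact Finset.measurable_sum _ fun e _ => by fun_prop
    · rw [norm_mul, norm_pow, ← ofReal_mul, norm_exp_ofReal_mul_I, one_mul]
      refine pow_le_one₀ (norm_nonneg _) ((norm_sum_le _ _).trans ?_)
      have hone : ∑ e : ℤˣ, Real.exp (x * ((e : ℤ) : ℝ)) / (2 * Real.cosh x) = 1 := by
        rw [sum_units]
        simp only [Units.val_one, Int.cast_one, mul_one, Units.val_neg, Int.cast_neg, mul_neg,
          hp, hm]
        ring
      rw [← hone]
      refine Finset.sum_le_sum fun e _ => ?_
      rw [norm_mul, norm_exp_ofReal_mul_I, mul_one, norm_real, Real.norm_of_nonneg (by positivity)]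
    · have h2 : Tendsto (fun d => cexp ((a d : ℂ) * z * I)) atTop (𝓝 1) := by
        have h3 : Continuous fun u : ℝ => cexp ((u : ℂ) * z * I) := by fun_prop
        have h4 := (h3.tendsto 0).comp ha
        simp only [ofReal_zero, zero_mul, Complex.exp_zero] at h4
        exact h4
      have h5 := h2.mul (hlim z)
      rw [one_mul] at h5
      exact h5
  have hval : ∫ z, cexp (-((s ^ 2 * (1 - t ^ 2) * z ^ 2 : ℝ) : ℂ) / 2) ∂gaussianReal 0 1 =
      (((Real.sqrt (1 + s ^ 2 * (1 - t ^ 2)))⁻¹ : ℝ) : ℂ) := by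
    rw [← integral_exp_neg_mul_sq_gaussianReal (by positivity), ← integral_complex_ofReal]
    congr 1
    ext z
    push_cast
    rfl
  rw [hval] at hmain
  exact (continuous_re.tendsto _).comp hmain

/-! ### The density of the rescaled intensity measure -/

/-- The factor `1 + h² (1 - t_*²) / θ` in the normalisation of the energies. -/
def centreVar (h θ : ℝ) : ℝ := 1 + h ^ 2 / θ * (1 - Real.tanh (tilt h θ * h) ^ 2)

/-- The centring of the energies of `d` spins with slope `θ`, for energies multiplied by `√N`. -/
def centre (h θ : ℝ) (d : ℕ) : ℝ :=
  Real.sqrt (θ * d) * centreB d (h / Real.sqrt θ)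

/-- The correction of the density `e^{-x}` of the rescaled intensity measure. -/
def densityCorr (h θ : ℝ) (d : ℕ) (x : ℝ) : ℝ :=
  Real.sqrt (centreVar h θ) * tiltMean (tilt h θ * h) (h / Real.sqrt θ)
    ((centre h θ d + (tilt h θ)⁻¹ * x - (tilt h θ * θ + h * Real.tanh (tilt h θ * h)) * d) /
      Real.sqrt (θ * d)) d

section

variable {h θ : ℝ}

lemma centreVar_pos (hθ : 0 < θ) : 0 < centreVar h θ := by
  have : 0 < 1 - Real.tanh (tilt h θ * h) ^ 2 := by linarith [tanh_sq_lt (tilt h θ * h)]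
  unfold centreVar; positivity

/-- The linear part of the centring balances the exponential moment, and its logarithmic part is the
Gaussian prefactor together with the Jacobian factor λ of the rescaling. -/
lemma tilt_mul_centre (hh : 0 ≤ h) (hθ : 0 < θ) {d : ℕ} (hd : 0 < d) :
    tilt h θ * centre h θ d = logMoment h (tilt h θ) d (θ * d) -
      Real.log (Real.sqrt (2 * Real.pi * centreVar h θ) * (tilt h θ * Real.sqrt (θ * d))) := by
  obtain ⟨hl, h1, h2, h3, h4⟩ := tilt_spec hh hθ
  set l := tilt h θ with hldef
  set t := Real.tanh (l * h) with ht
  have hd0 : (0 : ℝ) < d := Nat.cast_pos.2 hd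
  have hs := Real.sqrt_pos.2 hθ
  have hsd := Real.sqrt_pos.2 hd0
  have ht2 : 0 < 1 - t ^ 2 := by linarith [tanh_sq_lt (l * h)]
  have hV := centreVar_pos (h := h) hθ
  have hA : scaleA d (h / Real.sqrt θ) = (l * Real.sqrt (θ * d))⁻¹ := by
    rw [scaleA, h2, Real.sqrt_mul hθ.le, mul_assoc]
  have hvar : 2 * Real.pi * (1 - tStar (h / Real.sqrt θ) ^ 2) *
      (iteratedDeriv 2 cramerI (tStar (h / Real.sqrt θ)) + (h / Real.sqrt θ) ^ 2) =
      2 * Real.pi * centreVar h θ := by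
    rw [h1, iteratedDeriv_two_cramerI (abs_tanh_lt_one _), div_pow, Real.sq_sqrt hθ.le, centreVar,
      ← hldef, ← ht]
    field_simp
  have hsq : Real.sqrt (θ * d) * Real.sqrt d = Real.sqrt θ * d := by
    rw [Real.sqrt_mul hθ.le, mul_assoc, Real.mul_self_sqrt hd0.le]
  have hq : 0 < l * Real.sqrt (θ * d) := by positivity
  have hlog : Real.log ((l * Real.sqrt (θ * d))⁻¹ ^ 2 / (2 * Real.pi * centreVar h θ)) =
      -2 * Real.log (Real.sqrt (2 * Real.pi * centreVar h θ) * (l * Real.sqrt (θ * d))) := by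
    rw [← Real.log_rpow (by positivity), Real.rpow_neg (by positivity),
      show (2 : ℝ) = ((2 : ℕ) : ℝ) by norm_num, Real.rpow_natCast, mul_pow, Real.sq_sqrt
        (by positivity)]
    congr 1
    rw [inv_pow, mul_inv]
    field_simp
  rw [centre, centreB, hvar, hA, hlog, mul_add, mul_add]
  have e1 : l * (Real.sqrt (θ * d) * (maxValue (h / Real.sqrt θ) * Real.sqrt d)) =
      logMoment h l d (θ * d) := by
    have : l * (Real.sqrt (θ * d) * (maxValue (h / Real.sqrt θ) * Real.sqrt d)) =
        l * (Real.sqrt θ * maxValue (h / Real.sqrt θ)) * d := by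
      rw [mul_comm (maxValue _), ← mul_assoc (Real.sqrt _), hsq]; ring
    rw [this, h4, logMoment]
    rw [tiltEntropy] at h3
    linear_combination (-(d : ℝ) / 2) * h3
  rw [e1]
  have hq' : l * Real.sqrt (θ * d) * ((l * Real.sqrt (θ * d))⁻¹ / 2) = 1 / 2 := by
    field_simp
  linear_combination (-2 * Real.log (Real.sqrt (2 * Real.pi * centreVar h θ) *
    (l * Real.sqrt (θ * d)))) * hq'

lemma exp_neg_tilt_mul_centre (hh : 0 ≤ h) (hθ : 0 < θ) {d : ℕ} (hd : 0 < d) :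
    Real.exp (-(tilt h θ * centre h θ d)) = Real.exp (-logMoment h (tilt h θ) d (θ * d)) *
      (Real.sqrt (2 * Real.pi * centreVar h θ) * (tilt h θ * Real.sqrt (θ * d))) := by
  have hl := tilt_pos hh hθ
  have hV := centreVar_pos (h := h) hθ
  have hd0 : (0 : ℝ) < d := Nat.cast_pos.2 hd
  have hpos : 0 < Real.sqrt (2 * Real.pi * centreVar h θ) * (tilt h θ * Real.sqrt (θ * d)) := by
    have := Real.pi_pos
    positivity
  rw [tilt_mul_centre hh hθ hd, neg_sub, sub_eq_neg_add, Real.exp_add, Real.exp_log hpos]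

lemma densityCorr_nonneg (h θ : ℝ) (d : ℕ) (x : ℝ) : 0 ≤ densityCorr h θ d x :=
  mul_nonneg (Real.sqrt_nonneg _) (tiltMean_nonneg _ _ _ _)

lemma densityCorr_le (h θ : ℝ) (d : ℕ) (x : ℝ) : densityCorr h θ d x ≤ Real.sqrt (centreVar h θ) :=
  mul_le_of_le_one_right (Real.sqrt_nonneg _) (tiltMean_le_one _ _ _ _)

lemma continuous_densityCorr (h θ : ℝ) (d : ℕ) : Continuous (densityCorr h θ d) := by
  unfold densityCorr tiltMean
  fun_prop

/-- The centring differs from its linear part by a term of order log d, which disappears on the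
scale √d. Thus `tendsto_tiltMean` applies with a → 0, and its limit cancels against √`centreVar`. -/
lemma tendsto_densityCorr (hh : 0 ≤ h) (hθ : 0 < θ) (x : ℝ) :
    Tendsto (fun d => densityCorr h θ d x) atTop (𝓝 1) := by
  obtain ⟨hl, h1, h2, h3, h4⟩ := tilt_spec hh hθ
  have hV := centreVar_pos (h := h) hθ
  have hpi := Real.pi_pos
  set K := Real.sqrt (2 * Real.pi * centreVar h θ) * (tilt h θ * Real.sqrt θ) with hK
  have hK0 : 0 < K := by positivity
  have ha : Tendsto (fun d : ℕ => (centre h θ d + (tilt h θ)⁻¹ * x -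
      (tilt h θ * θ + h * Real.tanh (tilt h θ * h)) * d) / Real.sqrt (θ * d)) atTop (𝓝 0) := by
    have e1 : ∀ᶠ d : ℕ in atTop, (x - Real.log K - Real.log d / 2) * (tilt h θ)⁻¹ /
        (Real.sqrt θ * Real.sqrt d) = (centre h θ d + (tilt h θ)⁻¹ * x -
        (tilt h θ * θ + h * Real.tanh (tilt h θ * h)) * d) / Real.sqrt (θ * d) := by
      filter_upwards [eventually_gt_atTop 0] with d hd
      have hd0 : (0 : ℝ) < d := Nat.cast_pos.2 hd
      have hsd := Real.sqrt_pos.2 hd0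
      rw [Real.sqrt_mul hθ.le]
      congr 1
      have e2 := tilt_mul_centre hh hθ hd
      have e3 : Real.log (Real.sqrt (2 * Real.pi * centreVar h θ) *
          (tilt h θ * Real.sqrt (θ * d))) = Real.log K + Real.log d / 2 := by
        rw [← Real.log_sqrt hd0.le, ← Real.log_mul hK0.ne' hsd.ne', Real.sqrt_mul hθ.le, hK]
        congr 1; ring
      have e4 : logMoment h (tilt h θ) d (θ * d) =
          tilt h θ * ((tilt h θ * θ + h * Real.tanh (tilt h θ * h)) * d) := by
        rw [logMoment]
        rw [tiltEntropy] at h3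
        linear_combination ((d : ℝ) / 2) * h3
      rw [e3, e4] at e2
      have e5 : centre h θ d = (tilt h θ * ((tilt h θ * θ + h * Real.tanh (tilt h θ * h)) * d) -
          (Real.log K + Real.log d / 2)) / tilt h θ := by
        rw [← e2, mul_div_cancel_left₀ _ hl.ne']
      rw [e5]
      field_simp
      ring
    refine Tendsto.congr' e1 ?_
    have hsq : Tendsto (fun d : ℕ => Real.sqrt d) atTop atTop :=
      Real.tendsto_sqrt_atTop.comp tendsto_natCast_atTop_atTop
    have hinv : Tendsto (fun d : ℕ => (Real.sqrt d)⁻¹) atTop (𝓝 0) := tendsto_inv_atTop_zero.comp hsq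
    have hlog : Tendsto (fun d : ℕ => Real.log d / Real.sqrt d) atTop (𝓝 0) := by
      have := (isLittleO_log_rpow_atTop (show (0 : ℝ) < 1 / 2 by norm_num)).tendsto_div_nhds_zero
      refine (this.comp tendsto_natCast_atTop_atTop).congr fun d => ?_
      simp only [Function.comp, Real.sqrt_eq_rpow]
    have := ((hinv.const_mul ((x - Real.log K) * (tilt h θ)⁻¹ * (Real.sqrt θ)⁻¹)).sub
      (hlog.const_mul ((tilt h θ)⁻¹ * (Real.sqrt θ)⁻¹ / 2)))
    simp only [mul_zero, sub_zero] at this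
    refine this.congr fun d => ?_
    rw [div_eq_mul_inv _ (Real.sqrt θ * _), mul_inv]
    ring
  have := (tendsto_tiltMean (tilt h θ * h) (h / Real.sqrt θ) ha).const_mul
    (Real.sqrt (centreVar h θ))
  rw [div_pow, Real.sq_sqrt hθ.le, ← centreVar, mul_inv_cancel₀ (Real.sqrt_pos.2 hV).ne'] at this
  exact this

/-- Substitute w = centre + x/λ and complete the square in each Gaussian density: the sum over the
configurations becomes an expectation over tilted spins. The identity is exact for every `d`. -/
lemma integral_intensity_eq (hh : 0 ≤ h) (hθ : 0 < θ) {d : ℕ} (hd : 0 < d) {v : ℝ≥0}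
    (hv : (v : ℝ) = θ * d) {f : ℝ → ℝ} (hf : Measurable f) (hb : ∀ x, f x ∈ Icc (0 : ℝ) 1) :
    ∫ w, f (w - centre h θ d) ∂intensity h d v =
      ∫ x, f ((tilt h θ)⁻¹ * x) * (Real.exp (-x) * densityCorr h θ d x) := by
  have hl := tilt_pos hh hθ
  have hd0 : (0 : ℝ) < d := Nat.cast_pos.2 hd
  have hv0 : (0 : ℝ) < v := by rw [hv]; positivity
  have hvne : v ≠ 0 := fun h0 => by rw [h0] at hv0; simp at hv0
  set c := centre h θ d with hc
  set l := tilt h θ with hldef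
  rw [integral_intensity fun m => integrable_of_mem_Icc (by fun_prop) fun x => hb _]
  have h1 (m : ℝ) : ∫ w, f (w - c) ∂gaussianReal m v =
      ∫ x, l⁻¹ * (gaussianPDFReal m v (l⁻¹ * x + c) * f (l⁻¹ * x)) := by
    rw [integral_gaussianReal_eq_integral_smul hvne,
      ← integral_add_right_eq_self (fun w => gaussianPDFReal m v w • f (w - c)) c,
      integral_const_mul]
    simp only [add_sub_cancel_right, smul_eq_mul]
    rw [Measure.integral_comp_mul_left (fun w => gaussianPDFReal m v (w + c) * f w), inv_inv,
      abs_of_pos hl, smul_eq_mul, ← mul_assoc, inv_mul_cancel₀ hl.ne', one_mul]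
  have h1i (m : ℝ) : Integrable
      (fun x => l⁻¹ * (gaussianPDFReal m v (l⁻¹ * x + c) * f (l⁻¹ * x))) := by
    refine Integrable.const_mul ?_ _
    refine Integrable.mul_bdd (c := 1) (((integrable_gaussianPDFReal m v).comp_add_right c).comp_mul_left'
      (inv_ne_zero hl.ne')) (hf.comp (by fun_prop)).aestronglyMeasurable (ae_of_all _ fun x => ?_)
    rw [Real.norm_of_nonneg (hb _).1]; exact (hb _).2
  simp_rw [h1]
  rw [← integral_finsetSum _ fun σ _ => h1i _]
  congr 1
  ext x
  have hexpc := exp_neg_tilt_mul_centre hh hθ hd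
  rw [← hc, ← hldef] at hexpc
  have hpdf (S : ℝ) : l⁻¹ * gaussianPDFReal (h * S) v (l⁻¹ * x + c) =
      Real.exp (-x) * (Real.sqrt (centreVar h θ) * ((2 * Real.cosh (l * h)) ^ d)⁻¹ *
        (Real.exp (l * h * S) * Real.exp (-((c + l⁻¹ * x -
          (l * θ + h * Real.tanh (l * h)) * d) / Real.sqrt (θ * d) -
            h / Real.sqrt θ * ((S - d * Real.tanh (l * h)) / Real.sqrt d)) ^ 2 / 2))) := by
    set u := c + l⁻¹ * x - h * S - l * v with hu
    have e1 : (c + l⁻¹ * x - (l * θ + h * Real.tanh (l * h)) * d) / Real.sqrt (θ * d) -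
            h / Real.sqrt θ * ((S - d * Real.tanh (l * h)) / Real.sqrt d) = u / Real.sqrt v := by
      rw [hv, Real.sqrt_mul hθ.le, hu, hv]
      have := Real.sqrt_pos.2 hθ
      have := Real.sqrt_pos.2 hd0
      field_simp
      ring
    have e2 : gaussianPDFReal (h * S) v (l⁻¹ * x + c) = (Real.sqrt (2 * Real.pi * v))⁻¹ *
        (Real.exp (-(l * c)) * Real.exp (-x) * Real.exp (l * h * S) * Real.exp (l ^ 2 * v / 2) *
          Real.exp (-(u / Real.sqrt v) ^ 2 / 2)) := by
      rw [gaussianPDFReal, ← Real.exp_add, ← Real.exp_add, ← Real.exp_add, ← Real.exp_add, div_pow,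
        Real.sq_sqrt hv0.le]
      congr 2
      rw [hu]
      field_simp
      ring
    rw [e1, e2, hexpc, logMoment, neg_add, Real.exp_add, ← hv, Real.exp_neg (_ * _),
      ← two_cosh_pow, Real.exp_neg (l ^ 2 * v / 2), 
      Real.sqrt_mul (show (0 : ℝ) ≤ 2 * Real.pi by positivity) (v : ℝ),
      Real.sqrt_mul (show (0 : ℝ) ≤ 2 * Real.pi by positivity) (centreVar h θ)]
    have e3 := (Real.exp_pos (l ^ 2 * v / 2)).ne'
    have e4 := (Real.sqrt_pos.2 hv0).ne'
    have e5 := (Real.sqrt_pos.2 (show 0 < 2 * Real.pi by positivity)).ne'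
    field_simp
  calc ∑ σ : Config d, l⁻¹ * (gaussianPDFReal (h * spinSum σ) v (l⁻¹ * x + c) * f (l⁻¹ * x))
      = ∑ σ : Config d, f (l⁻¹ * x) *
          (l⁻¹ * gaussianPDFReal (h * spinSum σ) v (l⁻¹ * x + c)) :=
        Finset.sum_congr rfl fun σ _ => by ring
    _ = _ := by
        rw [← Finset.mul_sum]
        simp_rw [hpdf]
        rw [← Finset.mul_sum, ← Finset.mul_sum, densityCorr, tiltMean, ← hc, ← hldef, mul_assoc]

end

/-! ### Sharp bounds for the iterated level maps -/

section

variable {h : ℝ} {d : ℕ → ℕ} {v : ℕ → ℝ≥0} {ψ : ℝ → ℝ}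

/-- The logarithm of the exponential moment of the intensity of the levels `k, …, k + r - 1`. -/
def momentSum (h l : ℝ) (d : ℕ → ℕ) (v : ℕ → ℝ≥0) (k r : ℕ) : ℝ :=
  ∑ i ∈ Finset.range r, logMoment h l (d (k + i)) (v (k + i))

lemma momentSum_eq (h l : ℝ) (d : ℕ → ℕ) (v : ℕ → ℝ≥0) (k r : ℕ) : momentSum h l d v k r =
    logMoment h l (∑ i ∈ Finset.range r, (d (k + i) : ℝ)) (∑ i ∈ Finset.range r, (v (k + i) : ℝ)) := by
  simp only [momentSum, logMoment, Finset.sum_add_distrib, Finset.sum_mul, Finset.mul_sum,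
    Finset.sum_div]

lemma momentSum_succ (h l : ℝ) (d : ℕ → ℕ) (v : ℕ → ℝ≥0) (k r : ℕ) : momentSum h l d v k (r + 1) =
    logMoment h l (d k) (v k) + momentSum h l d v (k + 1) r := by
  rw [momentSum, Finset.sum_range_succ', add_comm]
  simp only [momentSum, add_zero, add_assoc, add_comm 1]

/-- The error made at level `k + j` if the product over the configurations is linearised. -/
def iterError (h l : ℝ) (d : ℕ → ℕ) (v : ℕ → ℝ≥0) (C p : ℝ) (k r j : ℕ) (y : ℝ) : ℝ :=
  C ^ p * Real.exp (p * (l * y + momentSum h l d v k r) +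
    (momentSum h (p * l) d v k j - p * momentSum h l d v k j))

lemma iterError_add (h l : ℝ) (d : ℕ → ℕ) (v : ℕ → ℝ≥0) (C p : ℝ) (k r j : ℕ) (y w : ℝ) :
    iterError h l d v C p k r j (y + w) =
      iterError h l d v C p k r j y * Real.exp (p * l * w) := by
  rw [iterError, iterError, mul_assoc, ← Real.exp_add]
  congr 2; ring

/-- As an exponential in y, an error is reproduced when it is carried up one level; only its indices
shift. -/
lemma integral_iterError (h l : ℝ) (d : ℕ → ℕ) (v : ℕ → ℝ≥0) (C p : ℝ) (k r j : ℕ) (y : ℝ) :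
    ∫ w, iterError h l d v C p (k + 1) r j (y + w) ∂intensity h (d k) (v k) =
      iterError h l d v C p k (r + 1) (j + 1) y := by
  simp_rw [iterError_add, integral_const_mul, integral_exp_intensity]
  rw [iterError, iterError, mul_assoc, ← Real.exp_add, momentSum_succ, momentSum_succ,
    momentSum_succ]
  congr 2; ring

lemma integrable_integral_shift {μ ν : Measure ℝ} [IsFiniteMeasure μ] [IsFiniteMeasure ν]
    {f : ℝ → ℝ} (hf : Measurable f) (hb : ∀ x, f x ∈ Icc (0 : ℝ) 1) (y : ℝ) :
    Integrable (fun w => ∫ x, f (y + w + x) ∂μ) ν := by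
  refine Integrable.of_bound ((measurable_integral_shift hf μ).comp
    (measurable_const_add y)).aestronglyMeasurable (1 * μ.real univ) (ae_of_all _ fun w => ?_)
  refine norm_integral_le_of_norm_le_const (ae_of_all _ fun x => ?_)
  rw [Real.norm_of_nonneg (hb _).1]; exact (hb _).2

lemma intensity_zero (h : ℝ) : intensity h 0 0 = Measure.dirac 0 := by
  simp [intensity, spinSum]

lemma integral_intensity_iter (hψ : Measurable ψ) (hb : ∀ x, ψ x ∈ Icc (0 : ℝ) 1) (r k : ℕ)
    (y : ℝ) : ∫ w, ∫ x, ψ (y + w + x) ∂intensity h (∑ i ∈ Finset.range r, d (k + 1 + i))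
        (∑ i ∈ Finset.range r, v (k + 1 + i)) ∂intensity h (d k) (v k) =
      ∫ x, ψ (y + x) ∂intensity h (∑ i ∈ Finset.range (r + 1), d (k + i))
        (∑ i ∈ Finset.range (r + 1), v (k + i)) := by
  simp_rw [add_assoc y]
  rw [integral_intensity_add (f := fun x => ψ (y + x)) (by fun_prop) fun x => hb _,
    Finset.sum_range_succ', Finset.sum_range_succ', add_comm (d k), add_comm (v k)]
  simp only [add_zero, add_assoc, add_comm 1]

lemma integral_one_sub_iter_le (hψ : Measurable ψ) (hb : ∀ x, ψ x ∈ Icc (0 : ℝ) 1) (r k : ℕ)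
    (H : ∀ y, 1 - iter h d v r (k + 1) ψ y ≤ ∫ x, (1 - ψ (y + x))
      ∂intensity h (∑ i ∈ Finset.range r, d (k + 1 + i)) (∑ i ∈ Finset.range r, v (k + 1 + i)))
    (y : ℝ) : ∫ w, (1 - iter h d v r (k + 1) ψ (y + w)) ∂intensity h (d k) (v k) ≤
      ∫ x, (1 - ψ (y + x)) ∂intensity h (∑ i ∈ Finset.range (r + 1), d (k + i))
        (∑ i ∈ Finset.range (r + 1), v (k + i)) := by
  have hψ' : Measurable fun x => 1 - ψ x := by fun_prop
  have hb' := fun x => one_sub_mem (hb x)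
  rw [← integral_intensity_iter (ψ := fun x => 1 - ψ x) hψ' hb']
  refine integral_mono (integrable_of_mem_Icc ?_ fun x => one_sub_mem (iter_mem hb _ _ _))
    (integrable_integral_shift hψ' hb' _) fun w => H _
  have := measurable_iter (h := h) (d := d) (v := v) hψ r (k + 1)
  fun_prop

lemma one_sub_iter_le_integral (hψ : Measurable ψ) (hb : ∀ x, ψ x ∈ Icc (0 : ℝ) 1) (r k : ℕ)
    (y : ℝ) : 1 - iter h d v r k ψ y ≤ ∫ x, (1 - ψ (y + x))
      ∂intensity h (∑ i ∈ Finset.range r, d (k + i)) (∑ i ∈ Finset.range r, v (k + i)) := by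
  induction r generalizing k y with
  | zero => simp [intensity_zero, iter]
  | succ r ih =>
    exact (one_sub_levelMap_le (measurable_iter hψ _ _) (iter_mem hb _ _) _ _ _).trans
      (integral_one_sub_iter_le hψ hb r k (ih _) y)

lemma le_integral_one_sub_iter (hψ : Measurable ψ) (hb : ∀ x, ψ x ∈ Icc (0 : ℝ) 1) {C l p : ℝ}
    (r k : ℕ)
    (H : ∀ y, ∫ x, (1 - ψ (y + x)) ∂intensity h (∑ i ∈ Finset.range r, d (k + 1 + i))
      (∑ i ∈ Finset.range r, v (k + 1 + i)) -
        ∑ j ∈ Finset.range r, iterError h l d v C p (k + 1) r j y ≤ 1 - iter h d v r (k + 1) ψ y)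
    (y : ℝ) : ∫ x, (1 - ψ (y + x)) ∂intensity h (∑ i ∈ Finset.range (r + 1), d (k + i))
        (∑ i ∈ Finset.range (r + 1), v (k + i)) -
      ∑ j ∈ Finset.range r, iterError h l d v C p k (r + 1) (j + 1) y ≤
        ∫ w, (1 - iter h d v r (k + 1) ψ (y + w)) ∂intensity h (d k) (v k) := by
  have hψ' : Measurable fun x => 1 - ψ x := by fun_prop
  have hb' := fun x => one_sub_mem (hb x)
  have hie (j : ℕ) : Integrable (fun w => iterError h l d v C p (k + 1) r j (y + w))
      (intensity h (d k) (v k)) := by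
    simp_rw [iterError_add]
    exact (integrable_exp_intensity _ _ _ _).const_mul _
  have h1 := integrable_integral_shift (μ := intensity h (∑ i ∈ Finset.range r, d (k + 1 + i))
    (∑ i ∈ Finset.range r, v (k + 1 + i))) (ν := intensity h (d k) (v k)) hψ' hb' y
  rw [← integral_intensity_iter (ψ := fun x => 1 - ψ x) hψ' hb']
  simp_rw [← integral_iterError]
  rw [← integral_finsetSum _ fun j _ => hie j, ← integral_sub h1 (integrable_finsetSum _ fun j _ => hie j)]
  refine integral_mono (h1.sub (integrable_finsetSum _ fun j _ => hie j))
    (integrable_of_mem_Icc ?_ fun x => one_sub_mem (iter_mem hb _ _ _)) fun w => H _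
  have := measurable_iter (h := h) (d := d) (v := v) hψ r (k + 1)
  fun_prop

lemma integral_one_sub_iter_nonneg (hb : ∀ x, ψ x ∈ Icc (0 : ℝ) 1) (r k : ℕ) (μ : Measure ℝ)
    (y : ℝ) : 0 ≤ ∫ w, (1 - iter h d v r k ψ (y + w)) ∂μ :=
  integral_nonneg fun _ => (one_sub_mem (iter_mem hb _ _ _)).1

/-- Each linearisation loses at most the p-th power of the first moment, itself exponentially
bounded. The loss made `j` levels further down arrives at level `k` as `iterError` with index `j`.
-/
lemma le_one_sub_iter (hψ : Measurable ψ) (hb : ∀ x, ψ x ∈ Icc (0 : ℝ) 1) {C l p : ℝ} (hC0 : 0 ≤ C)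
    (hC : ∀ x, 1 - ψ x ≤ C * Real.exp (l * x)) (hp1 : 1 ≤ p) (hp2 : p ≤ 2) (r k : ℕ) (y : ℝ) :
    ∫ x, (1 - ψ (y + x)) ∂intensity h (∑ i ∈ Finset.range r, d (k + i))
      (∑ i ∈ Finset.range r, v (k + i)) -
        ∑ j ∈ Finset.range r, iterError h l d v C p k r j y ≤ 1 - iter h d v r k ψ y := by
  induction r generalizing k y with
  | zero => simp [intensity_zero, iter]
  | succ r ih =>
    have h1 := sub_rpow_le_one_sub_levelMap (h := h) (measurable_iter (h := h) (d := d) (v := v) hψ r (k + 1))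
      (iter_mem hb _ _) (d k) (v k) y hp1 hp2
    have h2 := le_integral_one_sub_iter hψ hb r k (ih (k + 1)) y
    have hA0 := integral_one_sub_iter_nonneg (h := h) (d := d) (v := v) hb r (k + 1)
      (intensity h (d k) (v k)) y
    have h3 : ∫ w, (1 - iter h d v r (k + 1) ψ (y + w)) ∂intensity h (d k) (v k) ≤
        C * Real.exp (l * y + momentSum h l d v k (r + 1)) := by
      have h4 := fun x => (one_sub_iter_le_exp (h := h) (d := d) (v := v) hψ hb hC r (k + 1) x)
      rw [← momentSum_eq] at h4
      have h5 : ∀ x, 1 - iter h d v r (k + 1) ψ x ≤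
          (C * Real.exp (momentSum h l d v (k + 1) r)) * Real.exp (l * x) := fun x =>
        (h4 x).trans_eq (by rw [Real.exp_add]; ring)
      refine (integral_one_sub_le_exp (measurable_iter hψ _ _) (iter_mem hb _ _) h5 _ _ _).trans_eq ?_
      rw [mul_assoc, ← Real.exp_add, momentSum_succ]
      congr 2; ring
    have h6 : (∫ w, (1 - iter h d v r (k + 1) ψ (y + w)) ∂intensity h (d k) (v k)) ^ p ≤
        iterError h l d v C p k (r + 1) 0 y := by
      refine (Real.rpow_le_rpow hA0 h3 (by linarith)).trans_eq ?_
      rw [Real.mul_rpow hC0 (Real.exp_pos _).le, ← Real.exp_mul, iterError]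
      simp [momentSum, mul_comm p]
    have h7 := Finset.sum_range_succ' (fun j => iterError h l d v C p k (r + 1) j y) r
    rw [iter]
    linarith

/-- The error made at the first level. -/
def topError (h l : ℝ) (d : ℕ → ℕ) (v : ℕ → ℝ≥0) (C p : ℝ) (k r : ℕ) (y : ℝ) : ℝ :=
  C ^ p * Real.exp (p * (l * y + momentSum h l d v k r) +
    (logMoment h (p * l) (d k) 0 - p * logMoment h l (d k) 0))

lemma exp_neg_le_one_sub {x : ℝ} (_h0 : 0 ≤ x) (h1 : x ≤ 1 / 2) :
    Real.exp (-(x + 2 * x ^ 2)) ≤ 1 - x := by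
  have h2 := Real.add_one_le_exp (x + 2 * x ^ 2)
  rw [Real.exp_neg, inv_le_comm₀ (Real.exp_pos _) (by linarith)]
  refine le_trans ?_ h2
  rw [inv_le_iff_one_le_mul₀ (by linarith)]
  nlinarith [sq_nonneg x]

/-- At the first level the p-th power of the whole sum does not become small. Here the powers are
taken configuration by configuration, so the exponent `p * l` acts on the spins alone, which
explains the zero variance in the error. -/
lemma le_levelMap {F : ℝ → ℝ} (hF : Measurable F) (hb : ∀ x, F x ∈ Icc (0 : ℝ) 1) {C l p : ℝ}
    (hC0 : 0 ≤ C) (hC : ∀ x, 1 - F x ≤ C * Real.exp (l * x)) (hp1 : 1 ≤ p) (hp2 : p ≤ 2) (d : ℕ)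
    (v : ℝ≥0) (y : ℝ)
    (hS : C ^ p * Real.exp (p * (l * y + l ^ 2 * v / 2) + logMoment h (p * l) d 0) ≤ 1 / 4) :
    Real.exp (-(∫ w, (1 - F (y + w)) ∂intensity h d v + 2 * (C ^ p *
      Real.exp (p * (l * y + l ^ 2 * v / 2) + logMoment h (p * l) d 0)))) ≤ levelMap h d v F y := by
  set S := C ^ p * Real.exp (p * (l * y + l ^ 2 * v / 2) + logMoment h (p * l) d 0) with hSdef
  set r : Config d → ℝ := fun σ => ∫ w, (1 - F (y + h * spinSum σ + w)) ∂gaussianReal 0 v with hr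
  have hrm (σ : Config d) : r σ ∈ Icc (0 : ℝ) 1 := integral_mem_Icc fun x => one_sub_mem (hb _)
  have hrle (σ : Config d) : r σ ≤ C * Real.exp (l * y + l ^ 2 * v / 2 + l * h * spinSum σ) := by
    have h1 : r σ ≤ ∫ w, C * Real.exp (l * (y + h * spinSum σ)) * Real.exp (l * w)
        ∂gaussianReal 0 v := by
      refine integral_mono (integrable_of_mem_Icc (by fun_prop) fun x => one_sub_mem (hb _))
        ((integrable_exp_mul_gaussianReal l).const_mul _) fun w => (hC _).trans_eq ?_
      rw [mul_assoc, ← Real.exp_add]; congr 2; ring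
    refine h1.trans_eq ?_
    rw [integral_const_mul, integral_exp_gaussianReal, mul_assoc, ← Real.exp_add]
    congr 2; ring
  have hrp (σ : Config d) : r σ ^ p ≤
      C ^ p * Real.exp (p * (l * y + l ^ 2 * v / 2)) * Real.exp (p * l * h * spinSum σ) := by
    refine (Real.rpow_le_rpow (hrm σ).1 (hrle σ) (by linarith)).trans_eq ?_
    rw [Real.mul_rpow hC0 (Real.exp_pos _).le, ← Real.exp_mul, mul_assoc (C ^ p), ← Real.exp_add]
    congr 2; ring
  have hsum : ∑ σ, r σ ^ p ≤ S := by
    refine (Finset.sum_le_sum fun σ _ => hrp σ).trans_eq ?_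
    rw [← Finset.mul_sum, sum_exp_mul_spinSum, two_cosh_pow, mul_assoc, ← Real.exp_add, hSdef,
      logMoment]
    congr 3; ring
  have hsq (σ : Config d) : r σ ^ 2 ≤ r σ ^ p := by
    rw [← Real.rpow_natCast]
    exact Real.rpow_le_rpow_of_exponent_ge' (hrm σ).1 (hrm σ).2 (by linarith) (by simpa using hp2)
  -- From r² ≤ r^p ≤ 1/4, where p ≤ 2 and 0 ≤ r ≤ 1.
  have hhalf (σ : Config d) : r σ ≤ 1 / 2 := by
    have h1 : r σ ^ p ≤ 1 / 4 := (Finset.single_le_sum (f := fun σ => r σ ^ p)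
      (fun τ _ => Real.rpow_nonneg (hrm τ).1 _) (Finset.mem_univ σ)).trans (hsum.trans hS)
    nlinarith [hsq σ, (hrm σ).1]
  rw [levelMap_eq hF hb, integral_intensity_shift (f := fun x => 1 - F x) (by fun_prop)
    fun x => one_sub_mem (hb x)]
  calc Real.exp (-(∑ σ, r σ + 2 * S)) ≤ Real.exp (∑ σ, -(r σ + 2 * r σ ^ 2)) := by
        rw [Real.exp_le_exp, Finset.sum_neg_distrib, Finset.sum_add_distrib, ← Finset.mul_sum]
        have := Finset.sum_le_sum fun σ (_ : σ ∈ Finset.univ) => hsq σ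
        linarith
    _ = ∏ σ, Real.exp (-(r σ + 2 * r σ ^ 2)) := Real.exp_sum _ _
    _ ≤ ∏ σ, (1 - r σ) := Finset.prod_le_prod (fun _ _ => (Real.exp_pos _).le) fun σ _ =>
        exp_neg_le_one_sub (hrm σ).1 (hhalf σ)

lemma one_sub_iter_le_exp_momentSum (hψ : Measurable ψ) (hb : ∀ x, ψ x ∈ Icc (0 : ℝ) 1) {C l : ℝ}
    (hC : ∀ x, 1 - ψ x ≤ C * Real.exp (l * x)) (r k : ℕ) (y : ℝ) :
    1 - iter h d v r k ψ y ≤ (C * Real.exp (momentSum h l d v k r)) * Real.exp (l * y) := by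
  refine (one_sub_iter_le_exp hψ hb hC r k y).trans_eq ?_
  rw [← momentSum_eq, Real.exp_add]; ring

/-- Up to small errors, the iterated level map is the exponential of minus the expected number
of points. -/
theorem iter_mem_Icc_exp (hψ : Measurable ψ) (hb : ∀ x, ψ x ∈ Icc (0 : ℝ) 1) {C l p : ℝ}
    (hC0 : 0 ≤ C) (hC : ∀ x, 1 - ψ x ≤ C * Real.exp (l * x)) (hp1 : 1 ≤ p) (hp2 : p ≤ 2) (r k : ℕ)
    (y : ℝ) (hS : topError h l d v C p k (r + 1) y ≤ 1 / 4) :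
    iter h d v (r + 1) k ψ y ∈ Icc
      (Real.exp (-(∫ x, (1 - ψ (y + x)) ∂intensity h (∑ i ∈ Finset.range (r + 1), d (k + i))
        (∑ i ∈ Finset.range (r + 1), v (k + i)) + 2 * topError h l d v C p k (r + 1) y)))
      (Real.exp (-(∫ x, (1 - ψ (y + x)) ∂intensity h (∑ i ∈ Finset.range (r + 1), d (k + i))
        (∑ i ∈ Finset.range (r + 1), v (k + i)) -
          ∑ j ∈ Finset.range r, iterError h l d v C p k (r + 1) (j + 1) y))) := by
  have hm := measurable_iter (h := h) (d := d) (v := v) hψ r (k + 1)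
  have hmem := iter_mem (h := h) (d := d) (v := v) hb r (k + 1)
  have h1 := integral_one_sub_iter_le (h := h) (d := d) (v := v) hψ hb r k
    (one_sub_iter_le_integral hψ hb r (k + 1)) y
  have h2 := le_integral_one_sub_iter (h := h) (d := d) (v := v) hψ hb r k
    (le_one_sub_iter hψ hb hC0 hC hp1 hp2 r (k + 1)) y
  have htop : (C * Real.exp (momentSum h l d v (k + 1) r)) ^ p * Real.exp
      (p * (l * y + l ^ 2 * v k / 2) + logMoment h (p * l) (d k) 0) =
        topError h l d v C p k (r + 1) y := by
    rw [Real.mul_rpow hC0 (Real.exp_pos _).le, ← Real.exp_mul, mul_assoc, ← Real.exp_add, topError,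
      momentSum_succ, logMoment, logMoment, logMoment]
    congr 2; ring
  have h3 := le_levelMap (h := h) hm hmem (mul_nonneg hC0 (Real.exp_pos _).le)
    (one_sub_iter_le_exp_momentSum hψ hb hC r (k + 1)) hp1 hp2 (d k) (v k) y (htop.trans_le hS)
  rw [htop] at h3
  refine ⟨le_trans (Real.exp_le_exp.2 (by linarith)) h3, (levelMap_le_exp hm hmem _ _ _).trans
    (Real.exp_le_exp.2 (by linarith))⟩

end

/-! ### The limit of one block -/

section

variable {h θ : ℝ}

lemma logMoment_mul (h l D V T : ℝ) : logMoment h l (D * T) (V * T) = logMoment h l D V * T := by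
  unfold logMoment; ring

/-- Linearisation errors at a point below the hull of the order parameter have a negative
exponent. -/
lemma eventually_logMoment_sub_neg (hh : 0 ≤ h) (hθ : 0 < θ) {X H : ℝ} (hXH : H < θ * X) :
    ∀ᶠ p in 𝓝[>] (1 : ℝ),
      logMoment h (p * tilt h θ) X H - p * logMoment h (tilt h θ) X H < 0 := by
  obtain ⟨hl, -, -, h3, -⟩ := tilt_spec hh hθ
  set l := tilt h θ with hldef
  have h1 : HasDerivAt (fun p : ℝ => p * l) l 1 := by simpa using (hasDerivAt_id (1 : ℝ)).mul_const l
  have h2 : HasDerivAt (fun l => logMoment h l X H) (h * Real.tanh (l * h) * X + l * H) (1 * l) := by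
    rw [one_mul]; exact hasDerivAt_logMoment h l X H
  have h4 := (h2.comp 1 h1).sub ((hasDerivAt_id (1 : ℝ)).mul_const (logMoment h l X H))
  -- By the critical equation the derivative in p at p = 1 is l²(H - θX)/2, so its sign records
  -- whether the point lies below the chord.
  have hneg : (h * Real.tanh (l * h) * X + l * H) * l - 1 * logMoment h l X H < 0 := by
    have : (h * Real.tanh (l * h) * X + l * H) * l - 1 * logMoment h l X H =
        l ^ 2 / 2 * (H - θ * X) := by
      rw [logMoment]
      rw [tiltEntropy] at h3
      linear_combination (-X / 2) * h3
    rw [this]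
    exact mul_neg_of_pos_of_neg (by positivity) (by linarith)
  have h5 := (hasDerivAt_iff_tendsto_slope.1 h4).eventually_lt_const hneg
  have h6 := h5.filter_mono (nhdsWithin_mono (1 : ℝ) (s := Ioi 1) (t := {1}ᶜ)
    fun x hx => ne_of_gt hx)
  filter_upwards [h6, self_mem_nhdsWithin] with p hp hp1
  rw [slope_def_field, div_neg_iff] at hp
  have hp1' : (1 : ℝ) < p := hp1
  simp only [Pi.sub_apply, Function.comp, id, one_mul, sub_self, sub_zero] at hp
  rcases hp with hp | hp
  · linarith [hp.2]
  · exact hp.1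

/-- The centring cancels the exponential moment up to a factor of order √T; the power T^{p/2} is
beaten by e^{φT}. -/
lemma tendsto_linearisation_error (hh : 0 ≤ h) (hθ : 0 < θ) {X φ : ℝ} (hX : 0 < X) (hφ : φ < 0)
    {D : ℕ → ℕ} {T : ℕ → ℝ} (hT : Tendsto T atTop atTop) (hD : ∀ a, (D a : ℝ) = X * T a)
    {C : ℝ} (hC : 0 ≤ C) (p y : ℝ) :
    Tendsto (fun a => (C * Real.exp (-(tilt h θ * centre h θ (D a)))) ^ p *
      Real.exp (p * (tilt h θ * y + logMoment h (tilt h θ) (D a) (θ * D a)) + φ * T a)) atTop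
      (𝓝 0) := by
  have hl := tilt_pos hh hθ
  set l := tilt h θ with hldef
  set K := C * Real.exp (l * y) * (Real.sqrt (2 * Real.pi * centreVar h θ) *
    (l * Real.sqrt (θ * X))) with hK
  have hK0 : 0 ≤ K := by positivity
  have h1 := ((tendsto_rpow_mul_exp_neg_mul_atTop_nhds_zero (p / 2) (-φ) (by linarith)).comp
    hT).const_mul (K ^ p)
  rw [mul_zero] at h1
  refine h1.congr' ?_
  filter_upwards [hT.eventually_gt_atTop 0] with a ha
  have hDa : 0 < D a := by
    have : (0 : ℝ) < D a := by rw [hD]; positivity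
    exact_mod_cast this
  set M := logMoment h l (D a) (θ * D a) with hM
  have e1 : Real.sqrt (θ * D a) = Real.sqrt (θ * X) * Real.sqrt (T a) := by
    rw [hD, ← mul_assoc, Real.sqrt_mul (by positivity)]
  rw [exp_neg_tilt_mul_centre hh hθ hDa, ← hldef, ← hM, e1]
  have e2 : C * (Real.exp (-M) * (Real.sqrt (2 * Real.pi * centreVar h θ) *
      (l * (Real.sqrt (θ * X) * Real.sqrt (T a))))) =
      K * Real.sqrt (T a) * Real.exp (-(l * y + M)) := by
    rw [hK, neg_add, Real.exp_add, Real.exp_neg (l * y)]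
    field_simp
  rw [e2, Real.mul_rpow (by positivity) (Real.exp_pos _).le, Real.mul_rpow hK0 (Real.sqrt_nonneg _),
    ← Real.exp_mul, mul_assoc, ← Real.exp_add, Real.sqrt_eq_rpow, ← Real.rpow_mul ha.le]
  simp only [Function.comp, neg_neg, mul_assoc]
  congr 2
  · congr 1; ring
  · congr 1; ring

lemma integrable_min_exp_mul_exp_neg {a C : ℝ} (ha : 1 < a) (hC : 0 ≤ C) :
    Integrable fun x : ℝ => min 1 (C * Real.exp (a * x)) * Real.exp (-x) := by
  have hn (x : ℝ) : ‖min 1 (C * Real.exp (a * x)) * Real.exp (-x)‖ =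
      min 1 (C * Real.exp (a * x)) * Real.exp (-x) :=
    Real.norm_of_nonneg (mul_nonneg (le_min zero_le_one (by positivity)) (Real.exp_pos _).le)
  have hmeas : Continuous fun x : ℝ => min 1 (C * Real.exp (a * x)) * Real.exp (-x) := by fun_prop
  rw [← integrableOn_univ, ← Iic_union_Ioi (a := (0 : ℝ))]
  refine IntegrableOn.union ?_ ?_
  · refine Integrable.mono' ((integrableOn_exp_mul_Iic (a := a - 1) (by linarith) 0).const_mul C)
      hmeas.aestronglyMeasurable (ae_of_all _ fun x => ?_)
    rw [hn, show (a - 1) * x = a * x + -x by ring, Real.exp_add, ← mul_assoc]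
    exact mul_le_mul_of_nonneg_right (min_le_right _ _) (Real.exp_pos _).le
  · refine Integrable.mono' (integrableOn_exp_neg_Ioi 0) hmeas.aestronglyMeasurable
      (ae_of_all _ fun x => ?_)
    rw [hn]
    exact mul_le_of_le_one_left (Real.exp_pos _).le (min_le_left _ _)

/-- The dominating function for the limit of one block. -/
lemma integrable_min_exp_shift {l κ C : ℝ} (hl : 0 < l) (hlκ : l < κ) (hC : 0 ≤ C) (y : ℝ) :
    Integrable (fun x : ℝ => min 1 (C * Real.exp (κ * (y + l⁻¹ * x))) * Real.exp (-x)) := by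
  have := integrable_min_exp_mul_exp_neg (a := κ * l⁻¹) (C := C * Real.exp (κ * y))
    (by rwa [← div_eq_mul_inv, one_lt_div hl]) (by positivity)
  refine this.congr (ae_of_all _ fun x => ?_)
  simp only
  rw [mul_assoc, ← Real.exp_add]
  congr 4; ring

/-- Translating x by -ly extracts the exact factor e^{ly}. So the passage through a block replaces
the exponent κ of a bound by the tilt `l` of the block. -/
lemma integral_min_exp_shift {l κ C : ℝ} (hl : 0 < l) (y : ℝ) :
    ∫ x : ℝ, min 1 (C * Real.exp (κ * (y + l⁻¹ * x))) * Real.exp (-x) =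
      (∫ x : ℝ, min 1 (C * Real.exp (κ * l⁻¹ * x)) * Real.exp (-x)) * Real.exp (l * y) := by
  rw [← integral_add_right_eq_self _ (-(l * y)), ← integral_mul_const]
  congr 1
  ext x
  rw [mul_assoc, ← Real.exp_add]
  congr 4
  · field_simp; ring
  · ring

/-- The map which describes the passage from one level of the cascade to the previous one. -/
def limitStep (γ : ℝ) (R : ℝ → ℝ) (y : ℝ) : ℝ :=
  1 - Real.exp (-∫ x, R (y + γ * x) * Real.exp (-x))

lemma min_exp_le {l κ C y : ℝ} (hlκ : l ≤ κ) (hl : 0 ≤ l) (hC : 1 ≤ C) {z : ℝ} (h1 : z ≤ 1)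
    (h2 : z ≤ C * Real.exp (κ * y)) : z ≤ C * Real.exp (l * y) := by
  rcases le_total y 0 with hy | hy
  · exact h2.trans (mul_le_mul_of_nonneg_left
      (Real.exp_le_exp.2 (mul_le_mul_of_nonpos_right hlκ hy)) (by linarith))
  · exact h1.trans (one_le_mul_of_one_le_of_one_le hC (Real.one_le_exp (by positivity)))

/-- The limit of the iterated level maps of one block. -/
theorem tendsto_iter_block (hh : 0 ≤ h) (hθ : 0 < θ) {r : ℕ} {ξ η : ℕ → ℝ} (hξ0 : 0 < ξ 0)
    (hX : 0 < ∑ i ∈ Finset.range (r + 1), ξ i)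
    (htot : ∑ i ∈ Finset.range (r + 1), η i = θ * ∑ i ∈ Finset.range (r + 1), ξ i)
    (hstrict : ∀ j ∈ Finset.range r,
      ∑ i ∈ Finset.range (j + 1), η i < θ * ∑ i ∈ Finset.range (j + 1), ξ i)
    {T : ℕ → ℝ} (hT : Tendsto T atTop atTop) {d : ℕ → ℕ → ℕ} {v : ℕ → ℕ → ℝ≥0}
    (hd : ∀ a, ∀ k < r + 1, (d a k : ℝ) = ξ k * T a)
    (hv : ∀ a, ∀ k < r + 1, (v a k : ℝ) = η k * T a)
    {D : ℕ → ℕ} (hD : ∀ a, D a = ∑ i ∈ Finset.range (r + 1), d a i)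
    {R : ℕ → ℝ → ℝ} {Rlim : ℝ → ℝ} (hR : ∀ a, Measurable (R a))
    (hb : ∀ a x, R a x ∈ Icc (0 : ℝ) 1) (hlim : ∀ x, Tendsto (fun a => R a x) atTop (𝓝 (Rlim x)))
    {κ C : ℝ} (hκ : tilt h θ < κ) (hC1 : 1 ≤ C)
    (hC : ∀ᶠ a in atTop, ∀ x, R a x ≤ C * Real.exp (κ * x)) :
    (∀ y, Tendsto (fun a => 1 - iter h (d a) (v a) (r + 1) 0
        (fun x => 1 - R a (x - centre h θ (D a))) y) atTop (𝓝 (limitStep (tilt h θ)⁻¹ Rlim y))) ∧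
      ∃ C', 1 ≤ C' ∧ ∀ᶠ a in atTop, ∀ y, 1 - iter h (d a) (v a) (r + 1) 0
        (fun x => 1 - R a (x - centre h θ (D a))) y ≤ C' * Real.exp (tilt h θ * y) := by
  have hl := tilt_pos hh hθ
  set l := tilt h θ with hldef
  set X := ∑ i ∈ Finset.range (r + 1), ξ i with hXdef
  have hDT (a : ℕ) : (D a : ℝ) = X * T a := by
    rw [hD]; push_cast
    rw [Finset.sum_congr rfl fun i hi => hd a i (Finset.mem_range.1 hi), ← Finset.sum_mul]
  have hdsum (a j : ℕ) (hj : j ≤ r + 1) : ∑ i ∈ Finset.range j, (d a (0 + i) : ℝ) =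
      (∑ i ∈ Finset.range j, ξ i) * T a := by
    rw [Finset.sum_mul]
    refine Finset.sum_congr rfl fun i hi => ?_
    rw [zero_add, hd a i (by have := Finset.mem_range.1 hi; omega)]
  have hvsum (a j : ℕ) (hj : j ≤ r + 1) : ∑ i ∈ Finset.range j, (v a (0 + i) : ℝ) =
      (∑ i ∈ Finset.range j, η i) * T a := by
    rw [Finset.sum_mul]
    refine Finset.sum_congr rfl fun i hi => ?_
    rw [zero_add, hv a i (by have := Finset.mem_range.1 hi; omega)]
  have hDtop : Tendsto D atTop atTop := by
    rw [← tendsto_natCast_atTop_iff (R := ℝ)]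
    simp_rw [hDT]
    exact hT.const_mul_atTop hX
  set c : ℕ → ℝ := fun a => centre h θ (D a) with hc
  set ψ : ℕ → ℝ → ℝ := fun a x => 1 - R a (x - c a) with hψ
  have hψm (a : ℕ) : Measurable (ψ a) := by
    have := hR a
    simp only [hψ]; fun_prop
  have hψb (a : ℕ) (x : ℝ) : ψ a x ∈ Icc (0 : ℝ) 1 := one_sub_mem (hb _ _)
  set L : ℕ → ℝ → ℝ := fun a y => ∫ x, (1 - ψ a (y + x))
    ∂intensity h (∑ i ∈ Finset.range (r + 1), d a (0 + i))
      (∑ i ∈ Finset.range (r + 1), v a (0 + i)) with hL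
  have hLeq : ∀ᶠ a in atTop, ∀ y, L a y =
      ∫ x, R a (y + l⁻¹ * x) * (Real.exp (-x) * densityCorr h θ (D a) x) := by
    filter_upwards [hDtop.eventually_gt_atTop 0] with a ha y
    have hRa := hR a
    have hvD : ((∑ i ∈ Finset.range (r + 1), v a (0 + i) : ℝ≥0) : ℝ) = θ * D a := by
      rw [NNReal.coe_sum, hvsum a _ le_rfl, htot, hDT, mul_assoc]
    have hdD : ∑ i ∈ Finset.range (r + 1), d a (0 + i) = D a := by
      rw [hD]; simp only [zero_add]
    simp only [hL]
    rw [hdD, ← integral_intensity_eq hh hθ ha hvD (f := fun x => R a (y + x)) (by fun_prop)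
      fun x => hb _ _]
    congr 1
    ext x
    simp only [hψ, sub_sub_cancel, hc]
    congr 1; ring
  set V := Real.sqrt (centreVar h θ) with hV
  set B : ℝ → ℝ → ℝ := fun y x => min 1 (C * Real.exp (κ * (y + l⁻¹ * x))) * Real.exp (-x) * V
    with hB
  have hBint (y : ℝ) : Integrable (B y) :=
    (integrable_min_exp_shift hl hκ (by linarith) y).mul_const V
  have hdom : ∀ᶠ a in atTop, ∀ y x,
      R a (y + l⁻¹ * x) * (Real.exp (-x) * densityCorr h θ (D a) x) ≤ B y x := by
    filter_upwards [hC] with a ha y x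
    simp only [hB]
    rw [mul_assoc (min _ _)]
    refine mul_le_mul (le_min (hb _ _).2 (ha _)) (mul_le_mul_of_nonneg_left (densityCorr_le _ _ _ _)
      (Real.exp_pos _).le) (mul_nonneg (Real.exp_pos _).le (densityCorr_nonneg _ _ _ _)) ?_
    exact le_min zero_le_one (by positivity)
  have hnn (a : ℕ) (y x : ℝ) :
      0 ≤ R a (y + l⁻¹ * x) * (Real.exp (-x) * densityCorr h θ (D a) x) :=
    mul_nonneg (hb _ _).1 (mul_nonneg (Real.exp_pos _).le (densityCorr_nonneg _ _ _ _))
  have hmeas (a : ℕ) (y : ℝ) : AEStronglyMeasurable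
      (fun x => R a (y + l⁻¹ * x) * (Real.exp (-x) * densityCorr h θ (D a) x)) volume := by
    have h1 := hR a
    have h2 := (continuous_densityCorr h θ (D a)).measurable
    exact Measurable.aestronglyMeasurable (by fun_prop)
  have hLlim (y : ℝ) : Tendsto (fun a => L a y) atTop
      (𝓝 (∫ x, Rlim (y + l⁻¹ * x) * Real.exp (-x))) := by
    refine Tendsto.congr' (hLeq.mono fun a ha => (ha y).symm) ?_
    refine tendsto_integral_filter_of_dominated_convergence (B y)
      (Eventually.of_forall fun a => hmeas a y) (hdom.mono fun a ha => ae_of_all _ fun x => ?_)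
      (hBint y) (ae_of_all _ fun x => ?_)
    · rw [Real.norm_of_nonneg (hnn _ _ _)]; exact ha y x
    · have := (hlim (y + l⁻¹ * x)).mul
        (((tendsto_densityCorr hh hθ x).comp hDtop).const_mul (Real.exp (-x)))
      rw [mul_one] at this
      exact this
  refine ⟨fun y => ?_, ?_⟩
  · -- the linearisation errors
    -- Only finitely many points must be treated, so one p near 1 serves all. The point (ξ 0, 0) for
    -- the top error lies below the chord trivially.
    obtain ⟨p, hp1, hp2, hpj, hp0⟩ : ∃ p : ℝ, 1 < p ∧ p ≤ 2 ∧ (∀ j ∈ Finset.range r,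
        logMoment h (p * l) (∑ i ∈ Finset.range (j + 1), ξ i) (∑ i ∈ Finset.range (j + 1), η i) -
          p * logMoment h l (∑ i ∈ Finset.range (j + 1), ξ i) (∑ i ∈ Finset.range (j + 1), η i) <
            0) ∧ logMoment h (p * l) (ξ 0) 0 - p * logMoment h l (ξ 0) 0 < 0 := by
      have h1 := (Filter.eventually_all_finset (Finset.range r)).2 fun j hj =>
        eventually_logMoment_sub_neg hh hθ (hstrict j hj)
      have h2 := eventually_logMoment_sub_neg hh hθ (X := ξ 0) (H := 0) (by positivity)
      obtain ⟨p, ⟨hp1, hp2⟩, hp3⟩ := ((h1.and h2).and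
        (Ioo_mem_nhdsGT (show (1 : ℝ) < 2 by norm_num))).exists
      exact ⟨p, hp3.1, hp3.2.le, hp1, hp2⟩
    have hC0 : 0 ≤ C := by linarith
    set C' : ℕ → ℝ := fun a => C * Real.exp (-(l * c a)) with hC'
    have hM (a : ℕ) : momentSum h l (d a) (v a) 0 (r + 1) = logMoment h l (D a) (θ * D a) := by
      rw [momentSum_eq, hdsum a _ le_rfl, hvsum a _ le_rfl, htot, hDT, mul_assoc]
    have hmom (a j : ℕ) (l : ℝ) (hj : j ≤ r + 1) : momentSum h l (d a) (v a) 0 j =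
        logMoment h l (∑ i ∈ Finset.range j, ξ i) (∑ i ∈ Finset.range j, η i) * T a := by
      rw [momentSum_eq, hdsum a _ hj, hvsum a _ hj, logMoment_mul]
    have herr (j : ℕ) (hj : j ∈ Finset.range r) : Tendsto
        (fun a => iterError h l (d a) (v a) (C' a) p 0 (r + 1) (j + 1) y) atTop (𝓝 0) := by
      refine (tendsto_linearisation_error hh hθ hX (hpj j hj) hT hDT hC0 p y).congr fun a => ?_
      have hj' : j + 1 ≤ r + 1 := by have := Finset.mem_range.1 hj; omega
      rw [iterError, hM, hmom a _ _ hj', hmom a _ _ hj']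
      congr 2; ring
    have htop : Tendsto (fun a => topError h l (d a) (v a) (C' a) p 0 (r + 1) y) atTop (𝓝 0) := by
      refine (tendsto_linearisation_error hh hθ hX hp0 hT hDT hC0 p y).congr fun a => ?_
      have e1 (l : ℝ) : logMoment h l (d a 0) 0 = logMoment h l (ξ 0) 0 * T a := by
        rw [hd a 0 (by omega), ← logMoment_mul, zero_mul]
      rw [topError, hM, e1, e1]
      congr 2; ring
    have hsum : Tendsto (fun a => ∑ j ∈ Finset.range r,
        iterError h l (d a) (v a) (C' a) p 0 (r + 1) (j + 1) y) atTop (𝓝 0) := by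
      have := tendsto_finsetSum (Finset.range r) herr
      rwa [Finset.sum_const_zero] at this
    have hev : ∀ᶠ a in atTop, iter h (d a) (v a) (r + 1) 0 (ψ a) y ∈ Icc
        (Real.exp (-(L a y + 2 * topError h l (d a) (v a) (C' a) p 0 (r + 1) y)))
        (Real.exp (-(L a y - ∑ j ∈ Finset.range r,
          iterError h l (d a) (v a) (C' a) p 0 (r + 1) (j + 1) y))) := by
      filter_upwards [hC, htop.eventually_le_const (show (0 : ℝ) < 1 / 4 by norm_num)] with a ha ha'
      refine iter_mem_Icc_exp (hψm a) (hψb a) (by positivity) (fun x => ?_) hp1.le hp2 r 0 y ha'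
      have h1 := min_exp_le hκ.le hl.le hC1 (hb a (x - c a)).2 (ha (x - c a))
      simp only [hψ, sub_sub_cancel]
      refine h1.trans_eq ?_
      rw [hC', mul_assoc, ← Real.exp_add]
      congr 2; ring
    have hlow := (Real.continuous_exp.tendsto _).comp (((hLlim y).add (htop.const_mul 2)).neg)
    have hupp := (Real.continuous_exp.tendsto _).comp (((hLlim y).sub hsum).neg)
    rw [mul_zero, add_zero] at hlow
    rw [sub_zero] at hupp
    exact (tendsto_of_tendsto_of_tendsto_of_le_of_le' hlow hupp (hev.mono fun a ha => ha.1)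
      (hev.mono fun a ha => ha.2)).const_sub 1
  · set I := (∫ x : ℝ, min 1 (C * Real.exp (κ * l⁻¹ * x)) * Real.exp (-x)) * V with hI
    refine ⟨max 1 I, le_max_left _ _, ?_⟩
    filter_upwards [hLeq, hdom] with a ha ha' y
    refine (one_sub_iter_le_integral (hψm a) (hψb a) _ _ _).trans ?_
    have h1 : L a y ≤ ∫ x, B y x := by
      rw [ha]
      exact integral_mono_of_nonneg (ae_of_all _ fun x => hnn a y x) (hBint y)
        (ae_of_all _ fun x => ha' y x)
    refine h1.trans ?_
    rw [hB]
    simp only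
    rw [integral_mul_const, integral_min_exp_shift hl, mul_right_comm]
    exact mul_le_mul_of_nonneg_right (le_max_right _ _) (Real.exp_pos _).le

end

/-! ### The limit of the Laplace functionals of the energies -/

/-- The composition of the maps `limitStep` of the levels `k, …, k + s - 1` of the cascade. -/
def limitIter (γ : ℕ → ℝ) : ℕ → ℕ → (ℝ → ℝ) → ℝ → ℝ
  | 0, _, R => R
  | s + 1, k, R => limitStep (γ k) (limitIter γ s (k + 1) R)

namespace OrderParameter

variable {n : ℕ} {D : OrderParameter n} {h : ℝ}

variable (D) in
/-- The number of spins of block `l`. -/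
def blockSize (h : ℝ) (N l : ℕ) : ℕ :=
  ∑ i ∈ Finset.range (D.J h (l + 1) - D.J h l), D.levelSize N (D.J h l + i)

variable (D) in
/-- The centring of block `l`, for energies multiplied by `√N`. -/
def blockCentre (h : ℝ) (N l : ℕ) : ℝ := centre h (D.thetaBar h l) (D.blockSize h N l)

lemma coe_blockSize (hh : 0 ≤ h) {l : ℕ} (hl : l < D.m h) {N : ℕ}
    (hdiv : ∀ k ≤ n, ∃ r : ℕ, D.x k * (N : ℝ) = r) : (D.blockSize h N l : ℝ) = D.xBar h l * N := by
  have h1 := D.J_lt_J_succ hh hl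
  have h2 := D.J_succ_le hh hl
  rw [blockSize, Nat.cast_sum, sum_levelSize_block hdiv (by omega),
    show D.J h l + (D.J h (l + 1) - D.J h l) = D.J h (l + 1) by omega, xBar]

theorem tendsto_one_sub_iter_block (hh : 0 ≤ h) (hs : D.StrictBlocks h) {l : ℕ} (hl : l < D.m h)
    {N : ℕ → ℕ} (hN : Tendsto N atTop atTop)
    (hdiv : ∀ a, ∀ k ≤ n, ∃ r : ℕ, D.x k * (N a : ℝ) = r)
    {R : ℕ → ℝ → ℝ} {Rlim : ℝ → ℝ} (hR : ∀ a, Measurable (R a))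
    (hb : ∀ a x, R a x ∈ Icc (0 : ℝ) 1) (hlim : ∀ x, Tendsto (fun a => R a x) atTop (𝓝 (Rlim x)))
    {κ C : ℝ} (hκ : D.blockTilt h l < κ) (hC1 : 1 ≤ C)
    (hC : ∀ᶠ a in atTop, ∀ x, R a x ≤ C * Real.exp (κ * x)) :
    (∀ y, Tendsto (fun a => 1 - iter h (D.levelSize (N a)) (D.levelVar (N a))
        (D.J h (l + 1) - D.J h l) (D.J h l) (fun x => 1 - R a (x - D.blockCentre h (N a) l)) y)
        atTop (𝓝 (limitStep (D.gammaBar h l) Rlim y))) ∧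
      ∃ C', 1 ≤ C' ∧ ∀ᶠ a in atTop, ∀ y, 1 - iter h (D.levelSize (N a)) (D.levelVar (N a))
        (D.J h (l + 1) - D.J h l) (D.J h l) (fun x => 1 - R a (x - D.blockCentre h (N a) l)) y ≤
          C' * Real.exp (D.blockTilt h l * y) := by
  have h1 := D.J_lt_J_succ hh hl
  have h2 := D.J_succ_le hh hl
  obtain ⟨r, hr⟩ : ∃ r, D.J h (l + 1) = D.J h l + (r + 1) := ⟨D.J h (l + 1) - D.J h l - 1, by omega⟩
  have hr' : D.J h (l + 1) - D.J h l = r + 1 := by omega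
  have hξsum (j : ℕ) : ∑ k ∈ Finset.range j, (D.x (D.J h l + k + 1) - D.x (D.J h l + k)) =
      D.x (D.J h l + j) - D.x (D.J h l) :=
    Finset.sum_range_sub (fun i => D.x (D.J h l + i)) j
  have hηsum (j : ℕ) : ∑ k ∈ Finset.range j, (D.q (D.J h l + k + 1) - D.q (D.J h l + k)) =
      D.q (D.J h l + j) - D.q (D.J h l) :=
    Finset.sum_range_sub (fun i => D.q (D.J h l + i)) j
  have key := tendsto_iter_block (h := h) hh (D.thetaBar_pos hh hl) (r := r)
    (ξ := fun k => D.x (D.J h l + k + 1) - D.x (D.J h l + k))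
    (η := fun k => D.q (D.J h l + k + 1) - D.q (D.J h l + k))
    (sub_pos.2 (D.x_lt _ (by omega)))
    (by rw [hξsum, ← hr]; exact D.xBar_pos hh hl)
    (by rw [hξsum, hηsum, ← hr]; exact D.qBar_eq hh hl)
    (fun j hj => by
      have := Finset.mem_range.1 hj
      rw [hξsum, hηsum]
      exact D.q_sub_lt_thetaBar_mul hh hs hl (by omega) (by omega))
    (tendsto_natCast_atTop_atTop.comp hN)
    (d := fun a k => D.levelSize (N a) (D.J h l + k))
    (v := fun a k => D.levelVar (N a) (D.J h l + k))
    (fun a k hk => coe_levelSize (hdiv a) (by omega))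
    (fun a k hk => D.coe_levelVar (N a) (by omega))
    (D := fun a => D.blockSize h (N a) l) (fun a => by rw [blockSize, hr'])
    hR hb hlim hκ hC1 hC
  rw [D.gammaBar_eq hh hl, hr']
  simp_rw [iter_shift (r + 1) (D.J h l)]
  exact key

/-- Backward induction over the blocks in which limit and exponential bound support each other. The
bound from the next block has exponent its larger tilt, which dominates the present block; for the
last block ψ allows any exponent. -/
theorem tendsto_one_sub_iter (hh : 0 ≤ h) (hs : D.StrictBlocks h)
    {N : ℕ → ℕ} (hN : Tendsto N atTop atTop)
    (hdiv : ∀ a, ∀ k ≤ n, ∃ r : ℕ, D.x k * (N a : ℝ) = r)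
    {ψ : ℝ → ℝ} (hψ : Measurable ψ) (hb : ∀ x, ψ x ∈ Icc (0 : ℝ) 1)
    (hC : ∀ κ > 0, ∃ C, 1 ≤ C ∧ ∀ x, 1 - ψ x ≤ C * Real.exp (κ * x)) (s l : ℕ)
    (hsl : l + s = D.m h) :
    (∀ y, Tendsto (fun a => 1 - iter h (D.levelSize (N a)) (D.levelVar (N a))
        (n - D.J h l) (D.J h l)
        (fun x => ψ (x - ∑ i ∈ Finset.Ico l (D.m h), D.blockCentre h (N a) i)) y)
        atTop (𝓝 (limitIter (D.gammaBar h) s l (fun x => 1 - ψ x) y))) ∧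
      ∀ κ > 0, (l < D.m h → κ ≤ D.blockTilt h l) → ∃ C, 1 ≤ C ∧ ∀ᶠ a in atTop, ∀ y,
        1 - iter h (D.levelSize (N a)) (D.levelVar (N a)) (n - D.J h l) (D.J h l)
          (fun x => ψ (x - ∑ i ∈ Finset.Ico l (D.m h), D.blockCentre h (N a) i)) y ≤
            C * Real.exp (κ * y) := by
  induction s generalizing l with
  | zero =>
    obtain rfl : l = D.m h := by omega
    simp only [D.J_m hh, Nat.sub_self, iter, Finset.Ico_self, Finset.sum_empty, sub_zero]
    refine ⟨fun y => tendsto_const_nhds, fun κ hκ _ => ?_⟩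
    obtain ⟨C, hC1, hC⟩ := hC κ hκ
    exact ⟨C, hC1, Eventually.of_forall fun _ => hC⟩
  | succ s ih =>
    have hl : l < D.m h := by omega
    have hpos := D.blockTilt_pos hh hl
    obtain ⟨hlim, hbound⟩ := ih (l + 1) (by omega)
    obtain ⟨κ, hκ, C, hC1, hC⟩ : ∃ κ, D.blockTilt h l < κ ∧ ∃ C, 1 ≤ C ∧ ∀ᶠ a in atTop, ∀ y,
        1 - iter h (D.levelSize (N a)) (D.levelVar (N a)) (n - D.J h (l + 1)) (D.J h (l + 1))
          (fun x => ψ (x - ∑ i ∈ Finset.Ico (l + 1) (D.m h), D.blockCentre h (N a) i)) y ≤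
            C * Real.exp (κ * y) := by
      by_cases hl' : l + 1 < D.m h
      · exact ⟨_, D.tilt_thetaBar_lt hh hl', hbound _ (D.blockTilt_pos hh hl') fun _ => le_rfl⟩
      · exact ⟨_, lt_add_one _, hbound _ (by linarith) fun h' => absurd h' hl'⟩
    have hmψ (a : ℕ) : Measurable
        (fun x => ψ (x - ∑ i ∈ Finset.Ico (l + 1) (D.m h), D.blockCentre h (N a) i)) := by fun_prop
    have key := tendsto_one_sub_iter_block hh hs hl hN hdiv
      (fun a => (measurable_iter (hmψ a) _ _).const_sub 1)
      (fun a x => one_sub_mem (iter_mem (fun _ => hb _) _ _ x)) hlim hκ hC1 hC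
    have heq (a : ℕ) (y : ℝ) : iter h (D.levelSize (N a)) (D.levelVar (N a))
        (n - D.J h l) (D.J h l)
        (fun x => ψ (x - ∑ i ∈ Finset.Ico l (D.m h), D.blockCentre h (N a) i)) y =
        iter h (D.levelSize (N a)) (D.levelVar (N a)) (D.J h (l + 1) - D.J h l) (D.J h l)
          (fun x => 1 - (1 - iter h (D.levelSize (N a)) (D.levelVar (N a)) (n - D.J h (l + 1))
            (D.J h (l + 1))
            (fun x => ψ (x - ∑ i ∈ Finset.Ico (l + 1) (D.m h), D.blockCentre h (N a) i))
            (x - D.blockCentre h (N a) l))) y := by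
      rw [D.iter_block_split hh hl]
      congr 1
      ext x
      rw [sub_sub_cancel, sub_eq_add_neg x, ← iter_comp_add]
      congr 1
      ext z
      rw [Finset.sum_eq_sum_Ico_succ_bot hl]
      congr 1
      ring
    simp_rw [heq]
    refine ⟨key.1, fun κ' hκ' hle => ?_⟩
    obtain ⟨C', hC1', hC'⟩ := key.2
    refine ⟨C', hC1', hC'.mono fun a ha y => min_exp_le (hle hl) hκ'.le hC1' ?_ (ha y)⟩
    rw [sub_le_self_iff]
    exact (iter_mem (fun x => one_sub_mem (one_sub_mem (iter_mem (fun _ => hb _) _ _ _))) _ _ _).1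

lemma sqrt_mul_scaling (hh : 0 ≤ h) {N : ℕ} (hdiv : ∀ k ≤ n, ∃ r : ℕ, D.x k * (N : ℝ) = r) (y : ℝ) :
    D.scalingInv h N y =
      Real.sqrt N * y - ∑ i ∈ Finset.Ico 0 (D.m h), D.blockCentre h N i := by
  rw [scalingInv, mul_sub, Finset.mul_sum, Nat.Ico_zero_eq_range]
  congr 1
  refine Finset.sum_congr rfl fun l hl => ?_
  have hl' := Finset.mem_range.1 hl
  rw [blockCentre, centre, coe_blockSize hh hl' hdiv, ← mul_assoc, ← mul_assoc,
    ← D.qBar_eq hh hl', Real.sqrt_mul (D.qBar_pos hh hl').le, mul_comm (Real.sqrt N)]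

/-- The limit of the Laplace functionals of the point processes of the energies. -/
theorem tendsto_integral_prod (hh : 0 ≤ h) (hs : D.StrictBlocks h)
    {N : ℕ → ℕ} (hN : Tendsto N atTop atTop)
    (hdiv : ∀ a, ∀ k ≤ n, ∃ r : ℕ, D.x k * (N a : ℝ) = r) {Ω : Type*} [MeasurableSpace Ω]
    {P : Measure Ω} {g : (a : ℕ) → Config (N a) → Ω → ℝ} (hg : ∀ a, D.IsGREM (N a) (g a) P)
    {ψ : ℝ → ℝ} (hψ : Measurable ψ) (hb : ∀ x, ψ x ∈ Icc (0 : ℝ) 1)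
    (hC : ∀ κ > 0, ∃ C, 1 ≤ C ∧ ∀ x, 1 - ψ x ≤ C * Real.exp (κ * x)) :
    Tendsto (fun a => ∫ ω, ∏ σ, ψ (D.scalingInv h (N a) (energy h (fun σ => g a σ ω) σ)) ∂P) atTop
      (𝓝 (1 - limitIter (D.gammaBar h) (D.m h) 0 (fun x => 1 - ψ x) 0)) := by
  have h1 := ((tendsto_one_sub_iter hh hs hN hdiv hψ hb hC (D.m h) 0 (zero_add _)).1 0).const_sub 1
  refine h1.congr' ?_
  filter_upwards [hN.eventually_gt_atTop 0] with a ha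
  simp_rw [sqrt_mul_scaling hh (hdiv a)]
  rw [integral_prod_eq_iter ha (hdiv a) (hg a) h (ψ := fun x =>
    ψ (x - ∑ i ∈ Finset.Ico 0 (D.m h), D.blockCentre h (N a) i)) (by fun_prop)
    fun x => abs_le.2 ⟨by linarith [(hb (x - ∑ i ∈ Finset.Ico 0 (D.m h), D.blockCentre h (N a) i)).1],
      (hb _).2⟩, sub_sub_cancel]
  rfl

end OrderParameter

/-! ### The exponential function on extended nonnegative numbers -/

/-- The function `x ↦ exp (-x)` on `[0, ∞]`. -/
def nexp (x : ℝ≥0∞) : ℝ≥0∞ := (EReal.exp x)⁻¹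

lemma one_le_exp_coe (x : ℝ≥0∞) : 1 ≤ EReal.exp x := EReal.one_le_exp_iff.2 (EReal.coe_ennreal_nonneg x)

lemma nexp_zero : nexp 0 = 1 := by simp [nexp]

lemma nexp_top : nexp ∞ = 0 := by simp [nexp]

lemma nexp_le_one (x : ℝ≥0∞) : nexp x ≤ 1 := ENNReal.inv_le_one.2 (one_le_exp_coe x)

lemma nexp_add (x y : ℝ≥0∞) : nexp (x + y) = nexp x * nexp y := by
  have hx : EReal.exp (x : EReal) ≠ 0 := (zero_lt_one.trans_le (one_le_exp_coe x)).ne'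
  have hy : EReal.exp (y : EReal) ≠ 0 := (zero_lt_one.trans_le (one_le_exp_coe y)).ne'
  rw [nexp, EReal.coe_ennreal_add, EReal.exp_add, ENNReal.mul_inv (Or.inl hx) (Or.inr hy), nexp, nexp]

lemma nexp_sum {ι : Type*} (s : Finset ι) (f : ι → ℝ≥0∞) :
    nexp (∑ i ∈ s, f i) = ∏ i ∈ s, nexp (f i) := by
  classical
  induction s using Finset.induction_on with
  | empty => simp [nexp_zero]
  | insert i s hi ih => rw [Finset.sum_insert hi, Finset.prod_insert hi, nexp_add, ih]

lemma continuous_nexp : Continuous nexp :=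
  continuous_inv.comp (EReal.expHomeomorph.continuous.comp continuous_coe_ennreal_ereal)

@[fun_prop]
lemma measurable_nexp : Measurable nexp := continuous_nexp.measurable

lemma nexp_antitone : Antitone nexp := fun _ _ hxy =>
  ENNReal.inv_le_inv.2 (EReal.exp_monotone (EReal.coe_ennreal_le_coe_ennreal_iff.2 hxy))

lemma nexp_ofReal {x : ℝ} (hx : 0 ≤ x) : nexp (ENNReal.ofReal x) = ENNReal.ofReal (Real.exp (-x)) := by
  rw [nexp, EReal.coe_ennreal_ofReal, max_eq_left hx, EReal.exp_coe, Real.exp_neg,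
    ENNReal.ofReal_inv_of_pos (Real.exp_pos _)]

lemma one_sub_nexp_ofReal {x : ℝ} (hx : 0 ≤ x) :
    1 - nexp (ENNReal.ofReal x) = ENNReal.ofReal (1 - Real.exp (-x)) := by
  rw [nexp_ofReal hx, ENNReal.ofReal_sub _ (Real.exp_pos _).le, ENNReal.ofReal_one]

lemma one_sub_nexp_le (x : ℝ≥0∞) : 1 - nexp x ≤ min 1 x := by
  refine le_min tsub_le_self ?_
  induction x with
  | top => simp
  | coe x =>
    rw [← ENNReal.ofReal_coe_nnreal, one_sub_nexp_ofReal x.coe_nonneg]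
    exact ENNReal.ofReal_le_ofReal (by linarith [Real.add_one_le_exp (-(x : ℝ))])

/-! ### Laplace functionals of Poisson processes -/

lemma lintegral_nexp_poissonMeasure (r : ℝ≥0) {c : ℝ≥0∞} (hc : c ≠ ∞) :
    ∫⁻ k, nexp (c * k) ∂poissonMeasure r = nexp ((1 - nexp c) * r) := by
  lift c to ℝ≥0 using hc
  have h1 (k : ℕ) : nexp ((c : ℝ≥0∞) * k) = ENNReal.ofReal (Real.exp (-(c * k : ℝ))) := by
    rw [← nexp_ofReal (by positivity), ENNReal.ofReal_mul c.coe_nonneg, ENNReal.ofReal_natCast,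
      ENNReal.ofReal_coe_nnreal]
  have h2 : (1 - nexp c) * (r : ℝ≥0∞) = ENNReal.ofReal ((1 - Real.exp (-c)) * r) := by
    rw [← ENNReal.ofReal_coe_nnreal (p := c), one_sub_nexp_ofReal c.coe_nonneg,
      ENNReal.ofReal_mul (by simp), ENNReal.ofReal_coe_nnreal]
  have h0 : 0 ≤ 1 - Real.exp (-(c : ℝ)) := by simp
  rw [h2, nexp_ofReal (by positivity)]
  simp_rw [h1]
  have hsum : HasSum (fun k : ℕ => Real.exp (-r) * (r : ℝ) ^ k / k.factorial * Real.exp (-(c * k : ℝ)))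
      (Real.exp (-((1 - Real.exp (-c)) * r))) := by
    have h3 := (NormedSpace.expSeries_div_hasSum_exp (𝔸 := ℝ) (Real.exp (-c) * r : ℝ)).mul_left
      (Real.exp (-r))
    rw [← Real.exp_eq_exp_ℝ, ← Real.exp_add] at h3
    have e1 : (fun k : ℕ => Real.exp (-r) * (r : ℝ) ^ k / k.factorial * Real.exp (-(c * k : ℝ))) =
        fun k : ℕ => Real.exp (-r) * ((Real.exp (-c) * r) ^ k / k.factorial) := by
      ext k
      rw [mul_pow, ← Real.exp_nat_mul, show -(c * k : ℝ) = k * -(c : ℝ) by ring]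
      ring
    rw [e1, show -((1 - Real.exp (-(c : ℝ))) * r) = -(r : ℝ) + Real.exp (-c) * r by ring]
    exact h3
  rw [poissonMeasure, lintegral_sum_measure]
  simp_rw [lintegral_smul_measure, lintegral_dirac]
  rw [← hsum.tsum_eq, ENNReal.ofReal_tsum_of_nonneg (fun k => by positivity) hsum.summable]
  refine tsum_congr fun k => ?_
  rw [smul_eq_mul, ← ENNReal.ofReal_mul (by positivity)]

namespace IsPoissonProcess

variable {Ω S : Type*} [MeasurableSpace Ω] [MeasurableSpace S] {ξ : Ω → Measure S}
  {Λ : Measure S} {P : Measure Ω}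

lemma lintegral_nexp_mul (hξ : IsPoissonProcess ξ Λ P) {B : Set S} (hB : MeasurableSet B)
    (hΛ : Λ B ≠ ∞) {c : ℝ≥0∞} (hc : c ≠ ∞) :
    ∫⁻ ω, nexp (c * ξ ω B) ∂P = nexp ((1 - nexp c) * Λ B) := by
  have hm : Measurable fun ω => ξ ω B := (Measure.measurable_coe hB).comp hξ.measurable
  rw [← lintegral_map (f := fun x => nexp (c * x)) (by fun_prop) hm, hξ.law B hB hΛ,
    lintegral_map (by fun_prop) (by fun_prop), lintegral_nexp_poissonMeasure _ hc,
    ENNReal.coe_toNNReal hΛ]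

/-- The level sets are disjoint, so their counts are independent Poisson variables and the
functional factors. The level set of 0 may have infinite intensity but contributes the factor 1. -/
lemma lintegral_nexp_simpleFunc (hξ : IsPoissonProcess ξ Λ P) (g : SimpleFunc S ℝ≥0∞)
    (hg : ∀ x, g x ≠ ∞) (hΛ : ∀ c ≠ 0, Λ (g ⁻¹' {c}) ≠ ∞) :
    ∫⁻ ω, nexp (∫⁻ x, g x ∂ξ ω) ∂P = nexp (∫⁻ x, (1 - nexp (g x)) ∂Λ) := by
  have h1 (ω : Ω) : nexp (∫⁻ x, g x ∂ξ ω) = ∏ i : Fin g.range.card,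
      nexp ((g.range.equivFin.symm i : ℝ≥0∞) * ξ ω (g ⁻¹' {(g.range.equivFin.symm i : ℝ≥0∞)})) := by
    rw [SimpleFunc.lintegral_eq_lintegral, SimpleFunc.lintegral, nexp_sum, ← Finset.prod_coe_sort,
      ← g.range.equivFin.symm.prod_comp]
  have hms (i : Fin g.range.card) :
      MeasurableSet (g ⁻¹' {(g.range.equivFin.symm i : ℝ≥0∞)}) := g.measurableSet_preimage _
  have hind := hξ.indep g.range.card (fun i => g ⁻¹' {(g.range.equivFin.symm i : ℝ≥0∞)}) hms
    (fun i j hij => by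
      refine Disjoint.preimage _ (disjoint_singleton.2 fun h => hij ?_)
      exact g.range.equivFin.symm.injective (Subtype.ext h))
  have hmeas (i : Fin g.range.card) : Measurable fun ω => ξ ω (g ⁻¹' {(g.range.equivFin.symm i : ℝ≥0∞)}) :=
    (Measure.measurable_coe (hms i)).comp hξ.measurable
  simp_rw [h1]
  refine (lintegral_prod_eq_prod_lintegral_of_indepFun Finset.univ _
    (hind.comp (fun i x => nexp ((g.range.equivFin.symm i : ℝ≥0∞) * x)) fun i => by fun_prop)
    fun i => measurable_nexp.comp ((hmeas i).const_mul _)).trans ?_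
  have h2 : ∫⁻ x, (1 - nexp (g x)) ∂Λ =
      ∑ c ∈ g.range, (1 - nexp c) * Λ (g ⁻¹' {c}) := by
    rw [← SimpleFunc.map_lintegral (fun c => 1 - nexp c) g, ← SimpleFunc.lintegral_eq_lintegral]
    rfl
  rw [h2, nexp_sum, ← Finset.prod_coe_sort g.range fun c => nexp ((1 - nexp c) * Λ (g ⁻¹' {c})),
    ← g.range.equivFin.symm.prod_comp]
  refine Finset.prod_congr rfl fun i _ => ?_
  by_cases h0 : (g.range.equivFin.symm i : ℝ≥0∞) = 0
  · have := hξ.indep 0 (fun _ => ∅) (by simp) (by simp)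
    have := this.isProbabilityMeasure
    simp [h0, nexp_zero]
  · refine hξ.lintegral_nexp_mul (hms i) (hΛ _ h0) ?_
    obtain ⟨x, hx⟩ := SimpleFunc.mem_range.1 (g.range.equivFin.symm i).2
    rw [← hx]; exact hg x

/-- The Laplace functional of a Poisson process. -/
theorem lintegral_nexp [SigmaFinite Λ] (hξ : IsPoissonProcess ξ Λ P) {f : S → ℝ≥0∞}
    (hf : Measurable f) :
    ∫⁻ ω, nexp (∫⁻ x, f x ∂ξ ω) ∂P = nexp (∫⁻ x, (1 - nexp (f x)) ∂Λ) := by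
  have := (hξ.indep 0 (fun _ => ∅) (by simp) (by simp)).isProbabilityMeasure
  -- Restriction to the spanning sets gives all nonzero level sets finite intensity, and the
  -- approximation remains monotone.
  set g : ℕ → SimpleFunc S ℝ≥0∞ := fun n =>
    (SimpleFunc.eapprox f n).restrict (spanningSets Λ n) with hg
  have hgx (n : ℕ) (x : S) : g n x = (spanningSets Λ n).indicator (SimpleFunc.eapprox f n) x := by
    rw [hg, SimpleFunc.restrict_apply _ (measurableSet_spanningSets Λ n)]
  have hmono (x : S) : Monotone fun n => g n x := by
    intro a b hab
    simp only [hgx]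
    exact (indicator_le_indicator_of_subset (monotone_spanningSets Λ hab) (fun _ => zero_le) x).trans
      (indicator_le_indicator (SimpleFunc.monotone_eapprox f hab x))
  have hlim (x : S) : Tendsto (fun n => g n x) atTop (𝓝 (f x)) := by
    refine (SimpleFunc.tendsto_eapprox hf x).congr' ?_
    filter_upwards [eventually_ge_atTop (spanningSetsIndex Λ x)] with n hn
    rw [hgx, indicator_of_mem (mem_spanningSets_of_index_le Λ x hn)]
  have h1 (n : ℕ) := hξ.lintegral_nexp_simpleFunc (g n)
    (fun x => by
      rw [hgx]
      exact ((indicator_le_self' (fun _ _ => zero_le) x).trans_lt (SimpleFunc.eapprox_lt_top f n x)).ne)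
    (fun c hc => by
      refine ((measure_mono fun x hx => ?_).trans_lt (measure_spanningSets_lt_top Λ n)).ne
      by_contra h'
      have hx' : g n x = c := hx
      rw [hgx, indicator_of_notMem h'] at hx'
      exact hc hx'.symm)
  have hint (μ : Measure S) : Tendsto (fun n => ∫⁻ x, g n x ∂μ) atTop (𝓝 (∫⁻ x, f x ∂μ)) :=
    lintegral_tendsto_of_tendsto_of_monotone (fun n => (g n).measurable.aemeasurable)
      (ae_of_all _ hmono) (ae_of_all _ hlim)
  have hL : Tendsto (fun n => ∫⁻ ω, nexp (∫⁻ x, g n x ∂ξ ω) ∂P) atTop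
      (𝓝 (∫⁻ ω, nexp (∫⁻ x, f x ∂ξ ω) ∂P)) := by
    refine tendsto_lintegral_of_dominated_convergence (fun _ => 1) (fun n => ?_)
      (fun n => ae_of_all _ fun ω => nexp_le_one _) (by simp) (ae_of_all _ fun ω => ?_)
    · exact measurable_nexp.comp
        ((Measure.measurable_lintegral (g n).measurable).comp hξ.measurable)
    · exact (continuous_nexp.tendsto _).comp (hint _)
  have hR : Tendsto (fun n => nexp (∫⁻ x, (1 - nexp (g n x)) ∂Λ)) atTop
      (𝓝 (nexp (∫⁻ x, (1 - nexp (f x)) ∂Λ))) := by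
    refine (continuous_nexp.tendsto _).comp ?_
    refine lintegral_tendsto_of_tendsto_of_monotone
      (fun n => (by have := (g n).measurable; fun_prop)) (ae_of_all _ fun x a b hab => ?_)
      (ae_of_all _ fun x => ?_)
    · exact tsub_le_tsub_left (nexp_antitone (hmono x hab)) 1
    · exact ((ENNReal.continuous_sub_left ENNReal.one_ne_top).tendsto _).comp
        ((continuous_nexp.tendsto _).comp (hlim x))
  simp_rw [h1] at hL
  exact tendsto_nhds_unique hL hR

end IsPoissonProcess

/-- Finite sums factor by independence; the countable sum follows by dominated convergence, `nexp`
being continuous also at ∞. -/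
lemma lintegral_nexp_tsum {ι : Type*} [Countable ι] {Ω : Type*} [MeasurableSpace Ω] {P : Measure Ω}
    {X : ι → Ω → ℝ≥0∞} (hX : iIndepFun X P) (hm : ∀ i, Measurable (X i)) {a : ι → ℝ≥0∞}
    (ha : ∀ i, ∫⁻ ω, nexp (X i ω) ∂P = nexp (a i)) :
    ∫⁻ ω, nexp (∑' i, X i ω) ∂P = nexp (∑' i, a i) := by
  have := hX.isProbabilityMeasure
  have h1 (s : Finset ι) : ∫⁻ ω, nexp (∑ i ∈ s, X i ω) ∂P = nexp (∑ i ∈ s, a i) := by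
    simp_rw [nexp_sum]
    refine (lintegral_prod_eq_prod_lintegral_of_indepFun s _
      (hX.comp (fun _ => nexp) fun _ => measurable_nexp) fun i => measurable_nexp.comp (hm i)).trans ?_
    exact Finset.prod_congr rfl fun i _ => ha i
  have hR : Tendsto (fun s : Finset ι => nexp (∑ i ∈ s, a i)) atTop (𝓝 (nexp (∑' i, a i))) :=
    (continuous_nexp.tendsto _).comp ENNReal.summable.hasSum
  have hL : Tendsto (fun s : Finset ι => ∫⁻ ω, nexp (∑ i ∈ s, X i ω) ∂P) atTop
      (𝓝 (∫⁻ ω, nexp (∑' i, X i ω) ∂P)) := by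
    refine tendsto_lintegral_filter_of_dominated_convergence (fun _ => 1)
      (Eventually.of_forall fun s => by fun_prop)
      (Eventually.of_forall fun s => ae_of_all _ fun ω => nexp_le_one _) (by simp)
      (ae_of_all _ fun ω => (continuous_nexp.tendsto _).comp ENNReal.summable.hasSum)
  simp_rw [h1] at hL
  exact tendsto_nhds_unique hL hR

/-! ### Laplace functionals of the cascade -/

lemma _root_.ProbabilityTheory.iIndepFun.indepFun_of_disjoint {ι Ω : Type*} {β : ι → Type*}
    [∀ i, MeasurableSpace (β i)] [MeasurableSpace Ω] {P : Measure Ω} {X : (i : ι) → Ω → β i}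
    (hX : iIndepFun X P) (hm : ∀ i, Measurable (X i)) {S T : Set ι} (hST : Disjoint S T) :
    IndepFun (fun ω (i : S) => X i ω) (fun ω (i : T) => X i ω) P := by
  have h1 (S : Set ι) : MeasurableSpace.comap (fun ω (i : S) => X i ω) MeasurableSpace.pi =
      ⨆ i ∈ S, MeasurableSpace.comap (X i) inferInstance := by
    rw [MeasurableSpace.pi, MeasurableSpace.comap_iSup, iSup_subtype']
    simp_rw [MeasurableSpace.comap_comp]
    rfl
  rw [IndepFun_iff_Indep, h1, h1]
  exact indep_iSup_of_disjoint (fun i => (hm i).comap_le) hX.iIndep hST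

instance : SigmaFinite expIntensity := by
  unfold expIntensity; infer_instance

/-- The map which describes the passage from one level of the cascade to the previous one, for
Laplace functionals. -/
def cascadeStep (γ : ℝ) (f : ℝ → ℝ≥0∞) (y : ℝ) : ℝ≥0∞ :=
  ∫⁻ x, (1 - nexp (f (y + γ * x))) ∂expIntensity

lemma measurable_cascadeStep (γ : ℝ) {f : ℝ → ℝ≥0∞} (hf : Measurable f) :
    Measurable (cascadeStep γ f) :=
  Measurable.lintegral_prod_right' (f := fun z : ℝ × ℝ => 1 - nexp (f (z.1 + γ * z.2)))
    (by fun_prop)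

/-- The composition of the maps `cascadeStep` of the levels `k, …, k + s - 1`. -/
def cascadeIter (γ : ℕ → ℝ) : ℕ → ℕ → (ℝ → ℝ≥0∞) → ℝ → ℝ≥0∞
  | 0, _, f => f
  | s + 1, k, f => cascadeStep (γ k) (cascadeIter γ s (k + 1) f)

lemma measurable_cascadeIter (γ : ℕ → ℝ) (s k : ℕ) {f : ℝ → ℝ≥0∞} (hf : Measurable f) :
    Measurable (cascadeIter γ s k f) := by
  induction s generalizing k with
  | zero => exact hf
  | succ s ih => exact measurable_cascadeStep _ (ih _)

/-- The contribution of the first `s` levels of the cascade to the point with label `β`. -/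
def partialE {m : ℕ} {Ω : Type*} (γ : ℕ → ℝ) (p : (l : Fin m) → (Fin (l : ℕ) → ℕ) → ℕ → Ω → ℝ)
    (s : ℕ) (hs : s ≤ m) (β : Fin s → ℕ) (ω : Ω) : ℝ :=
  ∑ l : Fin s, γ l * p (Fin.castLE hs l) (fun i => β (Fin.castLE l.isLt.le i)) (β l) ω

lemma partialE_snoc {m : ℕ} {Ω : Type*} {p : (l : Fin m) → (Fin (l : ℕ) → ℕ) → ℕ → Ω → ℝ}
    (γ : ℕ → ℝ) {s : ℕ} (hs : s < m) (β : Fin s → ℕ) (j : ℕ) (ω : Ω) :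
    partialE γ p (s + 1) hs (Fin.snoc (α := fun _ => ℕ) β j) ω =
      partialE γ p s hs.le β ω + γ s * p ⟨s, hs⟩ β j ω := by
  rw [partialE, Fin.sum_univ_castSucc, partialE]
  congr 1
  · refine Finset.sum_congr rfl fun l _ => ?_
    rw [Fin.snoc_castSucc]
    congr 2
    ext i
    exact Fin.snoc_castSucc (α := fun _ => ℕ) j β (Fin.castLE l.isLt.le i)
  · rw [Fin.snoc_last]
    congr 2
    ext i
    exact Fin.snoc_castSucc (α := fun _ => ℕ) j β i

namespace IsCascadeFamily

variable {m : ℕ} {Ω : Type*} [MeasurableSpace Ω]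
  {p : (l : Fin m) → (Fin (l : ℕ) → ℕ) → ℕ → Ω → ℝ} {P : Measure Ω}

lemma measurable_partialE (hp : IsCascadeFamily p P) (γ : ℕ → ℝ) (s : ℕ) (hs : s ≤ m)
    (β : Fin s → ℕ) : Measurable (partialE γ p s hs β) :=
  Finset.measurable_sum _ fun _ _ => (hp.measurable _ _ _).const_mul _

lemma measurable_family (hp : IsCascadeFamily p P) (i : (l : Fin m) × (Fin (l : ℕ) → ℕ)) :
    Measurable fun (ω : Ω) (j : ℕ) => p i.1 i.2 j ω :=
  measurable_pi_lambda _ fun _ => hp.measurable _ _ _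

lemma indepFun_partialE (hp : IsCascadeFamily p P) (γ : ℕ → ℝ) {s : ℕ} (hs : s < m) :
    IndepFun (fun ω (β : Fin s → ℕ) => partialE γ p s hs.le β ω)
      (fun ω (β : Fin s → ℕ) (j : ℕ) => p ⟨s, hs⟩ β j ω) P := by
  have h1 := hp.indep.indepFun_of_disjoint hp.measurable_family
    (S := {i | (i.1 : ℕ) < s}) (T := {i | (i.1 : ℕ) = s})
    (Set.disjoint_left.2 fun i hi hi' => by
      have h1 : (i.1 : ℕ) < s := hi
      have h2 : (i.1 : ℕ) = s := hi'
      omega)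
  exact h1.comp
    (φ := fun t (β : Fin s → ℕ) => ∑ l : Fin s, γ l *
      t ⟨⟨Fin.castLE hs.le l, fun i => β (Fin.castLE l.isLt.le i)⟩, l.isLt⟩ (β l))
    (ψ := fun t (β : Fin s → ℕ) => t ⟨⟨⟨s, hs⟩, β⟩, rfl⟩) (by fun_prop) (by fun_prop)

lemma lintegral_nexp_level (hp : IsCascadeFamily p P) (γ : ℝ) {f : ℝ → ℝ≥0∞} (hf : Measurable f)
    {s : ℕ} (hs : s < m) (a : (Fin s → ℕ) → ℝ) :
    ∫⁻ ω, nexp (∑' (β : Fin s → ℕ) (j : ℕ), f (a β + γ * p ⟨s, hs⟩ β j ω)) ∂P =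
      nexp (∑' β, cascadeStep γ f (a β)) := by
  have hind : iIndepFun (fun (β : Fin s → ℕ) ω (j : ℕ) => p ⟨s, hs⟩ β j ω) P :=
    hp.indep.precomp (g := fun β : Fin s → ℕ => (⟨⟨s, hs⟩, β⟩ : (l : Fin m) × (Fin (l : ℕ) → ℕ)))
      fun β β' h => by simpa using h
  refine lintegral_nexp_tsum (X := fun β ω => ∑' j, f (a β + γ * p ⟨s, hs⟩ β j ω))
    (hind.comp (fun β b => ∑' j : ℕ, f (a β + γ * b j)) fun β => by fun_prop)
    (fun β => ?_) fun β => ?_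
  · have := hp.measurable ⟨s, hs⟩ β
    fun_prop
  · rw [cascadeStep, ← (hp.poisson ⟨s, hs⟩ β).lintegral_nexp (f := fun x => f (a β + γ * x))
      (by fun_prop)]
    refine lintegral_congr fun ω => ?_
    rw [lintegral_sum_measure]
    simp_rw [lintegral_dirac]

/-- The first `s` levels are independent of the processes at level `s`. With the former frozen,
`lintegral_nexp_level` integrates out the latter, which are independent Poisson processes. -/
lemma lintegral_nexp_partialE_succ [IsProbabilityMeasure P] (hp : IsCascadeFamily p P) (γ : ℕ → ℝ)
    {f : ℝ → ℝ≥0∞} (hf : Measurable f) {s : ℕ} (hs : s < m) :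
    ∫⁻ ω, nexp (∑' β : Fin (s + 1) → ℕ, f (partialE γ p (s + 1) hs β ω)) ∂P =
      ∫⁻ ω, nexp (∑' β : Fin s → ℕ, cascadeStep (γ s) f (partialE γ p s hs.le β ω)) ∂P := by
  set F : ((Fin s → ℕ) → ℝ) × ((Fin s → ℕ) → ℕ → ℝ) → ℝ≥0∞ := fun z =>
    nexp (∑' (β : Fin s → ℕ) (j : ℕ), f (z.1 β + γ s * z.2 β j)) with hF
  have hFm : Measurable F := by
    refine measurable_nexp.comp (Measurable.tsum fun β => Measurable.tsum fun j => ?_)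
    fun_prop
  have hA : Measurable fun ω (β : Fin s → ℕ) => partialE γ p s hs.le β ω :=
    measurable_pi_lambda _ fun β => hp.measurable_partialE γ s hs.le β
  have hB : Measurable fun ω (β : Fin s → ℕ) (j : ℕ) => p ⟨s, hs⟩ β j ω :=
    measurable_pi_lambda _ fun β => measurable_pi_lambda _ fun j => hp.measurable _ _ _
  have h1 (ω : Ω) : nexp (∑' β : Fin (s + 1) → ℕ, f (partialE γ p (s + 1) hs β ω)) =
      F (fun β => partialE γ p s hs.le β ω, fun β j => p ⟨s, hs⟩ β j ω) := by
    simp only [hF]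
    rw [← (Fin.snocEquiv fun _ : Fin (s + 1) => ℕ).tsum_eq, ENNReal.tsum_prod', ENNReal.tsum_comm]
    simp only [Fin.snocEquiv, Equiv.coe_fn_mk, partialE_snoc]
  simp_rw [h1]
  rw [← lintegral_map (f := F) hFm (hA.prodMk hB),
    (indepFun_iff_map_prod_eq_prod_map_map hA.aemeasurable hB.aemeasurable).1
      (hp.indepFun_partialE γ hs)]
  have := Measure.isProbabilityMeasure_map (μ := P) hB.aemeasurable
  rw [lintegral_prod _ hFm.aemeasurable, lintegral_map (hFm.lintegral_prod_right') hA]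
  refine lintegral_congr fun ω => ?_
  rw [lintegral_map (by fun_prop) hB]
  exact hp.lintegral_nexp_level (γ s) hf hs _

lemma lintegral_nexp_partialE [IsProbabilityMeasure P] (hp : IsCascadeFamily p P) (γ : ℕ → ℝ)
    {f : ℝ → ℝ≥0∞} (hf : Measurable f) (r s : ℕ) (hs : s + r = m) :
    ∫⁻ ω, nexp (∑' β : Fin m → ℕ, f (partialE γ p m le_rfl β ω)) ∂P =
      ∫⁻ ω, nexp (∑' β : Fin s → ℕ, cascadeIter γ r s f (partialE γ p s (by omega) β ω)) ∂P := by
  induction r generalizing s with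
  | zero => obtain rfl : s = m := by omega
            rfl
  | succ r ih =>
    rw [ih (s + 1) (by omega),
      hp.lintegral_nexp_partialE_succ γ (measurable_cascadeIter γ r (s + 1) hf)]
    rfl

/-- The Laplace functional of the image of the cascade under a linear map. -/
theorem lintegral_nexp_cascade [IsProbabilityMeasure P] (hp : IsCascadeFamily p P) (γ : ℕ → ℝ)
    {f : ℝ → ℝ≥0∞} (hf : Measurable f) :
    ∫⁻ ω, nexp (∑' β : Fin m → ℕ, f (partialE γ p m le_rfl β ω)) ∂P =
      nexp (cascadeIter γ m 0 f 0) := by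
  rw [hp.lintegral_nexp_partialE γ hf m 0 (zero_add _)]
  simp [partialE, tsum_fintype]

end IsCascadeFamily

/-! ### Local finiteness of the image of the cascade -/

lemma lintegral_expIntensity {f : ℝ → ℝ≥0∞} (hf : Measurable f) :
    ∫⁻ x, f x ∂expIntensity = ∫⁻ x, ENNReal.ofReal (Real.exp (-x)) * f x := by
  rw [expIntensity, lintegral_withDensity_eq_lintegral_mul _ (by fun_prop) hf]
  rfl

lemma cascadeStep_le {l κ K z : ℝ} (hl : 0 < l) (hlκ : l < κ) (hK : 0 ≤ K) {f : ℝ → ℝ≥0∞}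
    (hf : Measurable f) (hfK : ∀ y, f y ≤ ENNReal.ofReal (K * Real.exp (κ * (y + z)))) (y : ℝ) :
    cascadeStep l⁻¹ f y ≤ ENNReal.ofReal
      ((∫ x, min 1 (K * Real.exp (κ * l⁻¹ * x)) * Real.exp (-x)) * Real.exp (l * (y + z))) := by
  rw [cascadeStep, lintegral_expIntensity (by fun_prop), ← integral_min_exp_shift hl,
    ofReal_integral_eq_lintegral_ofReal (integrable_min_exp_shift hl hlκ hK _)
      (ae_of_all _ fun x => mul_nonneg (le_min zero_le_one (by positivity)) (Real.exp_pos _).le)]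
  refine lintegral_mono fun x => ?_
  rw [mul_comm, ENNReal.ofReal_mul (le_min zero_le_one (by positivity))]
  refine mul_le_mul_left ((one_sub_nexp_le _).trans ?_) _
  rw [ENNReal.ofReal_min, ENNReal.ofReal_one]
  refine min_le_min le_rfl ((hfK _).trans_eq ?_)
  congr 4; ring

namespace OrderParameter

variable {n : ℕ} (D : OrderParameter n) {h : ℝ}

/-- The constants depend neither on `z` nor on `f`. Letting z → -∞ makes the functional small, which
gives local finiteness; z = 0 gives finiteness of the iterates. -/
lemma exists_cascadeIter_le (hh : 0 ≤ h) {κ₀ K₀ : ℝ} (hκ₀ : 0 < κ₀) (hK₀ : 0 ≤ K₀)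
    (hlast : ∀ i, i + 1 = D.m h → D.blockTilt h i < κ₀) (s l : ℕ) (hsl : l + s = D.m h) :
    ∃ κ K, 0 < κ ∧ 0 ≤ K ∧ (∀ i, i + 1 = l → D.blockTilt h i < κ) ∧ ∀ (z : ℝ) (f : ℝ → ℝ≥0∞),
      Measurable f → (∀ y, f y ≤ ENNReal.ofReal (K₀ * Real.exp (κ₀ * (y + z)))) → ∀ y,
        cascadeIter (D.gammaBar h) s l f y ≤ ENNReal.ofReal (K * Real.exp (κ * (y + z))) := by
  induction s generalizing l with
  | zero =>
    obtain rfl : l = D.m h := by omega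
    exact ⟨κ₀, K₀, hκ₀, hK₀, hlast, fun z f _ hf => hf⟩
  | succ s ih =>
    have hl : l < D.m h := by omega
    obtain ⟨κ, K, hκ, hK, hκl, hb⟩ := ih (l + 1) (by omega)
    refine ⟨D.blockTilt h l,
      ∫ x, min 1 (K * Real.exp (κ * (D.blockTilt h l)⁻¹ * x)) * Real.exp (-x),
      D.blockTilt_pos hh hl, ?_, ?_, fun z f hf hfK y => ?_⟩
    · exact integral_nonneg fun x =>
        mul_nonneg (le_min zero_le_one (by positivity)) (Real.exp_pos _).le
    · rintro i rfl
      exact D.tilt_thetaBar_lt hh hl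
    · rw [cascadeIter, D.gammaBar_eq hh hl]
      exact cascadeStep_le (D.blockTilt_pos hh hl) (hκl l rfl) hK (measurable_cascadeIter _ _ _ hf)
        (hb z f hf hfK) y

lemma limitPoints_eq_sum {Ω : Type*} (p : (l : Fin (D.m h)) → (Fin (l : ℕ) → ℕ) → ℕ → Ω → ℝ)
    (ω : Ω) : D.limitPoints h p ω = Measure.sum fun α : Fin (D.m h) → ℕ =>
      Measure.dirac (partialE (D.gammaBar h) p (D.m h) le_rfl α ω) := by
  have hE : Measurable (D.linearE h) := by unfold linearE; fun_prop
  rw [limitPoints, cascade, Measure.map_sum hE.aemeasurable]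
  congr 1
  ext1 α
  exact Measure.map_dirac' hE _

lemma lintegral_limitPoints {Ω : Type*} (p : (l : Fin (D.m h)) → (Fin (l : ℕ) → ℕ) → ℕ → Ω → ℝ)
    (ω : Ω) (f : ℝ → ℝ≥0∞) : ∫⁻ x, f x ∂D.limitPoints h p ω =
      ∑' α : Fin (D.m h) → ℕ, f (partialE (D.gammaBar h) p (D.m h) le_rfl α ω) := by
  rw [limitPoints_eq_sum, lintegral_sum_measure]
  simp_rw [lintegral_dirac]

section

variable {Ω : Type*} [MeasurableSpace Ω] {P : Measure Ω}
  {p : (l : Fin (D.m h)) → (Fin (l : ℕ) → ℕ) → ℕ → Ω → ℝ}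

lemma measurable_limitPoints (hp : IsCascadeFamily p P) : Measurable (D.limitPoints h p) := by
  refine Measure.measurable_of_measurable_coe _ fun s hs => ?_
  simp_rw [limitPoints_eq_sum, Measure.sum_apply _ hs]
  refine Measurable.tsum fun α => ?_
  exact (Measure.measurable_coe hs).comp
    (Measure.measurable_dirac.comp (hp.measurable_partialE _ _ _ α))

lemma lintegral_nexp_limitPoints [IsProbabilityMeasure P] (hp : IsCascadeFamily p P)
    {f : ℝ → ℝ≥0∞} (hf : Measurable f) :
    ∫⁻ ω, nexp (∫⁻ x, f x ∂D.limitPoints h p ω) ∂P =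
      nexp (cascadeIter (D.gammaBar h) (D.m h) 0 f 0) := by
  simp_rw [lintegral_limitPoints]
  exact hp.lintegral_nexp_cascade _ hf

/-- For a small weight ε > 0, E exp(-ε · mass) is at most the probability that the mass is finite,
since an infinite mass contributes 0. With ε = exp(κ₀z) and z → -∞, the bound on the cascade
recursion drives the left side to 1. -/
lemma ae_limitPoints_Icc_lt_top (hh : 0 ≤ h) [IsProbabilityMeasure P] (hp : IsCascadeFamily p P)
    (A : ℝ) : ∀ᵐ ω ∂P, D.limitPoints h p ω (Icc (-A) A) < ∞ := by
  obtain ⟨κ₀, hκ₀, hlast⟩ : ∃ κ₀, 0 < κ₀ ∧ ∀ i, i + 1 = D.m h → D.blockTilt h i < κ₀ := by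
    have hm := D.m_pos hh
    refine ⟨D.blockTilt h (D.m h - 1) + 1, by linarith [D.blockTilt_pos hh (l := D.m h - 1) (by omega)],
      fun i hi => ?_⟩
    rw [show i = D.m h - 1 by omega]
    linarith
  obtain ⟨κ, K, hκ, hK, -, hb⟩ := D.exists_cascadeIter_le hh hκ₀ (Real.exp_pos (κ₀ * A)).le hlast
    (D.m h) 0 (zero_add _)
  have hmeasZ : Measurable fun ω => D.limitPoints h p ω (Icc (-A) A) :=
    (Measure.measurable_coe measurableSet_Icc).comp (D.measurable_limitPoints hp)
  have hset : MeasurableSet {ω | D.limitPoints h p ω (Icc (-A) A) < ∞} :=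
    measurableSet_lt hmeasZ measurable_const
  have hle (z : ℝ) : nexp (ENNReal.ofReal (K * Real.exp (κ * (0 + z)))) ≤
      P {ω | D.limitPoints h p ω (Icc (-A) A) < ∞} := by
    set f : ℝ → ℝ≥0∞ := (Icc (-A) A).indicator fun _ => ENNReal.ofReal (Real.exp (κ₀ * z)) with hf
    have hfm : Measurable f := measurable_const.indicator measurableSet_Icc
    have h1 := hb z f hfm (fun y => by
      refine indicator_apply_le' (fun hy => ENNReal.ofReal_le_ofReal ?_) fun _ => zero_le
      rw [← Real.exp_add, Real.exp_le_exp]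
      nlinarith [hy.1]) 0
    refine (nexp_antitone h1).trans ?_
    rw [← D.lintegral_nexp_limitPoints hp hfm, ← lintegral_indicator_one hset]
    refine lintegral_mono fun ω => ?_
    by_cases hω : D.limitPoints h p ω (Icc (-A) A) < ∞
    · rw [indicator_of_mem (by exact hω)]
      exact nexp_le_one _
    · rw [lintegral_indicator_const measurableSet_Icc, not_lt_top_iff.1 hω,
        ENNReal.mul_top (by simpa using Real.exp_pos _), nexp_top]
      exact zero_le
  have hlim : Tendsto (fun z => nexp (ENNReal.ofReal (K * Real.exp (κ * (0 + z))))) atBot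
      (𝓝 1) := by
    have h1 : Tendsto (fun z : ℝ => K * Real.exp (κ * (0 + z))) atBot (𝓝 0) := by
      have h2 : Tendsto (fun z : ℝ => κ * (0 + z)) atBot atBot := by
        simp_rw [zero_add]; exact tendsto_id.const_mul_atBot hκ
      simpa using (Real.tendsto_exp_atBot.comp h2).const_mul K
    have h3 := (continuous_nexp.tendsto _).comp ((ENNReal.continuous_ofReal.tendsto _).comp h1)
    rwa [ENNReal.ofReal_zero, nexp_zero] at h3
  have h1 : 1 ≤ P {ω | D.limitPoints h p ω (Icc (-A) A) < ∞} :=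
    le_of_tendsto hlim (Eventually.of_forall hle)
  exact (prob_compl_eq_zero_iff hset).2 (le_antisymm prob_le_one h1)

lemma _root_.GREM.isLocallyFiniteMeasure_iff (μ : Measure ℝ) :
    IsLocallyFiniteMeasure μ ↔ ∀ k : ℕ, μ (Icc (-(k : ℝ)) k) < ∞ := by
  refine ⟨fun _ k => measure_Icc_lt_top, fun H => ⟨fun x => ?_⟩⟩
  obtain ⟨k, hk⟩ := exists_nat_gt |x|
  exact ⟨Icc (-(k : ℝ)) k, Icc_mem_nhds (abs_lt.1 hk).1 (abs_lt.1 hk).2, H k⟩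

theorem ae_isLocallyFiniteMeasure_limitPoints (hh : 0 ≤ h) [IsProbabilityMeasure P]
    (hp : IsCascadeFamily p P) : ∀ᵐ ω ∂P, IsLocallyFiniteMeasure (D.limitPoints h p ω) := by
  simp_rw [isLocallyFiniteMeasure_iff]
  exact ae_all_iff.2 fun k => D.ae_limitPoints_Icc_lt_top hh hp k

end

/-! ### The Laplace functionals in terms of real functions -/

/-- The substitution u ↦ 1 - e^{-u} turns the recursion of the cascade into that of the energies.
Finiteness of the iterates is needed to pass from lower integrals to real ones, as a divergent
Bochner integral would be 0. -/
lemma one_sub_nexp_cascadeIter (hh : 0 ≤ h) {κ₀ K₀ : ℝ} (hκ₀ : 0 < κ₀) (hK₀ : 0 ≤ K₀)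
    (hlast : ∀ i, i + 1 = D.m h → D.blockTilt h i < κ₀) {φ : ℝ → ℝ} (hφ : Measurable φ)
    (hφ0 : ∀ x, 0 ≤ φ x) (hφK : ∀ y, φ y ≤ K₀ * Real.exp (κ₀ * y)) (s l : ℕ)
    (hsl : l + s = D.m h) :
    (∀ y, 0 ≤ limitIter (D.gammaBar h) s l (fun x => 1 - Real.exp (-φ x)) y) ∧
    ∀ y, 1 - nexp (cascadeIter (D.gammaBar h) s l (fun x => ENNReal.ofReal (φ x)) y) =
      ENNReal.ofReal (limitIter (D.gammaBar h) s l (fun x => 1 - Real.exp (-φ x)) y) := by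
  induction s generalizing l with
  | zero => exact ⟨fun y => by simpa [limitIter] using hφ0 y, fun y => one_sub_nexp_ofReal (hφ0 y)⟩
  | succ s ih =>
    obtain ⟨hn, hi⟩ := ih (l + 1) (by omega)
    set L := limitIter (D.gammaBar h) s (l + 1) (fun x => 1 - Real.exp (-φ x)) with hL
    set f : ℝ → ℝ≥0∞ := fun x => ENNReal.ofReal (φ x) with hf
    have hfm : Measurable f := by fun_prop
    have hLm : Measurable L := by
      have h1 : L = fun y => (1 - nexp (cascadeIter (D.gammaBar h) s (l + 1) f y)).toReal := by
        ext y
        rw [hi, ENNReal.toReal_ofReal (hn y)]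
      rw [h1]
      have := measurable_cascadeIter (D.gammaBar h) s (l + 1) hfm
      fun_prop
    obtain ⟨κ, K, -, -, -, hb⟩ := D.exists_cascadeIter_le hh hκ₀ hK₀ hlast (s + 1) l hsl
    have hint0 (y : ℝ) : 0 ≤ ∫ x, L (y + D.gammaBar h l * x) * Real.exp (-x) :=
      integral_nonneg fun x => mul_nonneg (hn _) (Real.exp_pos _).le
    have key (y : ℝ) : cascadeIter (D.gammaBar h) (s + 1) l f y =
        ENNReal.ofReal (∫ x, L (y + D.gammaBar h l * x) * Real.exp (-x)) := by
      have h1 : cascadeIter (D.gammaBar h) (s + 1) l f y =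
          ∫⁻ x, ENNReal.ofReal (L (y + D.gammaBar h l * x) * Real.exp (-x)) := by
        have := measurable_cascadeIter (D.gammaBar h) s (l + 1) hfm
        rw [cascadeIter, cascadeStep, lintegral_expIntensity (by fun_prop)]
        refine lintegral_congr fun x => ?_
        rw [hi, ENNReal.ofReal_mul (hn _), mul_comm]
      have hfin : cascadeIter (D.gammaBar h) (s + 1) l f y ≠ ∞ :=
        ((hb 0 f hfm (fun y => ENNReal.ofReal_le_ofReal (by simpa using hφK y)) y).trans_lt
          ENNReal.ofReal_lt_top).ne
      rw [integral_eq_lintegral_of_nonneg_ae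
        (ae_of_all _ fun x => mul_nonneg (hn _) (Real.exp_pos _).le)
        (Measurable.aestronglyMeasurable (by fun_prop)), ← h1, ENNReal.ofReal_toReal hfin]
    refine ⟨fun y => ?_, fun y => ?_⟩
    · simpa [limitIter, limitStep] using hint0 y
    · rw [key, one_sub_nexp_ofReal (hint0 y)]
      rfl

end OrderParameter

/-! ### The vague topology -/

/-- The product of a continuous function with the cut-off function which is `1` on `[-k, k]` and
`0` outside `[-(k + 1), k + 1]`. -/
def cutoff (k : ℕ) (f : C(ℝ, ℝ)) : C_c(ℝ, ℝ) where
  toFun x := max 0 (min 1 (k + 1 - |x|)) * f x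
  continuous_toFun := by fun_prop
  hasCompactSupport' := by
    refine HasCompactSupport.mul_right (HasCompactSupport.intro (isCompact_Icc (a := -((k : ℝ) + 1))
      (b := k + 1)) fun x hx => ?_)
    have h1 : (k : ℝ) + 1 < |x| := by
      by_contra h'
      exact hx (abs_le.1 (not_lt.1 h'))
    rw [max_eq_left]
    exact (min_le_right _ _).trans (by linarith)

lemma cutoff_apply (k : ℕ) (f : C(ℝ, ℝ)) (x : ℝ) :
    cutoff k f x = max 0 (min 1 (k + 1 - |x|)) * f x := rfl

/-- A countable family of continuous functions. -/
def testFun : Option (ℕ × Bool) → C(ℝ, ℝ)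
  | none => 1
  | some (j, true) => TopologicalSpace.denseSeq C(ℝ, ℝ) j ⊔ 0
  | some (j, false) => (-TopologicalSpace.denseSeq C(ℝ, ℝ) j) ⊔ 0

lemma testFun_nonneg (i : Option (ℕ × Bool)) (x : ℝ) : 0 ≤ testFun i x := by
  match i with
  | none => exact zero_le_one
  | some (j, true) => exact le_max_right _ _
  | some (j, false) => exact le_max_right _ _

/-- A countable family of nonnegative continuous functions with compact support which determines
the vague topology. -/
def testFamily (i : ℕ × Option (ℕ × Bool)) : C_c(ℝ, ℝ) := cutoff i.1 (testFun i.2)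

lemma testFamily_nonneg (i : ℕ × Option (ℕ × Bool)) (x : ℝ) : 0 ≤ testFamily i x :=
  mul_nonneg (le_max_left _ _) (testFun_nonneg _ _)

namespace LocFinMeasure

instance (μ : LocFinMeasure) : IsLocallyFiniteMeasure μ.toMeasure := μ.locFin

lemma integrable (μ : LocFinMeasure) (φ : C_c(ℝ, ℝ)) : Integrable φ μ.toMeasure :=
  φ.continuous.integrable_of_hasCompactSupport φ.hasCompactSupport

/-- Approximate φ uniformly on a compact interval by a member of the dense sequence, split into
positive and negative parts. The error is at most δ times the integral of the cut-off function
(index `none`), which is itself continuous and hence locally bounded. -/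
lemma continuous_integral_of_testFamily {X : Type*} [TopologicalSpace X] {μ : X → LocFinMeasure}
    (H : ∀ i, Continuous fun x => ∫ y, testFamily i y ∂(μ x).toMeasure) (φ : C_c(ℝ, ℝ)) :
    Continuous fun x => ∫ y, φ y ∂(μ x).toMeasure := by
  obtain ⟨k, hk⟩ : ∃ k : ℕ, ∀ y, φ y ≠ 0 → |y| ≤ k := by
    obtain ⟨r, hr⟩ := φ.hasCompactSupport.isCompact.isBounded.subset_closedBall 0
    obtain ⟨k, hk⟩ := exists_nat_ge r
    refine ⟨k, fun y hy => ?_⟩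
    have := hr (subset_tsupport _ hy)
    rw [mem_closedBall_zero_iff, Real.norm_eq_abs] at this
    exact this.trans hk
  rw [continuous_iff_continuousAt]
  intro x₀
  rw [ContinuousAt, Metric.tendsto_nhds]
  intro ε hε
  set F : X → ℝ := fun x => ∫ y, testFamily (k, none) y ∂(μ x).toMeasure with hF
  have hF0 : 0 ≤ F x₀ := integral_nonneg fun y => testFamily_nonneg _ _
  set C := F x₀ + 1 with hC
  have hC0 : 0 < C := by linarith
  set δ := ε / (4 * C) with hδ
  have hδ0 : 0 < δ := by positivity
  obtain ⟨j, hj⟩ : ∃ j, ∀ y ∈ Icc (-((k : ℝ) + 1)) (k + 1),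
      dist (φ y) (TopologicalSpace.denseSeq C(ℝ, ℝ) j y) < δ := by
    have h1 := (ContinuousMap.tendsto_iff_forall_isCompact_tendstoUniformlyOn.1
      (tendsto_id (x := 𝓝 φ.toContinuousMap))) (Icc (-((k : ℝ) + 1)) (k + 1)) isCompact_Icc
    have h2 := Metric.tendstoUniformlyOn_iff.1 h1 δ hδ0
    exact (TopologicalSpace.denseRange_denseSeq C(ℝ, ℝ)).mem_nhds h2
  set g := TopologicalSpace.denseSeq C(ℝ, ℝ) j with hg
  set G : X → ℝ := fun x => ∫ y, testFamily (k, some (j, true)) y ∂(μ x).toMeasure -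
    ∫ y, testFamily (k, some (j, false)) y ∂(μ x).toMeasure with hG
  have hGc : Continuous G := (H _).sub (H _)
  have hφG (x : X) : |∫ y, φ y ∂(μ x).toMeasure - G x| ≤ δ * F x := by
    simp only [hG, hF]
    have hd : Integrable (fun y => testFamily (k, some (j, true)) y -
        testFamily (k, some (j, false)) y) (μ x).toMeasure :=
      ((μ x).integrable _).sub ((μ x).integrable _)
    rw [← integral_sub ((μ x).integrable _) ((μ x).integrable _),
      ← integral_sub ((μ x).integrable _) hd,
      ← integral_const_mul, ← Real.norm_eq_abs]
    refine norm_integral_le_of_norm_le (((μ x).integrable _).const_mul _) (ae_of_all _ fun y => ?_)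
    have e1 : testFamily (k, some (j, true)) y - testFamily (k, some (j, false)) y =
        max 0 (min 1 (k + 1 - |y|)) * g y := by
      simp only [testFamily, cutoff_apply, testFun, ← mul_sub]
      congr 1
      change max (g y) 0 - max (-g y) 0 = g y
      exact max_zero_sub_max_neg_zero_eq_self (g y)
    have e2 : testFamily (k, none) y = max 0 (min 1 (k + 1 - |y|)) := by
      simp [testFamily, cutoff_apply, testFun]
    have e3 : φ y = max 0 (min 1 (k + 1 - |y|)) * φ y := by
      by_cases h0 : φ y = 0
      · simp [h0]
      · have := hk y h0
        rw [min_eq_left (by linarith), max_eq_right zero_le_one, one_mul]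
    rw [e1, e2, e3, ← mul_sub, norm_mul, Real.norm_of_nonneg (le_max_left _ _), mul_comm]
    by_cases hy : |y| ≤ k + 1
    · exact mul_le_mul_of_nonneg_right (hj y (abs_le.1 hy)).le (le_max_left _ _)
    · rw [max_eq_left ((min_le_right _ _).trans (by linarith)), mul_zero, mul_zero]
  have h1 : ∀ᶠ x in 𝓝 x₀, F x < C := ((H _).tendsto x₀).eventually_lt_const (by linarith)
  have h2 : ∀ᶠ x in 𝓝 x₀, dist (G x) (G x₀) < ε / 2 :=
    Metric.tendsto_nhds.1 (hGc.tendsto x₀) (ε / 2) (by positivity)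
  filter_upwards [h1, h2] with x hx1 hx2
  have a1 := abs_le.1 (hφG x)
  have a2 := abs_le.1 (hφG x₀)
  rw [Real.dist_eq] at hx2 ⊢
  have a3 := abs_lt.1 hx2
  have a4 : δ * F x < ε / 4 := by
    calc δ * F x < δ * C := by gcongr
      _ = ε / 4 := by rw [hδ]; field_simp
  have a5 : δ * F x₀ < ε / 4 := by
    calc δ * F x₀ < δ * C := by gcongr; linarith
      _ = ε / 4 := by rw [hδ]; field_simp
  rw [abs_lt]
  constructor <;> linarith [a1.1, a1.2, a2.1, a2.2, a3.1, a3.2]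

lemma continuous_integral (φ : C_c(ℝ, ℝ)) :
    Continuous fun μ : LocFinMeasure => ∫ x, φ x ∂μ.toMeasure :=
  continuous_iInf_dom (i := φ) continuous_induced_dom

/-- The integrals of the test functions. -/
def testIntegrals (μ : LocFinMeasure) (i : ℕ × Option (ℕ × Bool)) : ℝ :=
  ∫ x, testFamily i x ∂μ.toMeasure

/-- Countably many test functions induce the vague topology. Borel measurability thus reduces to
countably many integrals, the target being a countable product of lines. -/
lemma isInducing_testIntegrals : IsInducing testIntegrals := by
  refine ⟨le_antisymm ?_ ?_⟩
  · exact (continuous_pi fun i => continuous_integral (testFamily i)).le_induced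
  · refine le_iInf fun φ => ?_
    rw [← continuous_iff_le_induced]
    let _ : TopologicalSpace LocFinMeasure := TopologicalSpace.induced testIntegrals inferInstance
    exact continuous_integral_of_testFamily (μ := id)
      (fun i => (continuous_apply i).comp continuous_induced_dom) φ

lemma measurable_of_integral {Ω : Type*} [MeasurableSpace Ω] {X : Ω → LocFinMeasure}
    (H : ∀ φ : C_c(ℝ, ℝ), (∀ x, 0 ≤ φ x) → Measurable fun ω => ∫ x, φ x ∂(X ω).toMeasure) :
    Measurable X := by
  refine measurable_of_isOpen fun U hU => ?_
  obtain ⟨V, hV, rfl⟩ := isInducing_testIntegrals.isOpen_iff.1 hU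
  have h1 : Measurable (testIntegrals ∘ X) :=
    measurable_pi_lambda _ fun i => H _ (testFamily_nonneg i)
  exact h1 hV.measurableSet

/-- The Laplace functionals at the test functions. -/
def testLaplace (μ : LocFinMeasure) (i : ℕ × Option (ℕ × Bool)) : Icc (0 : ℝ) 1 :=
  ⟨Real.exp (-∫ x, testFamily i x ∂μ.toMeasure), (Real.exp_pos _).le,
    Real.exp_le_one_iff.2 (neg_nonpos.2 (integral_nonneg (testFamily_nonneg i)))⟩

lemma isInducing_testLaplace : IsInducing testLaplace := by
  have h1 : IsInducing fun (u : ℕ × Option (ℕ × Bool) → ℝ) i => Real.exp (-u i) :=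
    IsInducing.piMap fun _ => (Real.isOpenEmbedding_exp.isEmbedding.comp
      (Homeomorph.neg ℝ).isEmbedding).isInducing
  have h2 := h1.comp isInducing_testIntegrals
  refine IsInducing.of_comp (f := testLaplace)
    (g := fun (u : ℕ × Option (ℕ × Bool) → Icc (0 : ℝ) 1) i => (u i : ℝ)) ?_ (by fun_prop) h2
  refine continuous_pi fun i => Continuous.subtype_mk ?_ _
  exact Real.continuous_exp.comp (continuous_integral _).neg

end LocFinMeasure

/-! ### Convergence in distribution from Laplace functionals -/

namespace LocFinMeasure

/-- The coordinate functions on the cube, as bounded continuous functions. -/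
def cubeCoord (i : ℕ × Option (ℕ × Bool)) :
    BoundedContinuousFunction (ℕ × Option (ℕ × Bool) → Icc (0 : ℝ) 1) ℝ :=
  BoundedContinuousFunction.mkOfCompact ⟨fun u => (u i : ℝ), by fun_prop⟩

/-- A product of exponentials is the exponential of a sum, so monomials in the coordinates of the
cube are again Laplace functionals at nonnegative test functions. -/
lemma exists_eq_exp_of_mem_closure
    {f : BoundedContinuousFunction (ℕ × Option (ℕ × Bool) → Icc (0 : ℝ) 1) ℝ}
    (hf : f ∈ Submonoid.closure (range cubeCoord)) :
    ∃ φ : C_c(ℝ, ℝ), (∀ x, 0 ≤ φ x) ∧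
      ∀ μ : LocFinMeasure, f (testLaplace μ) = Real.exp (-∫ x, φ x ∂μ.toMeasure) := by
  induction hf using Submonoid.closure_induction with
  | mem f hf =>
    obtain ⟨i, rfl⟩ := hf
    exact ⟨testFamily i, testFamily_nonneg i, fun μ => rfl⟩
  | one => exact ⟨0, fun x => le_rfl, fun μ => by simp⟩
  | mul f g _ _ hf hg =>
    obtain ⟨φ, hφ, hf⟩ := hf
    obtain ⟨χ, hχ, hg⟩ := hg
    refine ⟨φ + χ, fun x => add_nonneg (hφ x) (hχ x), fun μ => ?_⟩
    have h1 : ∫ x, (φ + χ) x ∂μ.toMeasure = ∫ x, φ x ∂μ.toMeasure + ∫ x, χ x ∂μ.toMeasure :=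
      integral_add (μ.integrable φ) (μ.integrable χ)
    rw [BoundedContinuousFunction.mul_apply, hf, hg, h1, neg_add, Real.exp_add]

lemma measurable_testLaplace : Measurable testLaplace :=
  isInducing_testLaplace.continuous.measurable

/-- Convergence of Laplace functionals implies convergence in distribution. -/
theorem tendstoInDistribution_of_laplace {ι Ω Ω' : Type*} [MeasurableSpace Ω] [MeasurableSpace Ω']
    {l : Filter ι} [l.IsCountablyGenerated]
    {P : Measure Ω} [IsProbabilityMeasure P] {P' : Measure Ω'} [IsProbabilityMeasure P']
    {X : ι → Ω → LocFinMeasure} {Z : Ω' → LocFinMeasure} (hX : ∀ a, AEMeasurable (X a) P)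
    (hZ : AEMeasurable Z P')
    (H : ∀ φ : C_c(ℝ, ℝ), (∀ x, 0 ≤ φ x) →
      Tendsto (fun a => ∫ ω, Real.exp (-∫ x, φ x ∂(X a ω).toMeasure) ∂P) l
        (𝓝 (∫ ω, Real.exp (-∫ x, φ x ∂(Z ω).toMeasure) ∂P'))) :
    TendstoInDistribution X l Z (fun _ => P) P' := by
  refine ⟨hX, hZ, ?_⟩
  have hLX (a) : AEMeasurable (fun ω => testLaplace (X a ω)) P :=
    measurable_testLaplace.comp_aemeasurable (hX a)
  have hLZ : AEMeasurable (fun ω => testLaplace (Z ω)) P' :=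
    measurable_testLaplace.comp_aemeasurable hZ
  let νX (a : ι) : ProbabilityMeasure (ℕ × Option (ℕ × Bool) → Icc (0 : ℝ) 1) :=
    ⟨P.map fun ω => testLaplace (X a ω), Measure.isProbabilityMeasure_map (hLX a)⟩
  let νZ : ProbabilityMeasure (ℕ × Option (ℕ × Bool) → Icc (0 : ℝ) 1) :=
    ⟨P'.map fun ω => testLaplace (Z ω), Measure.isProbabilityMeasure_map hLZ⟩
  have key : Tendsto νX l (𝓝 νZ) := by
    -- The algebra generated by the coordinates separates the points of the cube. Tightness is
    -- automatic by compactness, and on monomials convergence is the hypothesis `H`.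
    let A : StarSubalgebra ℝ
        (BoundedContinuousFunction (ℕ × Option (ℕ × Bool) → Icc (0 : ℝ) 1) ℝ) :=
      { Algebra.adjoin ℝ (range cubeCoord) with
        star_mem' := fun {f} hf => by
          have : star f = f := by ext; simp
          rwa [this] }
    refine ProbabilityMeasure.tendsto_of_tight_of_separatesPoints ℝ
      IsTightMeasureSet.of_compactSpace (A := A) ?_ ?_
    · intro u v huv
      obtain ⟨i, hi⟩ := Function.ne_iff.1 huv
      refine ⟨cubeCoord i, ⟨BoundedContinuousFunction.toContinuousMapStarₐ ℝ (cubeCoord i),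
        ⟨cubeCoord i, Algebra.subset_adjoin (mem_range_self i), rfl⟩, rfl⟩, ?_⟩
      exact fun h => hi (Subtype.ext h)
    · intro f hf
      have hf' : f ∈ Submodule.span ℝ
          (Submonoid.closure (range cubeCoord) : Set (BoundedContinuousFunction _ ℝ)) := by
        rw [← Algebra.adjoin_eq_span]
        exact hf
      clear hf
      induction hf' using Submodule.span_induction with
      | mem f hf =>
        obtain ⟨φ, hφ, hf⟩ := exists_eq_exp_of_mem_closure hf
        have e1 (a : ι) : ∫ x, f x ∂(νX a : Measure _) =
            ∫ ω, Real.exp (-∫ x, φ x ∂(X a ω).toMeasure) ∂P := by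
          simp only [← hf]
          exact integral_map (hLX a) f.continuous.aestronglyMeasurable
        have e2 : ∫ x, f x ∂(νZ : Measure _) =
            ∫ ω, Real.exp (-∫ x, φ x ∂(Z ω).toMeasure) ∂P' := by
          simp only [← hf]
          exact integral_map hLZ f.continuous.aestronglyMeasurable
        simp only [e1, e2]
        exact H φ hφ
      | zero => simpa using tendsto_const_nhds
      | add f g _ _ hf hg =>
        simp only [BoundedContinuousFunction.add_apply]
        simp only [integral_add (f.integrable _) (g.integrable _)]
        exact hf.add hg
      | smul c f _ hf =>
        simp only [BoundedContinuousFunction.smul_apply, smul_eq_mul, integral_const_mul]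
        exact hf.const_mul c
  -- Every vaguely open set is the preimage of an open set of the cube, so the portmanteau criterion
  -- pulls back. The image of `testLaplace` need not be closed or measurable.
  refine tendsto_of_forall_isOpen_le_liminf' fun U hU => ?_
  obtain ⟨V, hV, rfl⟩ := isInducing_testLaplace.isOpen_iff.1 hU
  have h1 := ProbabilityMeasure.le_liminf_measure_open_of_tendsto key hV
  have e1 (a : ι) : P.map (X a) (testLaplace ⁻¹' V) = (νX a : Measure _) V := by
    rw [← Measure.map_apply measurable_testLaplace hV.measurableSet,
      AEMeasurable.map_map_of_aemeasurable measurable_testLaplace.aemeasurable (hX a)]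
    rfl
  have e2 : P'.map Z (testLaplace ⁻¹' V) = (νZ : Measure _) V := by
    rw [← Measure.map_apply measurable_testLaplace hV.measurableSet,
      AEMeasurable.map_map_of_aemeasurable measurable_testLaplace.aemeasurable hZ]
    rfl
  simp only [ProbabilityMeasure.coe_mk, e1, e2]
  exact h1

end LocFinMeasure

/-- Compact support allows every exponent κ: this starts the recursion of exponential bounds at the
last block. -/
lemma exists_le_mul_exp (φ : C_c(ℝ, ℝ)) (κ : ℝ) :
    ∃ K, 1 ≤ K ∧ ∀ x, φ x ≤ K * Real.exp (κ * x) := by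
  obtain ⟨C, hC⟩ := (φ.hasCompactSupport.mul_right
    (f' := fun x => Real.exp (-(κ * x)))).exists_bound_of_continuous
      (φ.continuous.mul (by fun_prop))
  refine ⟨max 1 C, le_max_left _ _, fun x => ?_⟩
  have h1 : φ x * Real.exp (-(κ * x)) ≤ max 1 C :=
    (le_abs_self _).trans ((hC x).trans (le_max_right _ _))
  rwa [Real.exp_neg, ← div_eq_mul_inv, div_le_iff₀ (Real.exp_pos _)] at h1

open Classical in
lemma LocFinMeasure.integral_ofMeasure (μ : Measure ℝ) {φ : C_c(ℝ, ℝ)} (hφ : ∀ x, 0 ≤ φ x) :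
    ∫ x, φ x ∂(ofMeasure μ).toMeasure =
      if IsLocallyFiniteMeasure μ then (∫⁻ x, ENNReal.ofReal (φ x) ∂μ).toReal else 0 := by
  split_ifs with hμ
  · simp only [ofMeasure, dif_pos hμ]
    exact integral_eq_lintegral_of_nonneg_ae (ae_of_all _ hφ)
      φ.continuous.measurable.aestronglyMeasurable
  · simp [ofMeasure, dif_neg hμ]

namespace OrderParameter

variable {n : ℕ} (D : OrderParameter n) {h : ℝ}

/-! ### Convergence of the energy point process -/

lemma integral_energyPoints {N : ℕ} (g : Config N → ℝ) (φ : C_c(ℝ, ℝ)) :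
    ∫ x, φ x ∂(D.energyPoints h g).toMeasure = ∑ σ, φ (D.scalingInv h N (energy h g σ)) := by
  have h1 : (D.energyPoints h g).toMeasure =
      ∑ σ, Measure.dirac (D.scalingInv h N (energy h g σ)) := rfl
  rw [h1, integral_finsetSum_measure (f := φ) fun σ _ =>
    φ.continuous.integrable_of_hasCompactSupport φ.hasCompactSupport]
  simp

lemma measurable_energyPoints (N : ℕ) :
    Measurable fun g : Config N → ℝ => D.energyPoints h g := by
  refine LocFinMeasure.measurable_of_integral fun φ _ => ?_
  simp only [integral_energyPoints]
  refine Finset.measurable_sum _ fun σ _ => φ.continuous.measurable.comp ?_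
  have := measurable_energy (h := h) (N := N) σ
  unfold scalingInv
  fun_prop

lemma aemeasurable_energyPoints {Ω : Type*} [MeasurableSpace Ω] {P : Measure Ω} {N : ℕ}
    {g : Config N → Ω → ℝ} (hg : D.IsGREM N g P) :
    AEMeasurable (fun ω => D.energyPoints h fun σ => g σ ω) P :=
  (D.measurable_energyPoints N).comp_aemeasurable
    (aemeasurable_pi_lambda _ fun σ => hg.gaussian.aemeasurable σ)

lemma exp_neg_integral_energyPoints {N : ℕ} (g : Config N → ℝ) (φ : C_c(ℝ, ℝ)) :
    Real.exp (-∫ x, φ x ∂(D.energyPoints h g).toMeasure) =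
      ∏ σ, Real.exp (-φ (D.scalingInv h N (energy h g σ))) := by
  rw [integral_energyPoints, ← Finset.sum_neg_distrib, Real.exp_sum]

variable {Ω : Type*} [MeasurableSpace Ω] {P : Measure Ω}
  {p : (l : Fin (D.m h)) → (Fin (l : ℕ) → ℕ) → ℕ → Ω → ℝ}

lemma measurable_ofMeasure_limitPoints (hp : IsCascadeFamily p P) :
    Measurable fun ω => LocFinMeasure.ofMeasure (D.limitPoints h p ω) := by
  have hm := D.measurable_limitPoints hp
  refine LocFinMeasure.measurable_of_integral fun φ hφ => ?_
  have hs : MeasurableSet {ω | IsLocallyFiniteMeasure (D.limitPoints h p ω)} := by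
    simp_rw [isLocallyFiniteMeasure_iff]
    refine MeasurableSet.congr (MeasurableSet.iInter fun k : ℕ => measurableSet_lt
      ((Measure.measurable_coe (measurableSet_Icc (a := -(k : ℝ)) (b := k))).comp hm)
      (measurable_const (a := ∞))) ?_
    ext ω
    simp
  have h1 : Measurable fun ω => (∫⁻ x, ENNReal.ofReal (φ x) ∂D.limitPoints h p ω).toReal :=
    ((Measure.measurable_lintegral
      (φ.continuous.measurable.ennreal_ofReal)).comp hm).ennreal_toReal
  classical
  simp_rw [LocFinMeasure.integral_ofMeasure _ hφ]
  exact Measurable.ite hs h1 measurable_const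

/-- Almost sure local finiteness makes the replacement by `ofMeasure` invisible, so the Laplace
functional of the cascade can be evaluated and rewritten as the limit found for the energies. -/
lemma integral_exp_neg_limitPoints (hh : 0 ≤ h) [IsProbabilityMeasure P]
    (hp : IsCascadeFamily p P) (φ : C_c(ℝ, ℝ)) (hφ : ∀ x, 0 ≤ φ x) :
    ∫ ω, Real.exp (-∫ x, φ x ∂(LocFinMeasure.ofMeasure (D.limitPoints h p ω)).toMeasure) ∂P =
      1 - limitIter (D.gammaBar h) (D.m h) 0 (fun x => 1 - Real.exp (-φ x)) 0 := by
  have hφm : Measurable φ := φ.continuous.measurable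
  have hlam := D.blockTilt_pos hh (l := D.m h - 1) (by have := D.m_pos hh; omega)
  obtain ⟨K, hK, hφK⟩ := exists_le_mul_exp φ (D.blockTilt h (D.m h - 1) + 1)
  obtain ⟨hn, hi⟩ := D.one_sub_nexp_cascadeIter hh (by linarith) (by linarith) (fun i hi => by
    rw [show i = D.m h - 1 by omega]
    linarith) hφm hφ hφK (D.m h) 0 (zero_add _)
  have h1 := D.lintegral_nexp_limitPoints hp hφm.ennreal_ofReal
  have hm := D.measurable_limitPoints hp
  have h2 : ∀ᵐ ω ∂P, ENNReal.ofReal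
      (Real.exp (-∫ x, φ x ∂(LocFinMeasure.ofMeasure (D.limitPoints h p ω)).toMeasure)) =
        nexp (∫⁻ x, ENNReal.ofReal (φ x) ∂D.limitPoints h p ω) := by
    filter_upwards [D.ae_isLocallyFiniteMeasure_limitPoints hh hp] with ω hω
    have h3 : (LocFinMeasure.ofMeasure (D.limitPoints h p ω)).toMeasure = D.limitPoints h p ω := by
      simp only [LocFinMeasure.ofMeasure, dif_pos hω]
    rw [h3, ← nexp_ofReal (integral_nonneg hφ), ofReal_integral_eq_lintegral_ofReal (f := φ)
      (φ.continuous.integrable_of_hasCompactSupport φ.hasCompactSupport) (ae_of_all _ hφ)]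
  have hmeas : Measurable fun ω =>
      ∫ x, φ x ∂(LocFinMeasure.ofMeasure (D.limitPoints h p ω)).toMeasure :=
    (LocFinMeasure.continuous_integral φ).measurable.comp (D.measurable_ofMeasure_limitPoints hp)
  have h4 : nexp (cascadeIter (D.gammaBar h) (D.m h) 0 (fun x => ENNReal.ofReal (φ x)) 0) =
      1 - ENNReal.ofReal
        (limitIter (D.gammaBar h) (D.m h) 0 (fun x => 1 - Real.exp (-φ x)) 0) := by
    rw [← hi, ENNReal.sub_sub_cancel ENNReal.one_ne_top (nexp_le_one _)]
  have h5 : ENNReal.ofReal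
      (limitIter (D.gammaBar h) (D.m h) 0 (fun x => 1 - Real.exp (-φ x)) 0) ≤ 1 := by
    rw [← hi]
    exact tsub_le_self
  rw [integral_eq_lintegral_of_nonneg_ae (ae_of_all _ fun ω => (Real.exp_pos _).le)
    (Measurable.aestronglyMeasurable (by fun_prop)), lintegral_congr_ae h2, h1, h4,
    ENNReal.toReal_sub_of_le h5 ENNReal.one_ne_top, ENNReal.toReal_one,
    ENNReal.toReal_ofReal (hn 0)]

/-- Convergence of the point processes of the energies to the image of the cascade. -/
theorem tendstoInDistribution_energyPoints (hh : 0 ≤ h) (hs : D.StrictBlocks h)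
    {N : ℕ → ℕ} (hN : Tendsto N atTop atTop)
    (hdiv : ∀ a, ∀ k ≤ n, ∃ r : ℕ, D.x k * (N a : ℝ) = r)
    [IsProbabilityMeasure P] (hp : IsCascadeFamily p P)
    {Ω₀ : Type*} [MeasurableSpace Ω₀] {P₀ : Measure Ω₀} [IsProbabilityMeasure P₀]
    {g : (a : ℕ) → Config (N a) → Ω₀ → ℝ} (hg : ∀ a, D.IsGREM (N a) (g a) P₀) :
    TendstoInDistribution (fun a ω => D.energyPoints h (fun σ => g a σ ω)) atTop
      (fun ω => LocFinMeasure.ofMeasure (D.limitPoints h p ω)) (fun _ => P₀) P := by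
  refine LocFinMeasure.tendstoInDistribution_of_laplace
    (fun a => D.aemeasurable_energyPoints (hg a))
    (D.measurable_ofMeasure_limitPoints hp).aemeasurable fun φ hφ => ?_
  rw [D.integral_exp_neg_limitPoints hh hp φ hφ]
  simp_rw [exp_neg_integral_energyPoints]
  have hφm : Measurable φ := φ.continuous.measurable
  refine D.tendsto_integral_prod hh hs hN hdiv hg (ψ := fun x => Real.exp (-φ x)) (by fun_prop)
    (fun x => ⟨(Real.exp_pos _).le, Real.exp_le_one_iff.2 (neg_nonpos.2 (hφ x))⟩) fun κ _ => ?_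
  obtain ⟨K, hK, hφK⟩ := exists_le_mul_exp φ κ
  exact ⟨K, hK, fun x => by linarith [hφK x, Real.add_one_le_exp (-φ x)]⟩

end OrderParameter

end GREM

end

/-! ### The main theorem -/

theorem mainTheorem1 {n : ℕ} (D : GREM.OrderParameter n) {h : ℝ} (hh : 0 ≤ h)
    (N : ℕ → ℕ) (hN : StrictMono N)
    (hdiv : ∀ α, ∀ k ≤ n, ∃ r : ℕ, D.x k * (N α : ℝ) = r)
    {Ω : Type*} [MeasurableSpace Ω] (P : Measure Ω) [IsProbabilityMeasure P]
    (g : (α : ℕ) → GREM.Config (N α) → Ω → ℝ)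
    (hg : ∀ α, D.IsGREM (N α) (g α) P) :
    (∀ {Ω' : Type*} [MeasurableSpace Ω'] (P' : Measure Ω') [IsProbabilityMeasure P']
      (p : (l : Fin (D.m h)) → (Fin (l : ℕ) → ℕ) → ℕ → Ω' → ℝ),
      GREM.IsCascadeFamily p P' →
        (∀ᵐ ω ∂P', IsLocallyFiniteMeasure (D.limitPoints h p ω)) ∧
        (D.StrictBlocks h →
          TendstoInDistribution
            (fun α ω => D.energyPoints h (fun σ => g α σ ω)) atTop
            (fun ω => GREM.LocFinMeasure.ofMeasure (D.limitPoints h p ω))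
            (fun _ => P) P')) ∧
    (∀ᵐ ω ∂P, Tendsto (fun α => GREM.groundState h (fun σ => g α σ ω)) atTop
      (𝓝 (D.limitGroundState h))) ∧
    Tendsto (fun α => eLpNorm
      (fun ω => GREM.groundState h (fun σ => g α σ ω) - D.limitGroundState h) 1 P) atTop
      (𝓝 0) := by
  have hN' := hN.tendsto_atTop
  refine ⟨fun {Ω'} _ P' _ p hp => ⟨D.ae_isLocallyFiniteMeasure_limitPoints hh hp, fun hs =>
    D.tendstoInDistribution_energyPoints hh hs hN' hdiv hp hg⟩,
    D.ae_tendsto_groundState hh hN hdiv P g hg,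
    D.tendsto_eLpNorm_groundState hh hN hdiv P g hg⟩
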